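/- **Setting.** Let $M$ be a smooth 4-manifold, $C^\infty=C^\infty(M)$, and let $W$ be a free $C^\infty$-module of rank 4 with a conformal inner product of signature $-+++$ (a class $[g]$ of symmetric bilinear forms up to positive functions) that admits conformally orthonormal bases $\theta_0,\dots,\theta_3$ (some $g\in[g]$ has matrix $\mathrm{diag}(-1,1,1,1)$). Tensor products are over $C^\infty$; wedges are omitted. *The graded Lie algebra (gLa).* $\mathrm{CDerEnd}(W)$ consists of pairs $(D,\delta)$, $D\in\mathrm{Der}(C^\infty)$ and $\delta:W\to W$ additive, with $\delta(fw)=D(f)w+f\delta(w)$ and, for every $g\in[g]$, $D(g(w,w'))=g(\delta w,w')+g(w,\delta w')+h\,g(w,w')$ for some $h\in C^\infty$. It acts on $\wedge W$ and on $\Omega=\wedge^4W$ by derivations. Let $\mathcal L=\wedge W\otimes\mathrm{CDerEnd}(W)$, graded by the degree in $\wedge W$, with bracket $$[\omega\delta,\omega'\delta']=\omega\omega'[\delta,\delta']+\omega\,\delta(\omega')\,\delta'-(-1)^{|\omega||\omega'|}\omega'\,\delta'(\omega)\,\delta ,$$ and representation on $X=\wedge W\oplus(\wedge W\otimes\Omega)$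 given by $\omega\delta\cdot\omega'=\omega\,\delta(\omega')$ (the anchor) and $\omega\delta\cdot(\omega'\otimes z)=\omega\,\delta(\omega')\otimes z+\omega\omega'\otimes\delta(z)$. Let $\mathcal I\subset\mathcal L$ be the $\wedge W$-submodule generated by the algebraic Weyl tensors, i.e. the elements of $\wedge^2W\otimes\mathrm{CDerEnd}(W)$ that act by zero on $X$ and whose Ricci contraction vanishes (the Ricci contraction of $\omega\delta$ at $w\in W$ is the interior product of $\omega$ with the covector $g(\delta w,\cdot)$). $\mathcal I$ is an ideal acting by zero on $X$, so $\mathcal E=\mathcal L/\mathcal I$ is a gLa represented on $X$. *Filtrations.* Subspaces below are $C^\infty$-submodules. A filtration of a $\mathbb Z$-graded module $Y$ with compatible $\mathbb Z_2$-grading consists of graded submodules $Y=Y_0\oplus Y_1$ and $F_0Y\subset F_1Y\subset\cdots$, with $F_pY=Y$ for some $p$, such that $F_pY=F_{\lhd p}Y\oplus F_{\lhd p-1}Y$, where $F_{\lhd p}Y=F_pY\cap Y_{p\bmod 2}$ and $F_{\lhd -1}Y=0$. A gLa filtration of $\mathcal E$ (with one index in $\mathbb Z_{\ge0}$, or several,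 ordered componentwise) is an increasing family of graded submodules $F_\alpha\mathcal E$ with $F_\alpha\mathcal E=\mathcal E$ for some $\alpha$ and $[F_\alpha\mathcal E,F_\beta\mathcal E]\subset F_{\alpha+\beta}\mathcal E$. **(1) The 1-index BKL filtration.** Let $W=W_0\oplus W_1$ be an orthogonal decomposition, $W_0=C^\infty\theta_0\oplus C^\infty\theta_1$ and $W_1=C^\infty\theta_2\oplus C^\infty\theta_3$ for some conformally orthonormal basis. It induces $\mathbb Z_2$-gradings: on $\wedge W$ by the parity of the degree in $W_1$; on $\mathrm{CDerEnd}(W)$ by whether $\delta$ preserves or exchanges $W_0,W_1$; hence on $\mathcal L$ and $\mathcal E=\mathcal E_0\oplus\mathcal E_1$. Then the following are filtrations with compatible $\mathbb Z_2$-grading. * On $\wedge W$: $F_{\lhd p}(\wedge W)$ is the part with degree in $W_1$ at most $p$ and congruent to $p$ mod 2; it is $C^\infty$-spanned by the monomials in $\theta_0,\dots,\theta_3$ whose degree in $\theta_2,\theta_3$ has these properties, and $F_2(\wedge W)=\wedge W$. It is the smallest such filtration with $1\in F_{\lhd 0}$, $F_{\lhd p}F_{\lhd q}\subset F_{\lhd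 p+q}$, $W_0\subset F_{\lhd0}$, $W_1\subset F_{\lhd1}$. * On $\wedge W\otimes\Omega$: $F_{\lhd p}(\wedge W\otimes\Omega)=F_{\lhd p}(\wedge W)\otimes\Omega$. * On $\mathcal E$: $F_{\lhd p}\mathcal E=\{e\in\mathcal E_{p\bmod 2}\mid e(F_{\lhd q}X)\subset F_{\lhd q+p}X\ \ \forall q\ge0\}$, where $F_{\lhd q}X=F_{\lhd q}(\wedge W)\oplus F_{\lhd q}(\wedge W\otimes\Omega)$, and $F_p\mathcal E=F_{\lhd p}\mathcal E\oplus F_{\lhd p-1}\mathcal E$. Moreover $[\mathcal E_i,\mathcal E_j]\subset\mathcal E_{i+j}$, $[F_{\lhd p}\mathcal E,F_{\lhd q}\mathcal E]\subset F_{\lhd p+q}\mathcal E$, and $(F_p\mathcal E)_{p\ge0}$ is a gLa filtration. It depends only on $[g]$ and $W_0,W_1$. **(2) Explicit form.** Fix a conformally orthonormal basis. Let $\sigma_0=\mathrm{id}_W$; $\sigma_i:\theta_0\mapsto\theta_i,\ \theta_i\mapsto\theta_0$; $\sigma_{ij}:\theta_j\mapsto\theta_i,\ \theta_i\mapsto-\theta_j$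 ($i,j\in\{1,2,3\}$ distinct), with all other basis elements sent to $0$; and let $D\in\mathrm{Der}(C^\infty)$ act on $W$ annihilating all $\theta_\mu$. For $\alpha\in\mathbb Z_{\ge0}^3$ let $G_\alpha\mathcal E_G\subset\mathcal E$ be the $C^\infty$-span of the following elements, and $0$ for all other $\alpha$. Here $(i,j,k)$ is cyclic in $1,2,3$; the rows are stated for $(i,j,k)=(1,2,3)$, and each of the rows 200, 011, 211 also holds with $(i,j,k)$ and the three entries of $\alpha$ permuted cyclically (giving 020, 002; 101, 110; 121, 112). * 000: $\mathrm{Der}(C^\infty)$; $\sigma_0$; $\theta_0\sigma_0+\theta_l\sigma_l$ $(l=1,2,3)$; $\theta_2\theta_3\sigma_{23}+\theta_3\theta_1\sigma_{31}+\theta_1\theta_2\sigma_{12}+2\sum_{l=1}^3\theta_0\theta_l\sigma_l$. * 200: $-\theta_i\sigma_{jk}+\theta_j\sigma_{ki}+\theta_k\sigma_{ij}$. * 011: $\sigma_i$; $\sigma_{jk}$; $\theta_i\mathrm{Der}(C^\infty)$; $\theta_0\sigma_i+\theta_i\sigma_0$; $\theta_j\sigma_k+\theta_k\sigma_j$; $\theta_k\sigma_{ki}$;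 $\theta_j\sigma_{ij}$; $\theta_0\theta_j\sigma_{ij}+\theta_i\theta_j\sigma_j$. * 211: $\theta_j\sigma_k-\theta_k\sigma_j$; $\theta_j\theta_k\mathrm{Der}(C^\infty)$; $\theta_0\theta_j\sigma_k-\theta_0\theta_k\sigma_j-2\theta_j\theta_k\sigma_0$; $\theta_0\theta_j\sigma_k+\theta_0\theta_k\sigma_j-2\theta_i\theta_j\sigma_{ki}$. * 222: $\theta_0\theta_1\sigma_{23}+\theta_0\theta_2\sigma_{31}+\theta_0\theta_3\sigma_{12}-2\theta_2\theta_3\sigma_1-2\theta_3\theta_1\sigma_2-2\theta_1\theta_2\sigma_3$; $\theta_1\theta_2\theta_3\mathrm{Der}(C^\infty)$; $\theta_0\theta_2\theta_3\sigma_1+\theta_0\theta_3\theta_1\sigma_2+\theta_0\theta_1\theta_2\sigma_3+3\theta_1\theta_2\theta_3\sigma_0$. Put $\mathcal E_G=\sum_\alpha G_\alpha\mathcal E_G$ and $G_\alpha\mathcal E=G_\alpha\mathcal E_G+\theta_0(G_\alpha\mathcal E_G)$. Then multiplication by $\theta_0$ is injective on $\mathcal E_G$, $\mathcal E=\mathcal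 E_G\oplus\theta_0\mathcal E_G$, $\mathcal E=\bigoplus_\alpha G_\alpha\mathcal E$, and the filtration of (1) for $W_0=C^\infty\theta_0\oplus C^\infty\theta_1$, $W_1=C^\infty\theta_2\oplus C^\infty\theta_3$ is $$F_{\lhd p}\mathcal E=\bigoplus_{k\ge0}\bigoplus_{p_2,p_3}G_{p-2k,p_2,p_3}\mathcal E,\qquad F_p\mathcal E=\bigoplus_{q\le p}\bigoplus_{p_2,p_3}G_{q,p_2,p_3}\mathcal E .$$ **(3) The 2- and 3-index filtrations.** Let $F,F',F''$ be the filtrations of (1) for the decompositions $W_0\oplus W_1$ with $(W_0,W_1)$ spanned by $(\{\theta_0,\theta_1\},\{\theta_2,\theta_3\})$, $(\{\theta_0,\theta_2\},\{\theta_3,\theta_1\})$, $(\{\theta_0,\theta_3\},\{\theta_1,\theta_2\})$ respectively. Then $F_{p_2p_3}\mathcal E=F'_{p_2}\mathcal E\cap F''_{p_3}\mathcal E$ and $F_{p_1p_2p_3}\mathcal E=F_{p_1}\mathcal E\cap F'_{p_2}\mathcal E\cap F''_{p_3}\mathcal E$ are gLa filtrations, and $$F_{p_2p_3}\mathcal E=\bigoplus_{q_1}\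 \bigoplus_{q_2\le p_2,\;q_3\le p_3}G_{q_1q_2q_3}\mathcal E,\qquad F_\alpha\mathcal E=\bigoplus_{\beta\le\alpha}G_\beta\mathcal E\quad(\alpha\in\mathbb Z_{\ge0}^3).$$ If $\mathrm{Der}(C^\infty)$ is a free $C^\infty$-module (for example $M\cong\mathbb R^4$), then all $G_\alpha\mathcal E$, $F_{p_2p_3}\mathcal E$, $F_\alpha\mathcal E$ are stable under $\theta_0$ and free as modules over the exterior algebra $C^\infty1\oplus C^\infty\theta_0$. -/

import Mathlib

open scoped TensorProduct Manifold ContDiff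

namespace BKL

noncomputable section

/-- Left multiplication by `ω` as an additive map. -/
def lmulHom {R X : Type*} [Ring R] [AddCommGroup X] [Module R X] (w : R) : X →+ X :=
  AddMonoidHom.mk' (fun x => w • x) (smul_add w)

@[simp] theorem lmulHom_apply {R X : Type*} [Ring R] [AddCommGroup X] [Module R X] (w : R) (x : X) :
    lmulHom w x = w • x := rfl

section Algebra

set_option linter.unusedSectionVars false

variable {A : Type*} [CommRing A] [Algebra ℝ A] {W : Type*} [AddCommGroup W] [Module A W]

/-- `CDerEnd(W)` for a conformal class `c` of bilinear forms on the `A`-module `W`: the pairs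
`(D, δ)` of a derivation `D` of `A` and an additive map `δ : W → W` such that
`δ (f w) = D(f) w + f δ(w)`, and such that `δ` infinitesimally rescales every `g` in `c`:
`D (g(w,w')) = g(δ w, w') + g(w, δ w') + h g(w,w')` for some `h` in `A`. -/
def cDerEnd (c : Set (LinearMap.BilinForm A W)) :
    Submodule A (Derivation ℝ A A × (W →+ W)) where
  carrier := {x | (∀ (f : A) (w : W), x.2 (f • w) = x.1 f • w + f • x.2 w) ∧
    ∀ g ∈ c, ∃ h : A, ∀ w w' : W,
      x.1 (g w w') = g (x.2 w) w' + g w (x.2 w') + h * g w w'}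
  add_mem' := by
    rintro x y ⟨hx, hx'⟩ ⟨hy, hy'⟩
    refine ⟨fun f w => ?_, fun g hg => ?_⟩
    · simp only [Prod.fst_add, Prod.snd_add, AddMonoidHom.add_apply, Derivation.add_apply, hx, hy]
      module
    · obtain ⟨a, ha⟩ := hx' g hg
      obtain ⟨b, hb⟩ := hy' g hg
      refine ⟨a + b, fun w w' => ?_⟩
      simp only [Prod.fst_add, Prod.snd_add, AddMonoidHom.add_apply, Derivation.add_apply, ha, hb,
        map_add, LinearMap.add_apply]
      ring
  zero_mem' := ⟨fun f w => by simp, fun g hg => ⟨0, fun w w' => by simp⟩⟩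
  smul_mem' := by
    rintro r x ⟨hx, hx'⟩
    refine ⟨fun f w => ?_, fun g hg => ?_⟩
    · simp only [Prod.smul_fst, Prod.smul_snd, AddMonoidHom.smul_apply, Derivation.smul_apply, hx,
        smul_eq_mul]
      module
    · obtain ⟨a, ha⟩ := hx' g hg
      refine ⟨r * a, fun w w' => ?_⟩
      simp only [Prod.smul_fst, Prod.smul_snd, AddMonoidHom.smul_apply, Derivation.smul_apply, ha,
        map_smul, LinearMap.smul_apply, smul_eq_mul]
      ring

variable {c : Set (LinearMap.BilinForm A W)}

/-- `CDerEnd(W)` as a type. -/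
def CDerEnd (c : Set (LinearMap.BilinForm A W)) : Type _ := ↥(cDerEnd c)

instance : AddCommGroup (CDerEnd c) := inferInstanceAs (AddCommGroup ↥(cDerEnd c))

instance : Module A (CDerEnd c) := inferInstanceAs (Module A ↥(cDerEnd c))

namespace CDerEnd

/-- The underlying derivation of `A`. -/
def sym (x : CDerEnd c) : Derivation ℝ A A := x.1.1

/-- The underlying operator on `W`. -/
def op (x : CDerEnd c) : W →+ W := x.1.2

theorem op_smul (x : CDerEnd c) (f : A) (w : W) : x.op (f • w) = x.sym f • w + f • x.op w :=
  x.2.1 f w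

@[ext] theorem ext' {x y : CDerEnd c} (h₁ : x.sym = y.sym) (h₂ : ∀ w, x.op w = y.op w) : x = y :=
  Subtype.ext (Prod.ext h₁ (AddMonoidHom.ext h₂))

@[simp] theorem sym_add (x y : CDerEnd c) (f : A) : (x + y).sym f = x.sym f + y.sym f := rfl
@[simp] theorem sym_smul (a : A) (x : CDerEnd c) (f : A) : (a • x).sym f = a * x.sym f := rfl
@[simp] theorem sym_sub (x y : CDerEnd c) (f : A) : (x - y).sym f = x.sym f - y.sym f := rfl
@[simp] theorem op_sub (x y : CDerEnd c) (w : W) : (x - y).op w = x.op w - y.op w := rfl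
@[simp] theorem op_add (x y : CDerEnd c) (w : W) : (x + y).op w = x.op w + y.op w := rfl
@[simp] theorem smul_op (a : A) (x : CDerEnd c) (w : W) : (a • x).op w = a • x.op w := rfl

/-- The Lie bracket (commutator) of `CDerEnd(W)`. -/
def comm (x y : CDerEnd c) : CDerEnd c :=
  ⟨(⁅x.sym, y.sym⁆, x.op.comp y.op - y.op.comp x.op), by
    constructor
    · intro f w
      simp only [AddMonoidHom.sub_apply, AddMonoidHom.comp_apply, op_smul, map_add,
        Derivation.commutator_apply]
      module
    · intro g hg
      obtain ⟨a, ha⟩ := x.2.2 g hg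
      obtain ⟨b, hb⟩ := y.2.2 g hg
      change ∀ w w', x.sym (g w w') = g (x.op w) w' + g w (x.op w') + a * g w w' at ha
      change ∀ w w', y.sym (g w w') = g (y.op w) w' + g w (y.op w') + b * g w w' at hb
      refine ⟨x.sym b - y.sym a, fun w w' => ?_⟩
      simp only [AddMonoidHom.sub_apply, AddMonoidHom.comp_apply,
        Derivation.commutator_apply, ha, hb, map_add, map_sub, LinearMap.sub_apply,
        Derivation.leibniz, smul_eq_mul]
      ring⟩

@[simp] theorem sym_comm (x y : CDerEnd c) (f : A) :
    (x.comm y).sym f = x.sym (y.sym f) - y.sym (x.sym f) := rfl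
@[simp] theorem op_comm (x y : CDerEnd c) (w : W) :
    (x.comm y).op w = x.op (y.op w) - y.op (x.op w) := rfl

theorem comm_add (x y z : CDerEnd c) : x.comm (y + z) = x.comm y + x.comm z := by
  ext <;> simp <;> abel

theorem add_comm' (x y z : CDerEnd c) : (x + y).comm z = x.comm z + y.comm z := by
  ext <;> simp <;> abel

theorem comm_smul (x y : CDerEnd c) (f : A) : x.comm (f • y) = x.sym f • y + f • x.comm y := by
  ext
  · simp; ring
  · simp [op_smul]; module

theorem smul_comm' (x y : CDerEnd c) (f : A) : (f • x).comm y = f • x.comm y - y.sym f • x := by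
  ext
  · simp; ring
  · simp [op_smul]; module

theorem comm_anti (x y : CDerEnd c) : x.comm y = - y.comm x := by
  ext
  · change _ = -((y.comm x).sym _); simp
  · change _ = -((y.comm x).op _); simp

/-- `comm x` as an additive map. -/
def ad (x : CDerEnd c) : CDerEnd c →+ CDerEnd c where
  toFun := x.comm
  map_zero' := by simpa using (x.comm_smul 0 0)
  map_add' := x.comm_add

@[simp] theorem ad_apply (x y : CDerEnd c) : x.ad y = x.comm y := rfl

/-! The extension of an element of `CDerEnd(W)` to a derivation of `∧W`, through algebra maps from
`∧W` to the dual numbers over `∧W`, on which `f : A` acts as `f + D(f) ε`. -/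

/-- Dual numbers over `∧W`. -/
def Dual (_x : CDerEnd c) : Type _ :=
  TrivSqZeroExt (ExteriorAlgebra A W) (ExteriorAlgebra A W)

instance (x : CDerEnd c) : Ring x.Dual :=
  inferInstanceAs (Ring (TrivSqZeroExt (ExteriorAlgebra A W) (ExteriorAlgebra A W)))

/-- `a + b ε`. -/
def dmk (x : CDerEnd c) (a b : ExteriorAlgebra A W) : x.Dual := (a, b)

theorem dmk_mul (x : CDerEnd c) (a b a' b' : ExteriorAlgebra A W) :
    x.dmk a b * x.dmk a' b' = x.dmk (a * a') (a * b' + b * a') := rfl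

theorem dmk_add (x : CDerEnd c) (a b a' b' : ExteriorAlgebra A W) :
    x.dmk a b + x.dmk a' b' = x.dmk (a + a') (b + b') := rfl

/-- The ring map `f ↦ f + D(f) ε`. -/
def dualMap (x : CDerEnd c) : A →+* x.Dual where
  toFun f := x.dmk (algebraMap A _ f) (algebraMap A _ (x.sym f))
  map_one' := by simp; rfl
  map_zero' := by simp; rfl
  map_mul' f g := by
    rw [dmk_mul]
    simp only [Derivation.leibniz, smul_eq_mul, map_add, map_mul]
    congr 2
    rw [← map_mul, ← map_mul, mul_comm g]
  map_add' f g := by rw [dmk_add]; simp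

instance (x : CDerEnd c) : Algebra A x.Dual :=
  RingHom.toAlgebra' x.dualMap (by
    rintro f ⟨a, b⟩
    change x.dmk _ _ * x.dmk a b = x.dmk a b * x.dmk _ _
    rw [dmk_mul, dmk_mul, Algebra.commutes f a, Algebra.commutes f b,
      Algebra.commutes (x.sym f) a, add_comm])

theorem dual_smul (x : CDerEnd c) (f : A) (a b : ExteriorAlgebra A W) :
    f • x.dmk a b = x.dmk (f • a) (f • b + x.sym f • a) := by
  rw [Algebra.smul_def]
  change x.dmk _ _ * _ = _
  rw [dmk_mul, Algebra.smul_def, Algebra.smul_def, Algebra.smul_def]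

/-- The algebra map `∧W → ∧W[ε]` with `w ↦ w + δ(w) ε`. -/
def dualLift (x : CDerEnd c) : ExteriorAlgebra A W →ₐ[A] x.Dual :=
  ExteriorAlgebra.lift A
    ⟨{ toFun := fun w => x.dmk (ExteriorAlgebra.ι A w) (ExteriorAlgebra.ι A (x.op w))
       map_add' := fun v w => by rw [dmk_add]; simp
       map_smul' := fun f w => by
        simp only [RingHom.id_apply]
        rw [dual_smul, op_smul, map_add, map_smul, map_smul, map_smul, add_comm] },
     fun w => by
      change x.dmk _ _ * x.dmk _ _ = 0
      rw [dmk_mul, ExteriorAlgebra.ι_sq_zero, ExteriorAlgebra.ι_add_mul_swap]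
      rfl⟩

theorem fst_dualLift (x : CDerEnd c) (a : ExteriorAlgebra A W) : (x.dualLift a).1 = a := by
  induction a using ExteriorAlgebra.induction with
  | algebraMap r => rw [AlgHom.commutes]; rfl
  | ι w => rw [dualLift, ExteriorAlgebra.lift_ι_apply]; rfl
  | mul a b ha hb => rw [map_mul]; exact congrArg₂ (· * ·) ha hb
  | add a b ha hb => rw [map_add]; exact congrArg₂ (· + ·) ha hb

/-- The derivation of `∧W` over `D` that extends `δ`. -/
def onExt (x : CDerEnd c) : ExteriorAlgebra A W →+ ExteriorAlgebra A W where
  toFun a := (x.dualLift a).2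
  map_zero' := by rw [map_zero]; rfl
  map_add' a b := by rw [map_add]; rfl

@[simp] theorem onExt_algebraMap (x : CDerEnd c) (f : A) :
    x.onExt (algebraMap A _ f) = algebraMap A _ (x.sym f) := by
  change (x.dualLift _).2 = _
  rw [AlgHom.commutes]; rfl

@[simp] theorem onExt_ι (x : CDerEnd c) (w : W) :
    x.onExt (ExteriorAlgebra.ι A w) = ExteriorAlgebra.ι A (x.op w) := by
  change (x.dualLift _).2 = _
  rw [dualLift, ExteriorAlgebra.lift_ι_apply]; rfl

theorem onExt_mul (x : CDerEnd c) (a b : ExteriorAlgebra A W) :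
    x.onExt (a * b) = x.onExt a * b + a * x.onExt b := by
  change (x.dualLift _).2 = _
  rw [map_mul]
  change (x.dualLift a).1 * (x.dualLift b).2 + (x.dualLift a).2 * (x.dualLift b).1 = _
  rw [fst_dualLift, fst_dualLift, add_comm]; rfl

theorem onExt_smul (x : CDerEnd c) (f : A) (a : ExteriorAlgebra A W) :
    x.onExt (f • a) = x.sym f • a + f • x.onExt a := by
  rw [Algebra.smul_def, onExt_mul, onExt_algebraMap, Algebra.smul_def, Algebra.smul_def]

theorem onExt_add (x y : CDerEnd c) (a : ExteriorAlgebra A W) :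
    (x + y).onExt a = x.onExt a + y.onExt a := by
  induction a using ExteriorAlgebra.induction with
  | algebraMap r => simp
  | ι w => simp
  | mul a b ha hb => simp only [onExt_mul, ha, hb]; noncomm_ring
  | add a b ha hb => simp only [map_add, ha, hb]; abel

theorem smul_onExt (f : A) (x : CDerEnd c) (a : ExteriorAlgebra A W) :
    (f • x).onExt a = f • x.onExt a := by
  induction a using ExteriorAlgebra.induction with
  | algebraMap r => simp [Algebra.smul_def]
  | ι w => simp
  | mul a b ha hb => simp only [onExt_mul, ha, hb, smul_add, smul_mul_assoc, mul_smul_comm]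
  | add a b ha hb => simp only [map_add, ha, hb, smul_add]

theorem onExt_comm (x y : CDerEnd c) (a : ExteriorAlgebra A W) :
    (x.comm y).onExt a = x.onExt (y.onExt a) - y.onExt (x.onExt a) := by
  induction a using ExteriorAlgebra.induction with
  | algebraMap r => simp
  | ι w => simp
  | mul a b ha hb => simp only [onExt_mul, ha, hb, map_add]; noncomm_ring
  | add a b ha hb => simp only [map_add, ha, hb]; abel

theorem onExt_mem (x : CDerEnd c) (n : ℕ) {a : ExteriorAlgebra A W} (ha : a ∈ ⋀[A]^n W) :
    x.onExt a ∈ ⋀[A]^n W := by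
  induction ha using Submodule.pow_induction_on_left' with
  | algebraMap r => rw [onExt_algebraMap]; simp
  | add a b i _ _ iha ihb => rw [map_add]; exact add_mem iha ihb
  | mem_mul m hm i a ha ih =>
    obtain ⟨w, rfl⟩ := hm
    rw [onExt_mul, onExt_ι]
    refine add_mem ?_ ?_
    · change _ ∈ LinearMap.range (ExteriorAlgebra.ι A) ^ (i + 1)
      rw [pow_succ']; exact Submodule.mul_mem_mul ⟨_, rfl⟩ ha
    · change _ ∈ LinearMap.range (ExteriorAlgebra.ι A) ^ (i + 1)
      rw [pow_succ']; exact Submodule.mul_mem_mul ⟨_, rfl⟩ ih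

end CDerEnd

variable (A W) in
/-- `Ω = ∧⁴W`. -/
abbrev Om : Type _ := (⋀[A]^4 W : Submodule A (ExteriorAlgebra A W))

namespace CDerEnd

/-- The action of `CDerEnd(W)` on `Ω`. -/
def onOm (x : CDerEnd c) : Om A W →+ Om A W where
  toFun z := ⟨x.onExt z, x.onExt_mem 4 z.2⟩
  map_zero' := Subtype.ext (by simp)
  map_add' a b := Subtype.ext (by simp)

@[simp] theorem coe_onOm (x : CDerEnd c) (z : Om A W) : (x.onOm z : ExteriorAlgebra A W) = x.onExt z :=
  rfl

end CDerEnd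

/-- If `δX` and `δY` are additive operators satisfying the Leibniz rule over the same derivation
`D`, this is the operator `x ⊗ y ↦ δX x ⊗ y + x ⊗ δY y`. -/
def tensorDer {X Y : Type*} [AddCommGroup X] [Module A X] [AddCommGroup Y] [Module A Y]
    (D : Derivation ℝ A A) (δX : X →+ X) (hX : ∀ (f : A) (x : X), δX (f • x) = D f • x + f • δX x)
    (δY : Y →+ Y) (hY : ∀ (f : A) (y : Y), δY (f • y) = D f • y + f • δY y) :
    X ⊗[A] Y →+ X ⊗[A] Y :=
  TensorProduct.liftAddHom
    (AddMonoidHom.mk' (fun x => AddMonoidHom.mk' (fun y => δX x ⊗ₜ[A] y + x ⊗ₜ[A] δY y)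
        (fun y y' => by simp only [map_add, TensorProduct.tmul_add]; abel))
      (fun x x' => by
        ext y
        simp only [AddMonoidHom.mk'_apply, AddMonoidHom.add_apply, map_add, TensorProduct.add_tmul]
        abel))
    (fun r x y => by
      simp only [AddMonoidHom.mk'_apply, hX, hY, TensorProduct.add_tmul, TensorProduct.tmul_add,
        TensorProduct.smul_tmul', TensorProduct.tmul_smul]
      abel)

@[simp] theorem tensorDer_tmul {X Y : Type*} [AddCommGroup X] [Module A X] [AddCommGroup Y]
    [Module A Y] (D : Derivation ℝ A A) (δX : X →+ X) (hX) (δY : Y →+ Y) (hY) (x : X) (y : Y) :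
    tensorDer D δX hX δY hY (x ⊗ₜ[A] y) = δX x ⊗ₜ[A] y + x ⊗ₜ[A] δY y := rfl

/-- `ℒ = ∧W ⊗ CDerEnd(W)`. -/
abbrev L (c : Set (LinearMap.BilinForm A W)) : Type _ := ExteriorAlgebra A W ⊗[A] CDerEnd c

/-- The action of `δ` on `ℒ`: `ω'δ' ↦ δ(ω')δ' + ω'[δ,δ']`. -/
def adL (x : CDerEnd c) : L c →+ L c :=
  tensorDer x.sym x.onExt x.onExt_smul x.ad (fun f y => x.comm_smul y f)

@[simp] theorem adL_tmul (x : CDerEnd c) (a : ExteriorAlgebra A W) (y : CDerEnd c) :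
    adL x (a ⊗ₜ y) = x.onExt a ⊗ₜ[A] y + a ⊗ₜ[A] x.comm y := rfl

/-- `ω'δ' ↦ (δ'(ω) ∧ ω') δ`. -/
def backL (w : ExteriorAlgebra A W) (x : CDerEnd c) : L c →ₗ[A] L c :=
  TensorProduct.lift (LinearMap.mk₂ A (fun a y => (y.onExt w * a) ⊗ₜ[A] x)
    (fun a b y => by rw [mul_add, TensorProduct.add_tmul])
    (fun f a y => by rw [mul_smul_comm, TensorProduct.smul_tmul'])
    (fun a y z => by rw [CDerEnd.onExt_add, add_mul, TensorProduct.add_tmul])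
    (fun f a y => by rw [CDerEnd.smul_onExt, smul_mul_assoc, TensorProduct.smul_tmul']))

@[simp] theorem backL_tmul (w : ExteriorAlgebra A W) (x : CDerEnd c) (a : ExteriorAlgebra A W)
    (y : CDerEnd c) : backL w x (a ⊗ₜ y) = (y.onExt w * a) ⊗ₜ[A] x := rfl

/-- `ω'δ' ↦ [ωδ, ω'δ']`, see `bracketL`. -/
def bracketGen (w : ExteriorAlgebra A W) (x : CDerEnd c) : L c →+ L c :=
  (lmulHom w).comp (adL x) - (backL w x).toAddMonoidHom

theorem bracketGen_apply (w : ExteriorAlgebra A W) (x : CDerEnd c) (u : L c) :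
    bracketGen w x u = w • adL x u - backL w x u := rfl

theorem bracketGen_tmul (w a : ExteriorAlgebra A W) (x y : CDerEnd c) :
    bracketGen w x (a ⊗ₜ y) =
      (w * a) ⊗ₜ x.comm y + (w * x.onExt a) ⊗ₜ y - (y.onExt w * a) ⊗ₜ x := by
  rw [bracketGen_apply, adL_tmul, smul_add, TensorProduct.smul_tmul', TensorProduct.smul_tmul',
    backL_tmul, smul_eq_mul, smul_eq_mul, add_comm ((w * a) ⊗ₜ[A] _)]

theorem addHom_ext_tmul {N : Type*} [AddCommGroup N] {f g : L c →+ N}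
    (h : ∀ (a : ExteriorAlgebra A W) (y : CDerEnd c), f (a ⊗ₜ y) = g (a ⊗ₜ y)) : f = g := by
  ext u
  induction u using TensorProduct.induction_on with
  | zero => simp
  | add u v hu hv => rw [map_add, map_add, hu, hv]
  | tmul a y => exact h a y

theorem bracketGen_add_right (w : ExteriorAlgebra A W) (x x' : CDerEnd c) :
    bracketGen w (x + x') = bracketGen w x + bracketGen w x' := by
  apply addHom_ext_tmul
  intro a y
  rw [AddMonoidHom.add_apply]
  simp only [bracketGen_tmul, CDerEnd.onExt_add, CDerEnd.add_comm', TensorProduct.tmul_add,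
    mul_add, TensorProduct.add_tmul]
  abel

theorem bracketGen_add_left (w w' : ExteriorAlgebra A W) (x : CDerEnd c) :
    bracketGen (w + w') x = bracketGen w x + bracketGen w' x := by
  apply addHom_ext_tmul
  intro a y
  rw [AddMonoidHom.add_apply]
  simp only [bracketGen_tmul, map_add, add_mul, TensorProduct.add_tmul]
  abel

theorem bracketGen_smul (f : A) (w : ExteriorAlgebra A W) (x : CDerEnd c) :
    bracketGen (f • w) x = bracketGen w (f • x) := by
  apply addHom_ext_tmul
  intro a y
  simp only [bracketGen_tmul, CDerEnd.onExt_smul, CDerEnd.smul_onExt, CDerEnd.smul_comm',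
    add_mul, TensorProduct.add_tmul, TensorProduct.tmul_sub, TensorProduct.tmul_smul,
    smul_mul_assoc, mul_smul_comm, TensorProduct.smul_tmul']
  abel

/-- The bracket of the graded Lie algebra `ℒ`:
`[ωδ, ω'δ'] = ωω'[δ,δ'] + ωδ(ω')δ' - (-1)^(|ω||ω'|) ω'δ'(ω)δ`.
The last term is written as `δ'(ω)ω'δ`, which absorbs the sign. -/
def bracketL (c : Set (LinearMap.BilinForm A W)) : L c →+ L c →+ L c :=
  TensorProduct.liftAddHom
    (AddMonoidHom.mk' (fun w => AddMonoidHom.mk' (fun x => bracketGen w x) (bracketGen_add_right w))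
      (fun w w' => by ext1 x; exact bracketGen_add_left w w' x))
    bracketGen_smul

theorem bracketL_tmul (w : ExteriorAlgebra A W) (x : CDerEnd c) (u : L c) :
    bracketL c (w ⊗ₜ x) u = w • adL x u - backL w x u := rfl

theorem bracketL_tmul_tmul (w a : ExteriorAlgebra A W) (x y : CDerEnd c) :
    bracketL c (w ⊗ₜ x) (a ⊗ₜ y) =
      (w * a) ⊗ₜ x.comm y + (w * x.onExt a) ⊗ₜ y - (y.onExt w * a) ⊗ₜ x :=
  bracketGen_tmul w a x y

variable (A W) in
/-- `∧W ⊗ Ω`. -/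
abbrev ExtOm : Type _ := ExteriorAlgebra A W ⊗[A] Om A W

variable (A W) in
/-- The representation space `∧W ⊕ (∧W ⊗ Ω)`. -/
abbrev RepSpace : Type _ := ExteriorAlgebra A W × ExtOm A W

namespace CDerEnd

theorem onOm_smul (x : CDerEnd c) (f : A) (z : Om A W) :
    x.onOm (f • z) = x.sym f • z + f • x.onOm z :=
  Subtype.ext (x.onExt_smul f z)

/-- The action of `CDerEnd(W)` on `∧W ⊗ Ω`. -/
def onExtOm (x : CDerEnd c) : ExtOm A W →+ ExtOm A W :=
  tensorDer x.sym x.onExt x.onExt_smul x.onOm x.onOm_smul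

@[simp] theorem onExtOm_tmul (x : CDerEnd c) (a : ExteriorAlgebra A W) (z : Om A W) :
    x.onExtOm (a ⊗ₜ z) = x.onExt a ⊗ₜ[A] z + a ⊗ₜ[A] x.onOm z := rfl

theorem extOm_induction {N : Type*} [AddCommGroup N] {f g : ExtOm A W →+ N}
    (h : ∀ (a : ExteriorAlgebra A W) (z : Om A W), f (a ⊗ₜ z) = g (a ⊗ₜ z)) : f = g := by
  ext u
  induction u using TensorProduct.induction_on with
  | zero => simp
  | add u v hu hv => rw [map_add, map_add, hu, hv]
  | tmul a y => exact h a y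

theorem onExtOm_add (x y : CDerEnd c) : (x + y).onExtOm = x.onExtOm + y.onExtOm := by
  apply extOm_induction
  intro a z
  have : (x + y).onOm z = x.onOm z + y.onOm z := Subtype.ext (x.onExt_add y z)
  simp only [AddMonoidHom.add_apply, onExtOm_tmul, onExt_add, this, TensorProduct.add_tmul,
    TensorProduct.tmul_add]
  abel

theorem smul_onExtOm (f : A) (x : CDerEnd c) : (f • x).onExtOm = f • x.onExtOm := by
  apply extOm_induction
  intro a z
  have : (f • x).onOm z = f • x.onOm z := Subtype.ext (x.smul_onExt f z)
  simp only [AddMonoidHom.smul_apply, onExtOm_tmul, smul_onExt, this, TensorProduct.smul_tmul',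
    TensorProduct.tmul_smul, smul_add]

theorem onExtOm_lmul (x : CDerEnd c) (w : ExteriorAlgebra A W) (u : ExtOm A W) :
    x.onExtOm (w • u) = x.onExt w • u + w • x.onExtOm u := by
  induction u using TensorProduct.induction_on with
  | zero => simp
  | add u v hu hv => rw [smul_add, map_add, hu, hv, map_add, smul_add, smul_add]; abel
  | tmul a z =>
    simp only [TensorProduct.smul_tmul', onExtOm_tmul, smul_eq_mul, onExt_mul, smul_add,
      TensorProduct.add_tmul]
    abel

theorem onExtOm_comm (x y : CDerEnd c) (u : ExtOm A W) :
    (x.comm y).onExtOm u = x.onExtOm (y.onExtOm u) - y.onExtOm (x.onExtOm u) := by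
  induction u using TensorProduct.induction_on with
  | zero => simp
  | add u v hu hv => simp only [map_add, hu, hv]; abel
  | tmul a z =>
    have : (x.comm y).onOm z = x.onOm (y.onOm z) - y.onOm (x.onOm z) :=
      Subtype.ext (x.onExt_comm y z)
    simp only [onExtOm_tmul, map_add, onExt_comm, this, TensorProduct.sub_tmul,
      TensorProduct.tmul_sub]
    abel

end CDerEnd

/-- The anchor `ℒ → Der(∧W)`, `ωδ ↦ (ω' ↦ ω δ(ω'))`. -/
def anchor (c : Set (LinearMap.BilinForm A W)) :
    L c →ₗ[A] (ExteriorAlgebra A W →+ ExteriorAlgebra A W) :=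
  TensorProduct.lift (LinearMap.mk₂ A (fun w x => (lmulHom w).comp x.onExt)
    (fun w w' x => by ext a; simp [add_mul])
    (fun f w x => by ext a; simp)
    (fun w x y => by ext a; simp [CDerEnd.onExt_add, mul_add])
    (fun f w x => by ext a; simp [CDerEnd.smul_onExt]))

@[simp] theorem anchor_tmul (w : ExteriorAlgebra A W) (x : CDerEnd c) (a : ExteriorAlgebra A W) :
    anchor c (w ⊗ₜ x) a = w * x.onExt a := rfl

/-- The representation of `ℒ` on `∧W ⊗ Ω`,
`ωδ ↦ (ω'z ↦ (ω δ(ω'))z + (ω ω')δ(z))`. -/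
def repOm (c : Set (LinearMap.BilinForm A W)) : L c →ₗ[A] (ExtOm A W →+ ExtOm A W) :=
  TensorProduct.lift (LinearMap.mk₂ A (fun w x => (lmulHom w).comp x.onExtOm)
    (fun w w' x => by ext a; simp [add_smul])
    (fun f w x => by ext a; simp)
    (fun w x y => by ext a; simp [CDerEnd.onExtOm_add])
    (fun f w x => by ext a; simp [CDerEnd.smul_onExtOm, smul_comm w f]))

@[simp] theorem repOm_tmul (w : ExteriorAlgebra A W) (x : CDerEnd c) (u : ExtOm A W) :
    repOm c (w ⊗ₜ x) u = w • x.onExtOm u := rfl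

/-- The representation of `ℒ` on `∧W ⊕ (∧W ⊗ Ω)`. -/
def repL (c : Set (LinearMap.BilinForm A W)) : L c →ₗ[A] (RepSpace A W →+ RepSpace A W) where
  toFun u := (anchor c u).prodMap (repOm c u)
  map_add' u v := by ext x <;> simp
  map_smul' f u := by ext x <;> simp

theorem repL_apply (u : L c) (x : RepSpace A W) :
    repL c u x = (anchor c u x.1, repOm c u x.2) := rfl

theorem repL_eq_zero {u : L c} : repL c u = 0 ↔ anchor c u = 0 ∧ repOm c u = 0 := by
  constructor
  · intro h
    constructor
    · ext1 x
      exact congrArg Prod.fst (DFunLike.congr_fun h (x, 0))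
    · ext1 x
      exact congrArg Prod.snd (DFunLike.congr_fun h (0, x))
  · rintro ⟨h, h'⟩
    ext x <;> simp [repL_apply, h, h']

/-- The piece of `ℒ` of degree `n`, namely `∧ⁿW ⊗ CDerEnd(W)`. -/
def gradeL (c : Set (LinearMap.BilinForm A W)) (n : ℕ) : Submodule A (L c) :=
  Submodule.span A {u | ∃ w ∈ ⋀[A]^n W, ∃ x : CDerEnd c, u = w ⊗ₜ[A] x}

/-- The Ricci contraction of `ωδ`, with respect to `g` and evaluated at `w`: the interior product
of `ω` with the covector `g(δ w, -)`. -/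
def ricci (g : LinearMap.BilinForm A W) (w : W) : L c →ₗ[A] ExteriorAlgebra A W :=
  TensorProduct.lift (LinearMap.mk₂ A
    (fun a (x : CDerEnd c) => CliffordAlgebra.contractLeft (g (x.op w)) a)
    (fun a b x => by simp)
    (fun f a x => by simp)
    (fun a x y => by simp)
    (fun f a x => by simp))

@[simp] theorem ricci_tmul (g : LinearMap.BilinForm A W) (w : W) (a : ExteriorAlgebra A W)
    (x : CDerEnd c) :
    ricci g w (a ⊗ₜ x) = CliffordAlgebra.contractLeft (g (x.op w)) a := rfl

/-- Algebraic Weyl tensors: the elements of `∧²W ⊗ CDerEnd(W)` that act trivially on `∧W` (so the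
`Der` component vanishes and the first Bianchi identity holds) and on `∧W ⊗ Ω` (so there is no
conformal rescaling component), and whose Ricci contraction vanishes. -/
def weyl (c : Set (LinearMap.BilinForm A W)) : Submodule A (L c) where
  carrier := {u | u ∈ gradeL c 2 ∧ repL c u = 0 ∧ ∀ g ∈ c, ∀ w, ricci g w u = 0}
  add_mem' := by
    rintro u v ⟨h1, h2, h3⟩ ⟨k1, k2, k3⟩
    refine ⟨add_mem h1 k1, by rw [map_add, h2, k2, add_zero], fun g hg w => ?_⟩
    rw [map_add, h3 g hg, k3 g hg, add_zero]
  zero_mem' := ⟨zero_mem _, map_zero _, fun g hg w => map_zero _⟩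
  smul_mem' := by
    rintro f u ⟨h1, h2, h3⟩
    refine ⟨Submodule.smul_mem _ _ h1, by rw [map_smul, h2, smul_zero], fun g hg w => ?_⟩
    rw [map_smul, h3 g hg, smul_zero]

/-- The ideal `ℐ` of `ℒ`: the `∧W`-submodule generated by the algebraic Weyl tensors. -/
def weylIdeal (c : Set (LinearMap.BilinForm A W)) : Submodule (ExteriorAlgebra A W) (L c) :=
  Submodule.span (ExteriorAlgebra A W) (weyl c : Set (L c))

/-! `ℐ` acts trivially and is a two-sided ideal. -/

theorem anchor_smul (w : ExteriorAlgebra A W) (u : L c) (a : ExteriorAlgebra A W) :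
    anchor c (w • u) a = w * anchor c u a := by
  induction u using TensorProduct.induction_on with
  | zero => simp
  | add u v hu hv => simp only [smul_add, map_add, AddMonoidHom.add_apply, hu, hv, mul_add]
  | tmul b x => simp only [TensorProduct.smul_tmul', anchor_tmul, smul_eq_mul, mul_assoc]

theorem repOm_smul (w : ExteriorAlgebra A W) (u : L c) (a : ExtOm A W) :
    repOm c (w • u) a = w • repOm c u a := by
  induction u using TensorProduct.induction_on with
  | zero => simp
  | add u v hu hv => simp only [smul_add, map_add, AddMonoidHom.add_apply, hu, hv]
  | tmul b x => simp only [TensorProduct.smul_tmul', repOm_tmul, smul_eq_mul, mul_smul]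

theorem repL_smul (w : ExteriorAlgebra A W) (u : L c) (a : RepSpace A W) :
    repL c (w • u) a = w • repL c u a := by
  rw [repL_apply, repL_apply, anchor_smul, repOm_smul]; rfl

theorem repL_weylIdeal {u : L c} (hu : u ∈ weylIdeal c) : repL c u = 0 := by
  induction hu using Submodule.span_induction with
  | mem u h => exact h.2.1
  | zero => exact map_zero _
  | add u v _ _ hu hv => rw [map_add, hu, hv, add_zero]
  | smul w u _ hu =>
    ext1 a
    rw [repL_smul, hu]
    simp

theorem even_comm {b : ExteriorAlgebra A W} (hb : b ∈ ⋀[A]^2 W) (a : ExteriorAlgebra A W) :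
    b * a = a * b := by
  have key : ∀ v w : W, ∀ a : ExteriorAlgebra A W,
      ExteriorAlgebra.ι A v * ExteriorAlgebra.ι A w * a =
        a * (ExteriorAlgebra.ι A v * ExteriorAlgebra.ι A w) := by
    intro v w a
    induction a using ExteriorAlgebra.induction with
    | algebraMap r => rw [Algebra.commutes]
    | ι u =>
      have h1 := ExteriorAlgebra.ι_add_mul_swap (R := A) w u
      have h2 := ExteriorAlgebra.ι_add_mul_swap (R := A) v u
      rw [mul_assoc, eq_neg_of_add_eq_zero_left h1, mul_neg, ← mul_assoc,
        eq_neg_of_add_eq_zero_left h2, neg_mul, neg_neg, mul_assoc]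
    | mul a b ha hb => rw [← mul_assoc, ha, mul_assoc, hb, mul_assoc]
    | add a b ha hb => rw [mul_add, add_mul, ha, hb]
  change b ∈ LinearMap.range (ExteriorAlgebra.ι A) ^ 2 at hb
  rw [pow_two] at hb
  induction hb using Submodule.mul_induction_on' with
  | mem_mul_mem m hm n hn =>
    obtain ⟨v, rfl⟩ := hm
    obtain ⟨w, rfl⟩ := hn
    exact key v w a
  | add x _ y _ hx hy => rw [add_mul, mul_add, hx, hy]

theorem gradeL_induction {N : Type*} [AddCommGroup N] {f g : L c →+ N}
    (h : ∀ w ∈ ⋀[A]^2 W, ∀ x : CDerEnd c, f (w ⊗ₜ x) = g (w ⊗ₜ x)) {u : L c}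
    (hu : u ∈ gradeL c 2) : f u = g u := by
  induction hu using Submodule.closure_induction with
  | zero => simp
  | add u v _ _ hu hv => rw [map_add, map_add, hu, hv]
  | smul_mem r u hu =>
    obtain ⟨w, hw, x, rfl⟩ := hu
    rw [TensorProduct.smul_tmul']
    exact h _ (Submodule.smul_mem _ _ hw) x

theorem adL_smul (x : CDerEnd c) (w : ExteriorAlgebra A W) (u : L c) :
    adL x (w • u) = x.onExt w • u + w • adL x u := by
  induction u using TensorProduct.induction_on with
  | zero => simp
  | add u v hu hv => rw [smul_add, map_add, hu, hv, map_add, smul_add, smul_add]; abel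
  | tmul a z =>
    simp only [TensorProduct.smul_tmul', adL_tmul, smul_eq_mul, CDerEnd.onExt_mul, smul_add,
      TensorProduct.add_tmul]
    abel

theorem anchor_adL (x : CDerEnd c) (u : L c) (a : ExteriorAlgebra A W) :
    anchor c (adL x u) a = x.onExt (anchor c u a) - anchor c u (x.onExt a) := by
  induction u using TensorProduct.induction_on with
  | zero => simp
  | add u v hu hv => simp only [map_add, AddMonoidHom.add_apply, hu, hv]; abel
  | tmul b y =>
    simp only [adL_tmul, map_add, AddMonoidHom.add_apply, anchor_tmul, CDerEnd.onExt_comm,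
      CDerEnd.onExt_mul, mul_sub]
    abel

theorem repOm_adL (x : CDerEnd c) (u : L c) (a : ExtOm A W) :
    repOm c (adL x u) a = x.onExtOm (repOm c u a) - repOm c u (x.onExtOm a) := by
  induction u using TensorProduct.induction_on with
  | zero => simp
  | add u v hu hv => simp only [map_add, AddMonoidHom.add_apply, hu, hv]; abel
  | tmul b y =>
    simp only [adL_tmul, map_add, AddMonoidHom.add_apply, repOm_tmul, CDerEnd.onExtOm_comm,
      CDerEnd.onExtOm_lmul, smul_sub]
    abel

theorem onExt_contractLeft (x : CDerEnd c) (α β : Module.Dual A W)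
    (h : ∀ v, β v = x.sym (α v) - α (x.op v)) (a : ExteriorAlgebra A W) :
    x.onExt (CliffordAlgebra.contractLeft α a) =
      CliffordAlgebra.contractLeft β a + CliffordAlgebra.contractLeft α (x.onExt a) := by
  induction a using CliffordAlgebra.left_induction with
  | algebraMap r =>
    rw [show algebraMap A (CliffordAlgebra (0 : QuadraticForm A W)) r =
      algebraMap A (ExteriorAlgebra A W) r from rfl, CDerEnd.onExt_algebraMap]
    simp [CliffordAlgebra.contractLeft_algebraMap]
  | add a b ha hb => simp only [map_add, ha, hb]; abel
  | ι_mul a w ha =>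
    have e : x.onExt (CliffordAlgebra.ι 0 w * a) =
        CliffordAlgebra.ι 0 (x.op w) * a + CliffordAlgebra.ι 0 w * x.onExt a := by
      rw [CDerEnd.onExt_mul]
      congr 2
      exact x.onExt_ι w
    have e' : x.onExt (CliffordAlgebra.ι 0 w * CliffordAlgebra.contractLeft α a) =
        CliffordAlgebra.ι 0 (x.op w) * CliffordAlgebra.contractLeft α a
          + CliffordAlgebra.ι 0 w * x.onExt (CliffordAlgebra.contractLeft α a) := by
      rw [CDerEnd.onExt_mul]
      congr 2
      exact x.onExt_ι w
    rw [e, CliffordAlgebra.contractLeft_ι_mul, CliffordAlgebra.contractLeft_ι_mul, map_add,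
      CliffordAlgebra.contractLeft_ι_mul, CliffordAlgebra.contractLeft_ι_mul, map_sub, e', ha,
      CDerEnd.onExt_smul, h, mul_add, sub_smul]
    abel

theorem adL_weyl (x : CDerEnd c) {u : L c} (hu : u ∈ weyl c) : adL x u ∈ weyl c := by
  obtain ⟨h1, h2, h3⟩ := hu
  rw [repL_eq_zero] at h2
  refine ⟨?_, ?_, ?_⟩
  · clear h2 h3
    induction h1 using Submodule.span_induction with
    | mem u hu =>
      obtain ⟨w, hw, y, rfl⟩ := hu
      rw [adL_tmul]
      exact add_mem (Submodule.subset_span ⟨_, x.onExt_mem 2 hw, y, rfl⟩)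
        (Submodule.subset_span ⟨_, hw, _, rfl⟩)
    | zero => rw [map_zero]; exact zero_mem _
    | add u v _ _ hu hv => rw [map_add]; exact add_mem hu hv
    | smul r u hu' hu =>
      have := adL_smul x (algebraMap A _ r) u
      rw [CDerEnd.onExt_algebraMap, algebraMap_smul, algebraMap_smul, algebraMap_smul] at this
      rw [this]
      exact add_mem (Submodule.smul_mem _ _ hu') (Submodule.smul_mem _ _ hu)
  · rw [repL_eq_zero]
    constructor
    · ext a; rw [anchor_adL, h2.1]; simp
    · ext1 a; rw [repOm_adL, h2.2]; simp
  · intro g hg w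
    obtain ⟨b, hb⟩ := x.2.2 g hg
    change ∀ w w', x.sym (g w w') = g (x.op w) w' + g w (x.op w') + b * g w w' at hb
    have key : ∀ u : L c, ricci g w (adL x u) =
        x.onExt (ricci g w u) - b • ricci g w u - ricci g (x.op w) u := by
      intro u
      induction u using TensorProduct.induction_on with
      | zero => simp
      | add u v hu hv => simp only [map_add, hu, hv, smul_add]; abel
      | tmul a y =>
        rw [adL_tmul, map_add, ricci_tmul, ricci_tmul, ricci_tmul, ricci_tmul,
          onExt_contractLeft x (g (y.op w)) (g (x.op (y.op w)) + b • g (y.op w))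
            (fun v => by rw [hb]; simp; ring), CDerEnd.op_comm]
        simp only [map_add, map_sub, map_smul, LinearMap.add_apply, LinearMap.sub_apply,
          LinearMap.smul_apply]
        abel
    rw [key, h3 g hg, h3 g hg]; simp

theorem backL_smul_weyl (w : ExteriorAlgebra A W) (x : CDerEnd c) (a : ExteriorAlgebra A W)
    {u : L c} (hu : u ∈ weyl c) : backL w x (a • u) = 0 := by
  obtain ⟨h1, h2, -⟩ := hu
  rw [repL_eq_zero] at h2
  have key : ((backL w x).toAddMonoidHom.comp (lmulHom a)) u =
      (((TensorProduct.mk A (ExteriorAlgebra A W) (CDerEnd c)).flip x).toAddMonoidHom.comp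
        ((AddMonoidHom.mulRight a).comp
          ((AddMonoidHom.eval w).comp (anchor c).toAddMonoidHom))) u := by
    refine gradeL_induction ?_ h1
    intro b hb y
    simp only [AddMonoidHom.comp_apply, lmulHom_apply, TensorProduct.smul_tmul', smul_eq_mul,
      LinearMap.toAddMonoidHom_coe, backL_tmul, AddMonoidHom.eval_apply_apply, anchor_tmul,
      AddMonoidHom.coe_mulRight, LinearMap.flip_apply, TensorProduct.mk_apply]
    rw [even_comm hb (y.onExt w), mul_assoc (y.onExt w), ← even_comm hb a]
  change ((backL w x).toAddMonoidHom.comp (lmulHom a)) u = 0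
  rw [key]
  simp [h2.1]

theorem bracketL_right_mem (v : L c) {u : L c} (hu : u ∈ weylIdeal c) :
    bracketL c v u ∈ weylIdeal c := by
  induction v using TensorProduct.induction_on with
  | zero => simp
  | add v v' hv hv' => rw [map_add, AddMonoidHom.add_apply]; exact add_mem hv hv'
  | tmul w x =>
    rw [bracketL_tmul]
    induction hu using Submodule.closure_induction with
    | zero => simp
    | add u v _ _ hu hv => rw [map_add, map_add, smul_add, add_sub_add_comm]; exact add_mem hu hv
    | smul_mem a u hu =>
      rw [backL_smul_weyl w x a hu, sub_zero, adL_smul]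
      exact Submodule.smul_mem _ _ (add_mem (Submodule.smul_mem _ _ (Submodule.subset_span hu))
        (Submodule.smul_mem _ _ (Submodule.subset_span (adL_weyl x hu))))

theorem bracketL_smul_weyl (a b : ExteriorAlgebra A W) (y : CDerEnd c) {u : L c}
    (hu : u ∈ weyl c) :
    bracketL c (a • u) (b ⊗ₜ y) = -((a * b) • adL y u) - (y.onExt a * b) • u := by
  obtain ⟨h1, h2, -⟩ := hu
  rw [repL_eq_zero] at h2
  have key : (((bracketL c).flip (b ⊗ₜ y)).comp (lmulHom a)) u =
      (-((lmulHom (a * b)).comp (adL y)) - (lmulHom (y.onExt a * b) : L c →+ L c) +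
      ((TensorProduct.mk A (ExteriorAlgebra A W) (CDerEnd c)).flip y).toAddMonoidHom.comp
        ((AddMonoidHom.mulLeft a).comp
          ((AddMonoidHom.eval b).comp (anchor c).toAddMonoidHom)) : L c →+ L c) u := by
    refine gradeL_induction ?_ h1
    intro w hw x
    simp only [AddMonoidHom.comp_apply, lmulHom_apply, TensorProduct.smul_tmul', smul_eq_mul,
      LinearMap.toAddMonoidHom_coe, AddMonoidHom.eval_apply_apply, anchor_tmul,
      AddMonoidHom.coe_mulLeft, LinearMap.flip_apply, TensorProduct.mk_apply,
      AddMonoidHom.flip_apply, bracketL_tmul_tmul, AddMonoidHom.add_apply, AddMonoidHom.sub_apply,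
      AddMonoidHom.neg_apply, adL_tmul, smul_add, CDerEnd.onExt_mul, add_mul,
      TensorProduct.add_tmul, y.comm_anti x, TensorProduct.tmul_neg, smul_neg]
    rw [mul_assoc (y.onExt a), even_comm hw b, mul_assoc a (y.onExt w),
      even_comm (y.onExt_mem 2 hw) b, mul_assoc a w b, even_comm hw b]
    simp only [mul_assoc]
    abel
  change (((bracketL c).flip (b ⊗ₜ y)).comp (lmulHom a)) u = _
  rw [key]
  simp [h2.1]

theorem bracketL_left_mem (v : L c) {u : L c} (hu : u ∈ weylIdeal c) :
    bracketL c u v ∈ weylIdeal c := by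
  induction v using TensorProduct.induction_on with
  | zero => simp
  | add v v' hv hv' => rw [map_add]; exact add_mem hv hv'
  | tmul b y =>
    induction hu using Submodule.closure_induction with
    | zero => simp
    | add u v _ _ hu hv => rw [map_add, AddMonoidHom.add_apply]; exact add_mem hu hv
    | smul_mem a u hu =>
      rw [bracketL_smul_weyl a b y hu]
      exact sub_mem (neg_mem (Submodule.smul_mem _ _ (Submodule.subset_span (adL_weyl y hu))))
        (Submodule.smul_mem _ _ (Submodule.subset_span hu))

/-- `ℰ = ℒ / ℐ`. -/
abbrev E (c : Set (LinearMap.BilinForm A W)) : Type _ := L c ⧸ weylIdeal c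

/-- The class in `ℰ` of `ω δ`. -/
def mkE (w : ExteriorAlgebra A W) (x : CDerEnd c) : E c := (weylIdeal c).mkQ (w ⊗ₜ x)

/-- The bracket of the graded Lie algebra `ℰ`, induced by that of `ℒ`. -/
def bracketE (c : Set (LinearMap.BilinForm A W)) : E c →+ E c →+ E c :=
  QuotientAddGroup.lift (weylIdeal c).toAddSubgroup
    (AddMonoidHom.mk' (fun u => QuotientAddGroup.lift (weylIdeal c).toAddSubgroup
        ((weylIdeal c).mkQ.toAddMonoidHom.comp (bracketL c u))
        (fun v hv => (Submodule.Quotient.mk_eq_zero _).2 (bracketL_right_mem u hv)))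
      (fun u u' => by
        apply QuotientAddGroup.addMonoidHom_ext
        ext v
        change (weylIdeal c).mkQ (bracketL c (u + u') v) =
          (weylIdeal c).mkQ (bracketL c u v) + (weylIdeal c).mkQ (bracketL c u' v)
        rw [map_add, AddMonoidHom.add_apply, map_add]))
    (fun u hu => by
      apply QuotientAddGroup.addMonoidHom_ext
      ext v
      exact (Submodule.Quotient.mk_eq_zero _).2 (bracketL_left_mem v hu))

theorem bracketE_mk (u v : L c) :
    bracketE c ((weylIdeal c).mkQ u) ((weylIdeal c).mkQ v) =
      (weylIdeal c).mkQ (bracketL c u v) := rfl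

/-- The representation of `ℰ` on `∧W ⊕ (∧W ⊗ Ω)`, induced by that of `ℒ`. -/
def repE (c : Set (LinearMap.BilinForm A W)) : E c →ₗ[A] (RepSpace A W →+ RepSpace A W) where
  toFun := QuotientAddGroup.lift (weylIdeal c).toAddSubgroup (repL c).toAddMonoidHom
    (fun _ hu => repL_weylIdeal hu)
  map_add' := map_add _
  map_smul' f e := by
    obtain ⟨u, rfl⟩ := (weylIdeal c).mkQ_surjective e
    exact map_smul (repL c) f u

theorem repE_mk (u : L c) : repE c ((weylIdeal c).mkQ u) = repL c u := rfl

/-- The piece of `ℰ` of degree `n`. -/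
def gradeE (c : Set (LinearMap.BilinForm A W)) (n : ℕ) : Submodule A (E c) :=
  (gradeL c n).map ((weylIdeal c).mkQ.restrictScalars A)

/-! ### Filtrations with a compatible `ℤ/2`-grading -/

section Filtration

variable {X : Type*} [AddCommGroup X] [Module A X]

/-- `S` is a graded subspace with respect to the grading `𝒜` of the ambient space. -/
def IsGradedSubspace (𝒜 : ℕ → Submodule A X) (S : Submodule A X) : Prop :=
  S = ⨆ n, S ⊓ 𝒜 n

/-- The pieces `F_{◁p} X = F_p X ∩ X_{p mod 2}`. -/
def lead (P : ZMod 2 → Submodule A X) (F : ℕ → Submodule A X) (p : ℕ) : Submodule A X :=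
  F p ⊓ P p

/-- `(F_p X)` is a filtration with compatible `ℤ/2`-grading `X = X_0 ⊕ X_1`, where `X_i = P i`. -/
structure IsZ2Filtration (𝒜 : ℕ → Submodule A X) (P : ZMod 2 → Submodule A X)
    (F : ℕ → Submodule A X) : Prop where
  graded_part : ∀ i, IsGradedSubspace 𝒜 (P i)
  graded : ∀ p, IsGradedSubspace 𝒜 (F p)
  isCompl : IsCompl (P 0) (P 1)
  mono : ∀ p, F p ≤ F (p + 1)
  exhaust : ∃ p, F p = ⊤
  split_zero : F 0 = lead P F 0
  split_succ : ∀ p, F (p + 1) = lead P F (p + 1) ⊔ lead P F p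

/-- The filtration `F_p = F_{◁p} ⊕ F_{◁(p-1)}` determined by the pieces `F_{◁p}`. -/
def ofLead (G : ℕ → Submodule A X) : ℕ → Submodule A X
  | 0 => G 0
  | p + 1 => G (p + 1) ⊔ G p

/-- A (one- or many-index) filtration of a graded Lie algebra with bracket `br`. -/
structure IsGLAFiltration {ι : Type*} [Preorder ι] [Add ι] (𝒜 : ℕ → Submodule A X)
    (br : X →+ X →+ X) (F : ι → Submodule A X) : Prop where
  graded : ∀ p, IsGradedSubspace 𝒜 (F p)
  mono : Monotone F
  exhaust : ∃ p, F p = ⊤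
  bracket_mem : ∀ p q, ∀ x ∈ F p, ∀ y ∈ F q, br x y ∈ F (p + q)

end Filtration

/-! ### The filtrations associated to a decomposition `W = V 0 ⊕ V 1` -/

/-- The part of `∧W` of degree `k` in `V 1`, namely `∧(V 0) ⊗ ∧^k(V 1)`. -/
def extPiece (V : ZMod 2 → Submodule A W) (k : ℕ) : Submodule A (ExteriorAlgebra A W) :=
  Subalgebra.toSubmodule (Algebra.adjoin A (ExteriorAlgebra.ι A '' (V 0 : Set W))) *
    ((V 1).map (ExteriorAlgebra.ι A)) ^ k

/-- `(∧W)_i`: the degree in `V 1` is congruent to `i` mod 2. -/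
def extPart (V : ZMod 2 → Submodule A W) (i : ZMod 2) : Submodule A (ExteriorAlgebra A W) :=
  ⨆ (k : ℕ) (_ : (k : ZMod 2) = i), extPiece V k

/-- `F_{◁p}(∧W)`: the degree in `V 1` is at most `p` and congruent to `p` mod 2. -/
def extLead (V : ZMod 2 → Submodule A W) (p : ℕ) : Submodule A (ExteriorAlgebra A W) :=
  ⨆ (k : ℕ) (_ : k ≤ p ∧ (k : ZMod 2) = p), extPiece V k

/-- A `ℤ/2`-graded filtration of `∧W` respects the unital algebra structure and the injection
`W → ∧W`, where `F_{◁0} W = V 0` and `F_{◁1} W = V 1`. -/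
structure RespectsExt (V : ZMod 2 → Submodule A W)
    (P : ZMod 2 → Submodule A (ExteriorAlgebra A W))
    (F : ℕ → Submodule A (ExteriorAlgebra A W)) : Prop where
  one_mem : 1 ∈ lead P F 0
  mul_mem : ∀ p q, ∀ a ∈ lead P F p, ∀ b ∈ lead P F q, a * b ∈ lead P F (p + q)
  ι_zero : ∀ w ∈ V 0, ExteriorAlgebra.ι A w ∈ lead P F 0
  ι_one : ∀ w ∈ V 1, ExteriorAlgebra.ι A w ∈ lead P F 1

/-- `S ⊗ Ω` as a submodule of `∧W ⊗ Ω`. -/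
def tensOm (S : Submodule A (ExteriorAlgebra A W)) : Submodule A (ExtOm A W) :=
  Submodule.span A {u | ∃ w ∈ S, ∃ z : Om A W, u = w ⊗ₜ[A] z}

/-- `F_{◁p}` of the representation space. -/
def repLead (V : ZMod 2 → Submodule A W) (p : ℕ) : Submodule A (RepSpace A W) :=
  (extLead V p).prod (tensOm (extLead V p))

/-- The `ℤ/2`-grading of `CDerEnd(W)`: the elements mapping `V j` to `V (j + i)`. -/
def CDerEnd.part (c : Set (LinearMap.BilinForm A W)) (V : ZMod 2 → Submodule A W) (i : ZMod 2) :
    Submodule A (CDerEnd c) where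
  carrier := {x | ∀ j, ∀ w ∈ V j, x.op w ∈ V (j + i)}
  add_mem' hx hy j _ hw := add_mem (hx j _ hw) (hy j _ hw)
  zero_mem' j _ _ := zero_mem (V (j + i))
  smul_mem' f _ hx j _ hw := Submodule.smul_mem _ f (hx j _ hw)

/-- The `ℤ/2`-grading of `ℒ`. -/
def partL (c : Set (LinearMap.BilinForm A W)) (V : ZMod 2 → Submodule A W) (i : ZMod 2) :
    Submodule A (L c) :=
  Submodule.span A {u | ∃ a b : ZMod 2, a + b = i ∧
    ∃ w ∈ extPart V a, ∃ x ∈ CDerEnd.part c V b, u = w ⊗ₜ[A] x}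

/-- The `ℤ/2`-grading of `ℰ`. -/
def partE (c : Set (LinearMap.BilinForm A W)) (V : ZMod 2 → Submodule A W) (i : ZMod 2) :
    Submodule A (E c) :=
  (partL c V i).map ((weylIdeal c).mkQ.restrictScalars A)

/-- The induced pieces `F_{◁p} ℰ`: the elements of `ℰ_{p mod 2}` that map `F_{◁q}` of the
representation space to `F_{◁(q+p)}`, for all `q`. -/
def leadE (c : Set (LinearMap.BilinForm A W)) (V : ZMod 2 → Submodule A W) (p : ℕ) :
    Submodule A (E c) where
  carrier := {e | e ∈ partE c V p ∧ ∀ q, ∀ x ∈ repLead V q, repE c e x ∈ repLead V (q + p)}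
  add_mem' := fun ⟨h, h'⟩ ⟨k, k'⟩ => ⟨add_mem h k, fun q x hx => by
    rw [map_add, AddMonoidHom.add_apply]; exact add_mem (h' q x hx) (k' q x hx)⟩
  zero_mem' := ⟨zero_mem _, fun q x hx => by
    rw [map_zero, AddMonoidHom.zero_apply]; exact zero_mem _⟩
  smul_mem' := fun f _ ⟨h, h'⟩ => ⟨Submodule.smul_mem _ _ h, fun q x hx => by
    rw [map_smul, AddMonoidHom.smul_apply]; exact Submodule.smul_mem _ _ (h' q x hx)⟩

/-- The one-index BKL filtration `F_p ℰ` associated to the decomposition `W = V 0 ⊕ V 1`. -/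
def bkl (c : Set (LinearMap.BilinForm A W)) (V : ZMod 2 → Submodule A W) :
    ℕ → Submodule A (E c) :=
  ofLead (leadE c V)

/-! ### Conformally orthonormal bases and the explicit grading -/

/-- The Minkowski matrix `diag(-1,1,1,1)`. -/
def mink (A : Type*) [CommRing A] (i j : Fin 4) : A :=
  if i = j then (if i = 0 then -1 else 1) else 0

/-- `θ` is a conformally orthonormal basis of `W` for the conformal class `c`: some `g` in `c` has
matrix `diag(-1,1,1,1)` in the basis `θ`. (The other members of `c` are multiples of `g` by
invertible functions, which is automatic for a conformal class in the sense of
`IsConformalClass`.) -/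
structure IsConfFrame (c : Set (LinearMap.BilinForm A W)) (θ : Module.Basis (Fin 4) A W) :
    Prop where
  exists_rep : ∃ g ∈ c, (∀ i j, g (θ i) (θ j) = mink A i j) ∧ ∀ g' ∈ c, ∃ u : Aˣ, g' = (u : A) • g

/-- The elementary operator `θ b ↦ θ a`. -/
def elem (θ : Module.Basis (Fin 4) A W) (a b : Fin 4) : W →ₗ[A] W :=
  (θ.coord b).smulRight (θ a)

/-- The operator on `W` of `D : Der(A)` that annihilates the basis `θ`. -/
def derOp (θ : Module.Basis (Fin 4) A W) (D : Derivation ℝ A A) : W →+ W where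
  toFun w := ∑ i, D (θ.coord i w) • θ i
  map_zero' := by simp
  map_add' v w := by simp [add_smul, Finset.sum_add_distrib]

theorem linear_mem_cDerEnd (θ : Module.Basis (Fin 4) A W) (hθ : IsConfFrame c θ) (T : W →ₗ[A] W)
    (k : A) (hT : ∀ g : LinearMap.BilinForm A W, (∀ i j, g (θ i) (θ j) = mink A i j) →
      ∀ i j, g (T (θ i)) (θ j) + g (θ i) (T (θ j)) + k * g (θ i) (θ j) = 0) :
    ((0, T.toAddMonoidHom) : Derivation ℝ A A × (W →+ W)) ∈ cDerEnd c := by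
  refine ⟨fun f w => by simp, fun g' hg' => ⟨k, ?_⟩⟩
  obtain ⟨g, -, hg, hu⟩ := hθ.exists_rep
  obtain ⟨u, rfl⟩ := hu g' hg'
  have key : g.comp T LinearMap.id + g.comp LinearMap.id T + k • g = 0 := by
    refine LinearMap.BilinForm.ext_basis θ fun i j => ?_
    simpa using hT g hg i j
  intro w w'
  have := congrArg (fun b : LinearMap.BilinForm A W => (u : A) * b w w') key
  simp only [LinearMap.add_apply, LinearMap.smul_apply, smul_eq_mul, LinearMap.zero_apply,
    LinearMap.BilinForm.comp_apply, LinearMap.id_apply, mul_zero] at this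
  simp only [Derivation.coe_zero, Pi.zero_apply, LinearMap.smul_apply, smul_eq_mul,
    LinearMap.toAddMonoidHom_coe]
  linear_combination -this

theorem elem_apply (θ : Module.Basis (Fin 4) A W) (a b j : Fin 4) :
    elem θ a b (θ j) = if j = b then θ a else 0 := by
  simp only [elem, LinearMap.smulRight_apply, Module.Basis.coord_apply, Module.Basis.repr_self]
  by_cases h : j = b
  · simp [h]
  · simp [h]

/-- `σ_0`: the identity of `W`. -/
def sigma0 {θ : Module.Basis (Fin 4) A W} (hθ : IsConfFrame c θ) : CDerEnd c :=
  ⟨(0, (LinearMap.id : W →ₗ[A] W).toAddMonoidHom),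
    linear_mem_cDerEnd θ hθ LinearMap.id (-2) (fun g _ i j => by simp; ring)⟩

/-- `σ_i`, for `i = 1,2,3`: the boost `θ_0 ↦ θ_i`, `θ_i ↦ θ_0`. -/
def boost {θ : Module.Basis (Fin 4) A W} (hθ : IsConfFrame c θ) (i : Fin 3) : CDerEnd c :=
  ⟨(0, (elem θ i.succ 0 + elem θ 0 i.succ).toAddMonoidHom),
    linear_mem_cDerEnd θ hθ _ 0 (fun g hg a b => by
      fin_cases i <;> fin_cases a <;> fin_cases b <;>
        simp [elem_apply, hg, mink])⟩

/-- `σ_{ij}`, for distinct `i, j = 1,2,3`: the rotation `θ_j ↦ θ_i`, `θ_i ↦ -θ_j`. -/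
def rot {θ : Module.Basis (Fin 4) A W} (hθ : IsConfFrame c θ) (i j : Fin 3) : CDerEnd c :=
  ⟨(0, (elem θ i.succ j.succ - elem θ j.succ i.succ).toAddMonoidHom),
    linear_mem_cDerEnd θ hθ _ 0 (fun g hg a b => by
      fin_cases i <;> fin_cases j <;> fin_cases a <;> fin_cases b <;>
        simp [elem_apply, hg, mink])⟩

theorem derOp_apply (θ : Module.Basis (Fin 4) A W) (D : Derivation ℝ A A) (w : W) :
    derOp θ D w = ∑ i, D (θ.repr w i) • θ i := rfl

theorem derOp_smul (θ : Module.Basis (Fin 4) A W) (D : Derivation ℝ A A) (f : A) (w : W) :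
    derOp θ D (f • w) = D f • w + f • derOp θ D w := by
  have e : D f • w = ∑ i, (D f * θ.repr w i) • θ i := by
    conv_lhs => rw [← θ.sum_repr w]
    simp only [Finset.smul_sum, smul_smul]
  rw [e, derOp_apply, derOp_apply, Finset.smul_sum, ← Finset.sum_add_distrib]
  refine Finset.sum_congr rfl fun i _ => ?_
  rw [map_smul, Finsupp.smul_apply, smul_eq_mul, Derivation.leibniz, smul_eq_mul, smul_eq_mul]
  module

theorem derOp_form (θ : Module.Basis (Fin 4) A W) (D : Derivation ℝ A A)
    (g : LinearMap.BilinForm A W) (hg : ∀ i j, g (θ i) (θ j) = mink A i j) (w w' : W) :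
    D (g w w') = g (derOp θ D w) w' + g w (derOp θ D w') := by
  have h : ∀ i j, D (mink A i j) = 0 := by
    intro i j
    unfold mink
    split_ifs <;> simp
  have e : ∀ a b : Fin 4 → A,
      g (∑ i, a i • θ i) (∑ j, b j • θ j) = ∑ i, ∑ j, a i * (b j * mink A i j) := by
    intro a b
    simp only [map_sum, map_smul, LinearMap.sum_apply, LinearMap.smul_apply, smul_eq_mul, hg,
      Finset.mul_sum]
    rw [Finset.sum_comm]
    refine Finset.sum_congr rfl fun i _ => Finset.sum_congr rfl fun j _ => ?_
    ring
  have e0 : g w w' = ∑ i, ∑ j, θ.repr w i * (θ.repr w' j * mink A i j) := by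
    rw [← e, θ.sum_repr, θ.sum_repr]
  have e1 : g (derOp θ D w) w' = ∑ i, ∑ j, D (θ.repr w i) * (θ.repr w' j * mink A i j) := by
    rw [← e, θ.sum_repr]; rfl
  have e2 : g w (derOp θ D w') = ∑ i, ∑ j, θ.repr w i * (D (θ.repr w' j) * mink A i j) := by
    rw [← e, θ.sum_repr]; rfl
  rw [e0, e1, e2]
  simp only [map_sum, Derivation.leibniz, h, smul_eq_mul, mul_zero, zero_add,
    ← Finset.sum_add_distrib]
  refine Finset.sum_congr rfl fun i _ => Finset.sum_congr rfl fun j _ => ?_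
  ring

/-- The basis-dependent injection `Der(A) → CDerEnd(W)`. -/
def der {θ : Module.Basis (Fin 4) A W} (hθ : IsConfFrame c θ) (D : Derivation ℝ A A) :
    CDerEnd c :=
  ⟨(D, derOp θ D), by
    refine ⟨derOp_smul θ D, fun g' hg' => ?_⟩
    obtain ⟨g, -, hg, hu⟩ := hθ.exists_rep
    obtain ⟨u, rfl⟩ := hu g' hg'
    refine ⟨D u * (↑u⁻¹ : A), fun w w' => ?_⟩
    simp only [LinearMap.smul_apply, smul_eq_mul, Derivation.leibniz, derOp_form θ D g hg]
    linear_combination -(g w w' * D (u : A)) * u.inv_mul⟩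

/-! The explicit generators. Elements of `ℰ` are written `mkE ω δ`. In this part `th0 θ` is `θ_0`,
and an index `i = 0, 1, 2 : Fin 3` stands for the spatial index `1, 2, 3`, so that `th θ i`,
`boost hθ i`, `rot hθ i j` are `θ_{i+1}`, `σ_{i+1}`, `σ_{(i+1)(j+1)}`. -/

section Table

/-- The basis element `θ_0` in `∧W`. -/
def th0 (θ : Module.Basis (Fin 4) A W) : ExteriorAlgebra A W := ExteriorAlgebra.ι A (θ 0)

/-- The basis elements `θ_1, θ_2, θ_3` in `∧W`. -/
def th (θ : Module.Basis (Fin 4) A W) (i : Fin 3) : ExteriorAlgebra A W :=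
  ExteriorAlgebra.ι A (θ i.succ)

variable {θ : Module.Basis (Fin 4) A W} (hθ : IsConfFrame c θ)

/-- The elements `ω D` of `ℰ`, for `D : Der(A)`. -/
def derSet (w : ExteriorAlgebra A W) : Set (E c) := {e | ∃ D, e = mkE w (der hθ D)}

/-- Generators for `000`. -/
def gen000 : Set (E c) :=
  derSet hθ 1 ∪
  {mkE 1 (sigma0 hθ),
    mkE (th0 θ) (sigma0 hθ) + mkE (th θ 0) (boost hθ 0),
    mkE (th0 θ) (sigma0 hθ) + mkE (th θ 1) (boost hθ 1),
    mkE (th0 θ) (sigma0 hθ) + mkE (th θ 2) (boost hθ 2),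
    mkE (th θ 1 * th θ 2) (rot hθ 1 2) + mkE (th θ 2 * th θ 0) (rot hθ 2 0)
      + mkE (th θ 0 * th θ 1) (rot hθ 0 1) + (2 : A) • mkE (th0 θ * th θ 0) (boost hθ 0)
      + (2 : A) • mkE (th0 θ * th θ 1) (boost hθ 1)
      + (2 : A) • mkE (th0 θ * th θ 2) (boost hθ 2)}

/-- Generators for `200`, and for `020`, `002` by cyclic permutation. -/
def gen200 (i j k : Fin 3) : Set (E c) :=
  {-mkE (th θ i) (rot hθ j k) + mkE (th θ j) (rot hθ k i) + mkE (th θ k) (rot hθ i j)}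

/-- Generators for `011`, and for `101`, `110` by cyclic permutation. -/
def gen011 (i j k : Fin 3) : Set (E c) :=
  derSet hθ (th θ i) ∪
  {mkE 1 (boost hθ i),
    mkE 1 (rot hθ j k),
    mkE (th0 θ) (boost hθ i) + mkE (th θ i) (sigma0 hθ),
    mkE (th θ j) (boost hθ k) + mkE (th θ k) (boost hθ j),
    mkE (th θ k) (rot hθ k i),
    mkE (th θ j) (rot hθ i j),
    mkE (th0 θ * th θ j) (rot hθ i j) + mkE (th θ i * th θ j) (boost hθ j)}

/-- Generators for `211`, and for `121`, `112` by cyclic permutation. -/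
def gen211 (i j k : Fin 3) : Set (E c) :=
  derSet hθ (th θ j * th θ k) ∪
  {mkE (th θ j) (boost hθ k) - mkE (th θ k) (boost hθ j),
    mkE (th0 θ * th θ j) (boost hθ k) - mkE (th0 θ * th θ k) (boost hθ j)
      - (2 : A) • mkE (th θ j * th θ k) (sigma0 hθ),
    mkE (th0 θ * th θ j) (boost hθ k) + mkE (th0 θ * th θ k) (boost hθ j)
      - (2 : A) • mkE (th θ i * th θ j) (rot hθ k i)}

/-- Generators for `222`. -/
def gen222 : Set (E c) :=
  derSet hθ (th θ 0 * th θ 1 * th θ 2) ∪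
  {mkE (th0 θ * th θ 0) (rot hθ 1 2) + mkE (th0 θ * th θ 1) (rot hθ 2 0)
      + mkE (th0 θ * th θ 2) (rot hθ 0 1)
      - (2 : A) • mkE (th θ 1 * th θ 2) (boost hθ 0)
      - (2 : A) • mkE (th θ 2 * th θ 0) (boost hθ 1)
      - (2 : A) • mkE (th θ 0 * th θ 1) (boost hθ 2),
    mkE (th0 θ * th θ 1 * th θ 2) (boost hθ 0) + mkE (th0 θ * th θ 2 * th θ 0) (boost hθ 1)
      + mkE (th0 θ * th θ 0 * th θ 1) (boost hθ 2)
      + (3 : A) • mkE (th θ 0 * th θ 1 * th θ 2) (sigma0 hθ)}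

/-- The generators of the `A`-submodules `G_α ℰ_G`. -/
def gens : ℕ × ℕ × ℕ → Set (E c)
  | (0, 0, 0) => gen000 hθ
  | (2, 0, 0) => gen200 hθ 0 1 2
  | (0, 2, 0) => gen200 hθ 1 2 0
  | (0, 0, 2) => gen200 hθ 2 0 1
  | (0, 1, 1) => gen011 hθ 0 1 2
  | (1, 0, 1) => gen011 hθ 1 2 0
  | (1, 1, 0) => gen011 hθ 2 0 1
  | (2, 1, 1) => gen211 hθ 0 1 2
  | (1, 2, 1) => gen211 hθ 1 2 0
  | (1, 1, 2) => gen211 hθ 2 0 1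
  | (2, 2, 2) => gen222 hθ
  | _ => ∅

/-- `G_α ℰ_G`. -/
def GG (α : ℕ × ℕ × ℕ) : Submodule A (E c) := Submodule.span A (gens hθ α)

/-- Multiplication by `θ_0` on `ℰ`. -/
def mulTh0 (c : Set (LinearMap.BilinForm A W)) (θ : Module.Basis (Fin 4) A W) : E c →ₗ[A] E c :=
  Algebra.lsmul A A (E c) (th0 θ)

/-- `G_α ℰ = G_α ℰ_G ⊕ θ_0 (G_α ℰ_G)`. -/
def G (α : ℕ × ℕ × ℕ) : Submodule A (E c) := GG hθ α ⊔ (GG hθ α).map (mulTh0 c θ)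

/-- `ℰ_G = ⊕_α G_α ℰ_G`. -/
def EG : Submodule A (E c) := ⨆ α, GG hθ α

/-- `S` is stable under multiplication by `θ_0`, and free as a module over the exterior algebra
`A 1 ⊕ A θ_0` in one generator. -/
def IsFreeOverTh0 (θ : Module.Basis (Fin 4) A W) (S : Submodule A (E c)) : Prop :=
  ∃ T : Submodule (Algebra.adjoin A {th0 θ}) (E c), (T : Set (E c)) = S ∧
    Module.Free (Algebra.adjoin A {th0 θ}) T

end Table

/-- The decomposition `W = (A θ_a ⊕ A θ_b) ⊕ (A θ_c ⊕ A θ_d)`. -/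
def frameDecomp (θ : Module.Basis (Fin 4) A W) (a b c d : Fin 4) (i : ZMod 2) : Submodule A W :=
  if i = 0 then Submodule.span A {θ a, θ b} else Submodule.span A {θ c, θ d}

/-- Orthogonal decompositions `W = V 0 ⊕ V 1` into submodules of signature `-+` and `++`. -/
def IsOrthDecomp (c : Set (LinearMap.BilinForm A W)) (V : ZMod 2 → Submodule A W) : Prop :=
  ∃ θ : Module.Basis (Fin 4) A W, IsConfFrame c θ ∧ V = frameDecomp θ 0 1 2 3

/-- The one-index BKL filtration `F` of a conformally orthonormal basis. -/
def bkl1 (c : Set (LinearMap.BilinForm A W)) (θ : Module.Basis (Fin 4) A W) :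
    ℕ → Submodule A (E c) := bkl c (frameDecomp θ 0 1 2 3)

/-- The one-index BKL filtration `F'` of a conformally orthonormal basis. -/
def bkl2 (c : Set (LinearMap.BilinForm A W)) (θ : Module.Basis (Fin 4) A W) :
    ℕ → Submodule A (E c) := bkl c (frameDecomp θ 0 2 3 1)

/-- The one-index BKL filtration `F''` of a conformally orthonormal basis. -/
def bkl3 (c : Set (LinearMap.BilinForm A W)) (θ : Module.Basis (Fin 4) A W) :
    ℕ → Submodule A (E c) := bkl c (frameDecomp θ 0 3 1 2)

/-- The 2-index BKL filtration `F_{p₂p₃} = F'_{p₂} ∩ F''_{p₃}`. -/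
def bkl23 (c : Set (LinearMap.BilinForm A W)) (θ : Module.Basis (Fin 4) A W) (p : ℕ × ℕ) :
    Submodule A (E c) := bkl2 c θ p.1 ⊓ bkl3 c θ p.2

/-- The 3-index BKL filtration `F_{p₁p₂p₃} = F_{p₁} ∩ F'_{p₂} ∩ F''_{p₃}`. -/
def bkl123 (c : Set (LinearMap.BilinForm A W)) (θ : Module.Basis (Fin 4) A W)
    (p : ℕ × ℕ × ℕ) : Submodule A (E c) := bkl1 c θ p.1 ⊓ bkl2 c θ p.2.1 ⊓ bkl3 c θ p.2.2

/-- The monomials in `θ_0, …, θ_3` (wedge products in increasing order over a subset) whose degree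
in `θ_2, θ_3` is at most `p` and congruent to `p` mod 2. -/
def leadMonomials (θ : Module.Basis (Fin 4) A W) (p : ℕ) : Set (ExteriorAlgebra A W) :=
  {m | ∃ S : Finset (Fin 4), (S ∩ {2, 3}).card ≤ p ∧ (S ∩ {2, 3}).card % 2 = p % 2 ∧
    m = ((S.sort (· ≤ ·)).map fun i => ExteriorAlgebra.ι A (θ i)).prod}

end Algebra

/-! ### The geometric setting -/

section Smooth

/-- The algebra `C^∞` of smooth real functions on a 4-manifold. -/
abbrev Smooth (M : Type*) [TopologicalSpace M] [ChartedSpace (EuclideanSpace ℝ (Fin 4)) M] :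
    Type _ :=
  C^∞⟮𝓡 4, M; ℝ⟯

/-- `c` is a conformal class of bilinear forms: all multiples of one form by positive smooth
functions. -/
def IsConformalClass {M : Type*} [TopologicalSpace M]
    [ChartedSpace (EuclideanSpace ℝ (Fin 4)) M] {W : Type*} [AddCommGroup W] [Module (Smooth M) W]
    (c : Set (LinearMap.BilinForm (Smooth M) W)) : Prop :=
  ∃ g : LinearMap.BilinForm (Smooth M) W,
    c = {g' | ∃ f : Smooth M, (∀ x, 0 < f x) ∧ g' = f • g}

end Smooth

end

end BKL

open BKL

/-! Write `A` for `C^∞`. After choosing a frame, the whole statement becomes a finite computation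
over `ℤ`, plus some lattice theory of submodules. The monomials `θ_S`, for `S ⊆ {0,1,2,3}`, form an
`A`-basis of `∧W` (`exists_mono_basis`). Conformal invariance forces an element of `CDerEnd(W)` to
be a derivation annihilating the frame plus an `A`-combination of seven operators `σ_a`
(`cDerEnd_eq`). Hence `ℒ` is the sum of sixteen copies of `Der(A)` and a free module on the 112
elements `θ_S σ_a` (`eq_sum_coef`). Each `θ_S σ_a` sends every monomial to an integer multiple of
one monomial, so the matrix entries of the representation and of the Ricci contraction are integral
functionals of the coordinates (`repr_anchor_mono`, `repr_repOm_mono`, `repr_ricci`). What remains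
are identities between integer tables, which are decided by evaluation. A common factor 6 clears
denominators and is invertible because `A` is a real algebra.

The ideal is handled first. In `∧²W ⊗ so(W)`, of rank 36, ten explicit tensors and 26 Bianchi and
Ricci equations resolve the identity, so the ten tensors span the Weyl tensors (`six_smul_weyl`).
The proposed coordinate functionals therefore vanish on the whole ideal once they vanish on monomial
multiples of these ten (`evalTerms_dual_weylIdeal`).

Next, `ℰ_G` has 48 components: the lines through 40 generators and eight copies of `Der(A)`. For
each component there is a functional reading off the coefficient of `θ_0` times that component; it
kills `ℰ_G` itself. Applied to `x` and to `θ_0 x`, these functionals recover both halves of `x` in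
`ℰ_G ⊕ θ_0 ℰ_G`. This is the structure `IsSeparated`, proved in `isSeparated_compE`. Membership in a
sum of components is then tested index by index (`IsSeparated.mem_supOn`), so such sums intersect
and add like sets of indices, and no freeness of `Der(A)` is needed. The direct sum decompositions
and all formulas for intersections follow.

For the one-index filtration the essential remark is that the degree in `W_1` is at most 2. So
`F_{◁p}` of the representation space is a full parity part as soon as `p ≥ 1`, and the condition
defining `F_{◁p} ℰ` only has content for `p = q = 0`: the element must preserve `∧W_0` and `∧W_0 ⊗
Ω`. Generators of first weight 0 do preserve them. The functionals dual to first weight 2 are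
combinations of matrix entries leading out of `∧W_0`, so they vanish on preserving elements; first
weight 1 is excluded by parity. This is `leadE_eq`. Brackets are compatible by parity, except for `p
= q = 0`, where the representation property is used (`bracketE_leadE_zero`).

The filtrations `F'` and `F''` are the filtration `F` of cyclically permuted frames, and the table
of generators is cyclically symmetric (`G_rotBasis`). Intersecting gives the multi-index
filtrations. Finally, an `A`-basis of a sum of components in `ℰ_G` is a basis of its `θ_0`-span over
`A ⊕ A θ_0` (`isFreeOverTh0_sup`). -/

namespace BKL

/-! ### Monomials in the exterior algebra

A subset of `{0, 1, 2, 3}` is encoded by the four binary digits of an element of `Fin 16`. -/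

/-- The singleton `{i}`. -/
def bit : Fin 4 → Fin 16 := ![1, 2, 4, 8]

/-- The cardinality of the subset encoded by `n`. -/
def popCount (n : ℕ) : ℕ := n % 2 + n / 2 % 2 + n / 4 % 2 + n / 8 % 2

/-- The increasing list of the elements of a subset. -/
def elems (S : Fin 16) : List (Fin 4) := (List.finRange 4).filter fun i => S.val.testBit i

/-- The sign in `θ_S θ_T = ± θ_{S ∆ T}`, zero if `S` and `T` meet. -/
def wedgeSign (S T : Fin 16) : ℤ :=
  if S.val &&& T.val = 0 then
    -- This counts the pairs `s ∈ S`, `t ∈ T` with `s > t`, that is, the transpositions that sort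
    -- `θ_S θ_T`.
    if (T.val % 2 * popCount (S.val / 2) + T.val / 2 % 2 * popCount (S.val / 4)
      + T.val / 4 % 2 * popCount (S.val / 8)) % 2 = 0 then 1 else -1
  else 0

/-- Peels off the least element. The numerical inequality `T < S` is what makes the recursion in
`mono_induction` terminate. -/
theorem exists_low (S : Fin 16) : S = 0 ∨ ∃ j : Fin 4, ∃ T : Fin 16,
    S = bit j ^^^ T ∧ T < S ∧ elems S = j :: elems T ∧ ∀ k ∈ elems T, j < k := by
  revert S; decide +kernel

theorem elems_xor_bit : ∀ (j : Fin 4) (T : Fin 16), (∀ k ∈ elems T, j < k) →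
    elems (bit j ^^^ T) = j :: elems T := by
  decide +kernel

theorem wedgeSign_bit_of_lt : ∀ (j : Fin 4) (T : Fin 16), (∀ k ∈ elems T, j < k) →
    wedgeSign (bit j) T = 1 := by
  decide +kernel

/-- The three ways in which `θ_i` can meet the increasing product `θ_j θ_T`: it cancels against
`θ_j`, it has to move past `θ_j`, or it is already in place. -/
theorem wedgeSign_bit_xor : ∀ (i j : Fin 4) (T : Fin 16), (∀ k ∈ elems T, j < k) →
    (i = j → wedgeSign (bit i) (bit j ^^^ T) = 0) ∧
    (j < i → wedgeSign (bit i) (bit j ^^^ T) = - wedgeSign (bit i) T ∧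
      (wedgeSign (bit i) T = 0 ∨ ∀ k ∈ elems (bit i ^^^ T), j < k)) ∧
    (i < j → ∀ k ∈ elems (bit j ^^^ T), i < k) := by
  decide +kernel

/-- This is the associativity `(θ_j θ_S) θ_T = θ_j (θ_S θ_T)` at the level of signs; the product
`θ_j θ_S` carries no sign because `j` is least. -/
theorem wedgeSign_xor_left : ∀ (j : Fin 4) (S T : Fin 16), (∀ k ∈ elems S, j < k) →
    wedgeSign (bit j ^^^ S) T = wedgeSign S T * wedgeSign (bit j) (S ^^^ T) := by
  decide +kernel

theorem fin16_xor_assoc : ∀ S T U : Fin 16, S ^^^ T ^^^ U = S ^^^ (T ^^^ U) := by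
  intro S T U
  apply Fin.ext
  have h : ∀ a b : Fin 16, (a ^^^ b).val = a.val ^^^ b.val := by decide +kernel
  simp only [h, Nat.xor_assoc]

theorem fin16_xor_left_comm (S T U : Fin 16) : S ^^^ (T ^^^ U) = T ^^^ (S ^^^ U) := by
  have h : ∀ a b : Fin 16, a ^^^ b = b ^^^ a := by decide +kernel
  rw [← fin16_xor_assoc, h S T, fin16_xor_assoc]

theorem fin16_zero_xor (S : Fin 16) : 0 ^^^ S = S := by revert S; decide +kernel

section

variable {A : Type*} [CommRing A] {W : Type*} [AddCommGroup W] [Module A W]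
  (θ : Module.Basis (Fin 4) A W)

/-- The monomial `θ_S`. -/
noncomputable def mono (S : Fin 16) : ExteriorAlgebra A W :=
  ((elems S).map fun i => ExteriorAlgebra.ι A (θ i)).prod

theorem mono_zero : mono θ 0 = 1 := rfl

theorem mono_xor_bit {j : Fin 4} {T : Fin 16} (h : ∀ k ∈ elems T, j < k) :
    mono θ (bit j ^^^ T) = ExteriorAlgebra.ι A (θ j) * mono θ T := by
  rw [mono, elems_xor_bit j T h, List.map_cons, List.prod_cons, mono]

theorem mono_bit (i : Fin 4) : mono θ (bit i) = ExteriorAlgebra.ι A (θ i) := by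
  have h : elems (bit i) = [i] := by revert i; decide +kernel
  rw [mono, h]; simp

theorem mono_induction {p : Fin 16 → Prop} (h0 : p 0)
    (h : ∀ (j : Fin 4) (T : Fin 16), (∀ k ∈ elems T, j < k) → p T → p (bit j ^^^ T))
    (S : Fin 16) : p S := by
  induction S using WellFoundedLT.induction with
  | ind S ih =>
    rcases exists_low S with rfl | ⟨j, T, hS, hT, -, hj⟩
    · exact h0
    · rw [hS]; exact h j T hj (ih T hT)

theorem ι_mul_mono (i : Fin 4) (T : Fin 16) :
    ExteriorAlgebra.ι A (θ i) * mono θ T = wedgeSign (bit i) T • mono θ (bit i ^^^ T) := by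
  induction T using mono_induction with
  | h0 =>
    have h : ∀ i, wedgeSign (bit i) 0 = 1 ∧ bit i ^^^ 0 = bit i := by decide +kernel
    rw [(h i).1, (h i).2, mono_zero, mono_bit, mul_one, one_smul]
  | h j T hj ih =>
    obtain ⟨h1, h2, h3⟩ := wedgeSign_bit_xor i j T hj
    rcases lt_trichotomy i j with h | h | h
    · have h' := h3 h
      rw [mono_xor_bit θ h', wedgeSign_bit_of_lt _ _ h', one_smul]
    · subst h
      rw [h1 rfl, zero_smul, mono_xor_bit θ hj, ← mul_assoc, ExteriorAlgebra.ι_sq_zero, zero_mul]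
    -- Moving `θ_i` past the smaller `θ_j` costs a sign. By `h5`, either the remaining product
    -- vanishes or `j` is still least after `i` has been inserted, so the result is again
    -- increasing.
    · obtain ⟨h4, h5⟩ := h2 h
      have e := eq_neg_of_add_eq_zero_left (ExteriorAlgebra.ι_add_mul_swap (R := A) (θ i) (θ j))
      rw [mono_xor_bit θ hj, ← mul_assoc, e, neg_mul, mul_assoc, ih, h4, neg_smul,
        mul_smul_comm, fin16_xor_left_comm]
      rcases h5 with h5 | h5
      · rw [h5, zero_smul, zero_smul]
      · rw [mono_xor_bit θ h5]

/-- The multiplication table of `∧W`. It allows all later questions about products of monomials to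
be settled by evaluation on `Fin 16`. -/
theorem mono_mul (S T : Fin 16) :
    mono θ S * mono θ T = wedgeSign S T • mono θ (S ^^^ T) := by
  induction S using mono_induction with
  | h0 =>
    have h : ∀ T, wedgeSign 0 T = 1 := by decide +kernel
    rw [mono_zero, one_mul, h, one_smul, fin16_zero_xor]
  | h j S hj ih =>
    rw [mono_xor_bit θ hj, mul_assoc, ih, mul_smul_comm, ι_mul_mono, smul_smul,
      ← wedgeSign_xor_left j S T hj, fin16_xor_assoc]

theorem span_range_mono : Submodule.span A (Set.range (mono θ)) = ⊤ := by
  rw [eq_top_iff]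
  rintro x -
  have hmul : ∀ x ∈ Submodule.span A (Set.range (mono θ)),
      ∀ y ∈ Submodule.span A (Set.range (mono θ)),
      x * y ∈ Submodule.span A (Set.range (mono θ)) := by
    intro x hx y hy
    have := Submodule.mul_mem_mul hx hy
    rw [Submodule.span_mul_span] at this
    refine Submodule.span_le.2 ?_ this
    rintro _ ⟨_, ⟨S, rfl⟩, _, ⟨T, rfl⟩, rfl⟩
    simp only [mono_mul]
    exact zsmul_mem (Submodule.subset_span (Set.mem_range_self _)) _
  induction x using ExteriorAlgebra.induction with
  | algebraMap r =>
    rw [Algebra.algebraMap_eq_smul_one, ← mono_zero θ]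
    exact Submodule.smul_mem _ _ (Submodule.subset_span ⟨_, rfl⟩)
  | ι w =>
    rw [← θ.sum_repr w, map_sum]
    refine Submodule.sum_mem _ fun i _ => ?_
    rw [map_smul, ← mono_bit]
    exact Submodule.smul_mem _ _ (Submodule.subset_span ⟨_, rfl⟩)
  | mul a b ha hb => exact hmul a ha b hb
  | add a b ha hb => exact add_mem ha hb

/-- A counting argument: the monomials span, `∧W` is free of rank 16, and a surjective endomorphism
of a finitely generated module is injective. -/
theorem exists_mono_basis : ∃ b : Module.Basis (Fin 16) A (ExteriorAlgebra A W),
    ∀ S, b S = mono θ S := by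
  -- An arbitrary bijection is enough, since only the number of basis elements is used.
  let e : Finset (Fin 4) ≃ Fin 16 := Fintype.equivFinOfCardEq (by simp)
  let b := θ.ExteriorAlgebra.reindex e
  let f : ExteriorAlgebra A W →ₗ[A] ExteriorAlgebra A W := b.constr A (mono θ)
  have hf : Function.Surjective f := by
    rw [← LinearMap.range_eq_top, eq_top_iff, ← span_range_mono θ, Submodule.span_le]
    rintro _ ⟨S, rfl⟩
    exact ⟨b S, b.constr_basis A _ S⟩
  have : Module.Finite A (ExteriorAlgebra A W) := Module.Finite.of_basis b
  let g := LinearEquiv.ofBijective f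
    ⟨OrzechProperty.injective_of_surjective_endomorphism f hf, hf⟩
  exact ⟨b.map g, fun S => by
    rw [Module.Basis.map_apply]; exact b.constr_basis A _ S⟩

/-- The basis of `∧W` formed by the monomials. -/
noncomputable def monoBasis : Module.Basis (Fin 16) A (ExteriorAlgebra A W) :=
  (exists_mono_basis θ).choose

@[simp] theorem monoBasis_apply (S : Fin 16) : monoBasis θ S = mono θ S :=
  (exists_mono_basis θ).choose_spec S

theorem extPow_eq_span (n : ℕ) :
    ⋀[A]^n W = Submodule.span A {m | ∃ S : Fin 16, popCount S = n ∧ m = mono θ S} := by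
  apply le_antisymm
  · intro x hx
    induction hx using Submodule.pow_induction_on_left' with
    | algebraMap r =>
      rw [Algebra.algebraMap_eq_smul_one, ← mono_zero θ]
      exact Submodule.smul_mem _ _ (Submodule.subset_span ⟨0, rfl, rfl⟩)
    | add x y i _ _ hx hy => exact add_mem hx hy
    | mem_mul m hm i x hx' hx =>
      clear hx'
      obtain ⟨w, rfl⟩ := hm
      rw [← θ.sum_repr w, map_sum, Finset.sum_mul]
      refine Submodule.sum_mem _ fun j _ => ?_
      rw [map_smul, smul_mul_assoc]
      refine Submodule.smul_mem _ _ ?_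
      induction hx using Submodule.span_induction with
      | zero => rw [mul_zero]; exact zero_mem _
      | add x y _ _ hx hy => rw [mul_add]; exact add_mem hx hy
      | smul a x _ hx => rw [mul_smul_comm]; exact Submodule.smul_mem _ _ hx
      | mem x hx =>
        obtain ⟨S, rfl, rfl⟩ := hx
        rw [ι_mul_mono]
        have h : ∀ (j : Fin 4) (S : Fin 16), wedgeSign (bit j) S = 0 ∨
            popCount (bit j ^^^ S).val = popCount S.val + 1 := by decide +kernel
        rcases h j S with h | h
        · rw [h, zero_smul]; exact zero_mem _
        · refine zsmul_mem (Submodule.subset_span ?_) _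
          exact ⟨_, h, rfl⟩
  · rw [Submodule.span_le]
    rintro _ ⟨S, rfl, rfl⟩
    induction S using mono_induction with
    | h0 => exact Submodule.one_le.1 (by simp [popCount])
    | h j S hj ih =>
      have h : ∀ (j : Fin 4) (S : Fin 16), (∀ k ∈ elems S, j < k) →
            popCount (bit j ^^^ S).val = popCount S.val + 1 := by decide +kernel
      rw [mono_xor_bit θ hj, h j S hj]
      change _ ∈ LinearMap.range (ExteriorAlgebra.ι A) ^ (_ + 1)
      rw [pow_succ']; exact Submodule.mul_mem_mul ⟨_, rfl⟩ ih

theorem mono_mem_extPow (S : Fin 16) : mono θ S ∈ ⋀[A]^(popCount S) W := by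
  rw [extPow_eq_span θ]; exact Submodule.subset_span ⟨S, rfl, rfl⟩

end

/-! ### A basis of the conformal orthogonal Lie algebra -/

/-- The indices `(p, q)` on which the `a`-th element of `σ_0, σ_1, σ_2, σ_3, σ_23, σ_31, σ_12`
acts. -/
def ends : Fin 7 → Fin 4 × Fin 4 := ![(0, 0), (0, 1), (0, 2), (0, 3), (2, 3), (3, 1), (1, 2)]

/-- The subset `{p} ∆ {q}` for `(p, q) = ends a`. -/
def mask (a : Fin 7) : Fin 16 := bit (ends a).1 ^^^ bit (ends a).2

/-- The coefficient in `σ θ_i = ± θ_j`. -/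
def actSign (a : Fin 7) (i : Fin 4) : ℤ :=
  if a = 0 then 1
  else if i = (ends a).2 then 1
  else if i = (ends a).1 then (if i = 0 then 1 else -1)
  else 0

/-- The index `j` in `σ θ_i = ± θ_j`. -/
def actIdx (a : Fin 7) (i : Fin 4) : Fin 4 :=
  if i = (ends a).1 then (ends a).2 else if i = (ends a).2 then (ends a).1 else i

/-- The coefficient in `σ θ_S = ± θ_T`. -/
def derSign (a : Fin 7) (S : Fin 16) : ℤ :=
  ((elems S).map fun i => wedgeSign (bit i) (S ^^^ bit i) *
    (actSign a i * wedgeSign (bit i ^^^ mask a) (S ^^^ bit i))).sum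

/-- Each `σ_a` exchanges two basis indices or fixes the index, up to sign and zero. In bits this
toggles the same `mask a` for every index, so `σ_a` shifts all monomials by one mask. -/
theorem bit_actIdx : ∀ (a : Fin 7) (i : Fin 4), actSign a i ≠ 0 →
    bit (actIdx a i) = bit i ^^^ mask a := by decide +kernel

/-- The Leibniz rule for `σ_a` on `θ_j θ_S`, expressed through signs. -/
theorem derSign_bit_xor : ∀ (a : Fin 7) (j : Fin 4) (S : Fin 16), (∀ k ∈ elems S, j < k) →
    derSign a (bit j ^^^ S) = actSign a j * wedgeSign (bit j ^^^ mask a) S +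
      derSign a S * wedgeSign (bit j) (S ^^^ mask a) := by decide +kernel

section

variable {A : Type*} [CommRing A] [Algebra ℝ A] {W : Type*} [AddCommGroup W] [Module A W]
  {c : Set (LinearMap.BilinForm A W)} {θ : Module.Basis (Fin 4) A W} (hθ : IsConfFrame c θ)

/-- The elements `σ_0, σ_1, σ_2, σ_3, σ_23, σ_31, σ_12`. -/
noncomputable def sig : Fin 7 → CDerEnd c :=
  ![sigma0 hθ, boost hθ 0, boost hθ 1, boost hθ 2, rot hθ 1 2, rot hθ 2 0, rot hθ 0 1]

theorem sym_sig (a : Fin 7) : (sig hθ a).sym = 0 := by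
  fin_cases a <;> rfl

theorem sym_der (D : Derivation ℝ A A) : (der hθ D).sym = D := rfl

theorem op_der (D : Derivation ℝ A A) (i : Fin 4) : (der hθ D).op (θ i) = 0 := by
  change derOp θ D (θ i) = 0
  rw [derOp_apply]
  refine Finset.sum_eq_zero fun j _ => ?_
  rw [Module.Basis.repr_self, Finsupp.single_apply]
  split_ifs <;> simp

theorem op_sig (a : Fin 7) (i : Fin 4) :
    (sig hθ a).op (θ i) = actSign a i • θ (actIdx a i) := by
  have e : ∀ (T : W →ₗ[A] W) (h), CDerEnd.op (c := c) ⟨(0, T.toAddMonoidHom), h⟩ (θ i) = T (θ i) :=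
    fun _ _ => rfl
  fin_cases a <;>
    simp only [sig, sigma0, boost, rot, e, Fin.zero_eta, Fin.mk_one, Fin.reduceFinMk,
      Matrix.cons_val, LinearMap.add_apply, LinearMap.sub_apply, elem_apply, LinearMap.id_apply] <;>
    fin_cases i <;>
    simp [actSign, actIdx, ends]

theorem cDerEnd_ext {x y : CDerEnd c} (h : x.sym = y.sym) (h' : ∀ i, x.op (θ i) = y.op (θ i)) :
    x = y := by
  ext w
  · rw [h]
  · rw [← θ.sum_repr w, map_sum, map_sum]
    refine Finset.sum_congr rfl fun i _ => ?_
    rw [CDerEnd.op_smul, CDerEnd.op_smul, h, h']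

variable (c θ) in
/-- The coordinates of an element of `CDerEnd(W)`. -/
noncomputable def sigCoord (a : Fin 7) : CDerEnd c →ₗ[A] A where
  toFun x := θ.repr (x.op (θ (ends a).2)) (ends a).1
  map_add' x y := by simp
  map_smul' f x := by simp

theorem sigCoord_apply (a : Fin 7) (x : CDerEnd c) :
    sigCoord c θ a x = θ.repr (x.op (θ (ends a).2)) (ends a).1 := rfl

theorem sigCoord_sig (a b : Fin 7) : sigCoord c θ a (sig hθ b) = if a = b then 1 else 0 := by
  have h : ∀ a b : Fin 7, (if actIdx b (ends a).2 = (ends a).1 then actSign b (ends a).2 else 0) =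
    if a = b then 1 else 0 := by decide +kernel
  have h' := congrArg (Int.cast : ℤ → A) (h a b)
  push_cast at h'
  rw [sigCoord_apply, op_sig, map_zsmul, Finsupp.smul_apply, Module.Basis.repr_self,
    Finsupp.single_apply, zsmul_eq_mul, mul_ite, mul_one, mul_zero, h']

theorem sigCoord_der (a : Fin 7) (D : Derivation ℝ A A) : sigCoord c θ a (der hθ D) = 0 := by
  rw [sigCoord_apply, op_der]; simp

theorem two_mul_cancel {x y : A} (h : 2 * x = 2 * y) : x = y := by
  have h2 : IsUnit (2 : A) := by
    have := (IsUnit.mk0 (2 : ℝ) two_ne_zero).map (algebraMap ℝ A)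
    rwa [map_ofNat] at this
  exact h2.mul_left_cancel h

/-- Relative to the Minkowski form, the matrix of `x` in the frame is antisymmetric up to a multiple
of the identity. Thus it lies in `A ⊕ so(1,3)`, whose standard basis is `σ_0` with the three boosts
and the three rotations. The derivation part contributes nothing on the frame. -/
theorem cDerEnd_eq (x : CDerEnd c) :
    x = der hθ x.sym + ∑ a, sigCoord c θ a x • sig hθ a := by
  have hs : ∀ (s : Finset (Fin 7)) (f : Fin 7 → CDerEnd c) (w : W),
      (∑ a ∈ s, f a).op w = ∑ a ∈ s, (f a).op w := fun s f w =>
    map_sum (AddMonoidHom.mk' (fun y : CDerEnd c => y.op w) fun y z => rfl) f s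
  have hs' : ∀ (s : Finset (Fin 7)) (f : Fin 7 → CDerEnd c) (w : A),
      (∑ a ∈ s, f a).sym w = ∑ a ∈ s, (f a).sym w := fun s f w =>
    map_sum (AddMonoidHom.mk' (fun y : CDerEnd c => y.sym w) fun y z => rfl) f s
  obtain ⟨g, hgc, hg, -⟩ := hθ.exists_rep
  obtain ⟨h, hh⟩ := x.2.2 g hgc
  change ∀ w w', x.sym (g w w') = g (x.op w) w' + g w (x.op w') + h * g w w' at hh
  have hm : ∀ i j, x.sym (mink A i j) = 0 := by
    intro i j
    unfold mink
    split_ifs <;> simp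
  have hg1 : ∀ w j, g w (θ j) = θ.repr w j * mink A j j := by
    intro w j
    conv_lhs => rw [← θ.sum_repr w]
    simp only [map_sum, map_smul, LinearMap.sum_apply, LinearMap.smul_apply, hg, smul_eq_mul]
    rw [Finset.sum_eq_single j]
    · intro b _ hb; simp [mink, hb]
    · simp
  have hg2 : ∀ w j, g (θ j) w = θ.repr w j * mink A j j := by
    intro w j
    conv_lhs => rw [← θ.sum_repr w]
    simp only [map_sum, map_smul, hg, smul_eq_mul]
    rw [Finset.sum_eq_single j]
    · intro b _ hb; simp [mink, hb.symm]
    · simp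
  -- The entries of `g` in the frame are constants, so their derivatives drop out of the invariance
  -- condition.
  have key : ∀ i j, θ.repr (x.op (θ i)) j * mink A j j + θ.repr (x.op (θ j)) i * mink A i i
      + h * mink A i j = 0 := by
    intro i j
    rw [← hg1, ← hg2, ← hg, ← hh, hg, hm]
  have k00 := key 0 0
  have k11 := key 1 1
  have k22 := key 2 2
  have k33 := key 3 3
  have k01 := key 0 1
  have k02 := key 0 2
  have k03 := key 0 3
  have k12 := key 1 2
  have k13 := key 1 3
  have k23 := key 2 3
  simp [mink] at k00 k11 k22 k33 k01 k02 k03 k12 k13 k23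
  -- Adding the `(0,0)` equation eliminates `h`, since `g(θ_0, θ_0) = -1`, and leaves twice the
  -- difference of two diagonal entries.
  have d1 : θ.repr (x.op (θ 1)) 1 = θ.repr (x.op (θ 0)) 0 :=
    two_mul_cancel (by linear_combination k11 + k00)
  have d2 : θ.repr (x.op (θ 2)) 2 = θ.repr (x.op (θ 0)) 0 :=
    two_mul_cancel (by linear_combination k22 + k00)
  have d3 : θ.repr (x.op (θ 3)) 3 = θ.repr (x.op (θ 0)) 0 :=
    two_mul_cancel (by linear_combination k33 + k00)
  refine cDerEnd_ext (θ := θ) ?_ fun i => ?_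
  · ext f
    rw [CDerEnd.sym_add, hs']
    simp [sym_der, sym_sig]
  · rw [CDerEnd.op_add, op_der, zero_add, hs]
    simp only [CDerEnd.smul_op, op_sig, sigCoord_apply]
    apply θ.repr.injective
    ext j
    fin_cases i <;> fin_cases j <;>
      simp [Fin.sum_univ_seven, actSign, actIdx, ends, d1, d2, d3] <;>
      first
        | linear_combination k01
        | linear_combination -k01
        | linear_combination k02
        | linear_combination -k02
        | linear_combination k03
        | linear_combination -k03
        | linear_combination k12
        | linear_combination k13
        | linear_combination k23

/-- All terms of the Leibniz expansion land on the same monomial, because replacing any one factor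
toggles the same mask. -/
theorem onExt_sig_mono (a : Fin 7) (S : Fin 16) :
    (sig hθ a).onExt (mono θ S) = derSign a S • mono θ (S ^^^ mask a) := by
  induction S using mono_induction with
  | h0 =>
    have h : ∀ a, derSign a 0 = 0 := by decide +kernel
    rw [h, zero_smul, mono_zero, ← map_one (algebraMap A _), CDerEnd.onExt_algebraMap]
    simp
  | h j S hj ih =>
    rw [mono_xor_bit θ hj, CDerEnd.onExt_mul, ih, CDerEnd.onExt_ι, op_sig, mul_smul_comm,
      ι_mul_mono, map_zsmul, derSign_bit_xor a j S hj, fin16_xor_assoc, smul_smul, add_smul]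
    congr 1
    by_cases h : actSign a j = 0
    · simp [h]
    · have e : ∀ S T U : Fin 16, S ^^^ (T ^^^ U) = S ^^^ U ^^^ T := by decide +kernel
      rw [← mono_bit, bit_actIdx a j h, smul_mul_assoc, mono_mul, smul_smul, e]

theorem onExt_der_mono (D : Derivation ℝ A A) (S : Fin 16) :
    (der hθ D).onExt (mono θ S) = 0 := by
  induction S using mono_induction with
  | h0 =>
    rw [mono_zero, ← map_one (algebraMap A _), CDerEnd.onExt_algebraMap]; simp
  | h j S hj ih =>
    rw [mono_xor_bit θ hj, CDerEnd.onExt_mul, ih, CDerEnd.onExt_ι, op_der]; simp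

end

/-! ### Integral combinations of the elements `θ_S σ_a`

A list of terms `(n, S, a)` stands for `∑ n θ_S σ_a`, or for the functional that sends an element of
`ℒ` to the same combination of its coordinates. -/

/-- The coefficient of `θ_S σ_a`, for `k = (S, a)`, in an integral combination. -/
def termCoeff (k : Fin 16 × Fin 7) : List (ℤ × Fin 16 × Fin 7) → ℤ
  | [] => 0
  | v :: V => bif Nat.beq k.1.val v.2.1.val && Nat.beq k.2.val v.2.2.val
      then Int.add v.1 (termCoeff k V) else termCoeff k V

/-- The pairing of two integral combinations for which the `θ_S σ_a` are orthonormal. -/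
def pair : List (ℤ × Fin 16 × Fin 7) → List (ℤ × Fin 16 × Fin 7) → ℤ
  | [], _ => 0
  | f :: F, V => Int.add (Int.mul f.1 (termCoeff f.2 V)) (pair F V)

/-- The product of `θ_T` with an integral combination. -/
def mulTerms (T : Fin 16) (V : List (ℤ × Fin 16 × Fin 7)) : List (ℤ × Fin 16 × Fin 7) :=
  (V.filter fun v => wedgeSign T v.2.1 ≠ 0).map
    fun v => (v.1 * wedgeSign T v.2.1, T ^^^ v.2.1, v.2.2)

/-- A basis of the algebraic Weyl tensors. -/
def weylTerms : Fin 10 → List (ℤ × Fin 16 × Fin 7) := ![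
    [(1, 5, 6), (1, 6, 2), (1, 9, 5), (-1, 10, 3)],
    [(-1, 3, 6), (-1, 6, 1), (-1, 9, 4), (-1, 12, 3)],
    [(1, 3, 5), (-1, 10, 1), (1, 5, 4), (1, 12, 2)],
    [(-1, 3, 2), (-1, 5, 1), (-1, 10, 4), (1, 12, 5)],
    [(-1, 3, 3), (-1, 9, 1), (1, 6, 4), (1, 12, 6)],
    [(-1, 5, 3), (-1, 9, 2), (1, 6, 5), (-1, 10, 6)],
    [(-1, 3, 1), (1, 12, 4), (1, 5, 2), (1, 10, 5)],
    [(-1, 5, 2), (-1, 10, 5), (1, 9, 3), (-1, 6, 6)],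
    [(1, 3, 4), (1, 12, 1), (-1, 5, 5), (1, 10, 2)],
    [(1, 5, 5), (-1, 10, 2), (-1, 9, 6), (-1, 6, 3)]]

/-- The generators of `ℰ_G` that do not involve derivations. -/
def genTerms : Fin 40 → List (ℤ × Fin 16 × Fin 7) := ![
    [(1, 0, 0)],
    [(1, 1, 0), (1, 2, 1)],
    [(1, 1, 0), (1, 4, 2)],
    [(1, 1, 0), (1, 8, 3)],
    [(1, 12, 4), (-1, 10, 5), (1, 6, 6), (2, 3, 1), (2, 5, 2), (2, 9, 3)],
    [(-1, 2, 4), (1, 4, 5), (1, 8, 6)],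
    [(-1, 4, 5), (1, 8, 6), (1, 2, 4)],
    [(-1, 8, 6), (1, 2, 4), (1, 4, 5)],
    [(1, 0, 1)],
    [(1, 0, 4)],
    [(1, 1, 1), (1, 2, 0)],
    [(1, 4, 3), (1, 8, 2)],
    [(1, 8, 5)],
    [(1, 4, 6)],
    [(1, 5, 6), (1, 6, 2)],
    [(1, 0, 2)],
    [(1, 0, 5)],
    [(1, 1, 2), (1, 4, 0)],
    [(1, 8, 1), (1, 2, 3)],
    [(1, 2, 6)],
    [(1, 8, 4)],
    [(1, 9, 4), (1, 12, 3)],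
    [(1, 0, 3)],
    [(1, 0, 6)],
    [(1, 1, 3), (1, 8, 0)],
    [(1, 2, 2), (1, 4, 1)],
    [(1, 4, 4)],
    [(1, 2, 5)],
    [(1, 3, 5), (-1, 10, 1)],
    [(1, 4, 3), (-1, 8, 2)],
    [(1, 5, 3), (-1, 9, 2), (-2, 12, 0)],
    [(1, 5, 3), (1, 9, 2), (-2, 6, 5)],
    [(1, 8, 1), (-1, 2, 3)],
    [(1, 9, 1), (-1, 3, 3), (2, 10, 0)],
    [(1, 9, 1), (1, 3, 3), (-2, 12, 6)],
    [(1, 2, 2), (-1, 4, 1)],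
    [(1, 3, 2), (-1, 5, 1), (-2, 6, 0)],
    [(1, 3, 2), (1, 5, 1), (2, 10, 4)],
    [(1, 3, 4), (1, 5, 5), (1, 9, 6), (-2, 12, 1), (2, 10, 2), (-2, 6, 3)],
    [(1, 13, 1), (-1, 11, 2), (1, 7, 3), (3, 14, 0)]]

/-- The weights `α` of the generators. -/
def genWeight : Fin 40 → ℕ × ℕ × ℕ := ![
    (0, 0, 0), (0, 0, 0), (0, 0, 0), (0, 0, 0), (0, 0, 0), (2, 0, 0), (0, 2, 0), (0, 0, 2),
    (0, 1, 1), (0, 1, 1), (0, 1, 1), (0, 1, 1), (0, 1, 1), (0, 1, 1), (0, 1, 1), (1, 0, 1),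
    (1, 0, 1), (1, 0, 1), (1, 0, 1), (1, 0, 1), (1, 0, 1), (1, 0, 1), (1, 1, 0), (1, 1, 0),
    (1, 1, 0), (1, 1, 0), (1, 1, 0), (1, 1, 0), (1, 1, 0), (2, 1, 1), (2, 1, 1), (2, 1, 1),
    (1, 2, 1), (1, 2, 1), (1, 2, 1), (1, 1, 2), (1, 1, 2), (1, 1, 2), (2, 2, 2), (2, 2, 2)]

/-- Six times the coordinate functionals of `ℰ` with respect to `θ_0` times the generators. -/
def dualTerms : Fin 40 → List (ℤ × Fin 16 × Fin 7) := ![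
    [(6, 1, 0), (-6, 2, 1), (-6, 4, 2), (-6, 8, 3)],
    [(6, 3, 1), (6, 10, 5), (-6, 6, 6)],
    [(6, 5, 2), (-6, 12, 4), (-6, 6, 6)],
    [(6, 9, 3), (-6, 12, 4), (6, 10, 5)],
    [(2, 13, 4), (-2, 11, 5), (2, 7, 6)],
    [(3, 12, 1), (3, 5, 5), (3, 9, 6)],
    [(-3, 10, 2), (3, 3, 4), (3, 9, 6)],
    [(3, 6, 3), (3, 3, 4), (3, 5, 5)],
    [(-6, 2, 0), (6, 1, 1)],
    [(6, 1, 4)],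
    [(6, 3, 0)],
    [(3, 9, 2), (3, 5, 3), (3, 6, 5), (-3, 10, 6)],
    [(6, 10, 3), (6, 9, 5)],
    [(-6, 6, 2), (6, 5, 6)],
    [(6, 7, 2), (6, 11, 3), (6, 14, 4)],
    [(-6, 4, 0), (6, 1, 2)],
    [(6, 1, 5)],
    [(6, 5, 0)],
    [(3, 9, 1), (3, 3, 3), (3, 6, 4), (3, 12, 6)],
    [(-6, 6, 1), (6, 3, 6)],
    [(-6, 12, 3), (6, 9, 4)],
    [(-6, 7, 1), (6, 13, 3), (6, 14, 5)],
    [(-6, 8, 0), (6, 1, 3)],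
    [(6, 1, 6)],
    [(6, 9, 0)],
    [(3, 5, 1), (3, 3, 2), (-3, 10, 4), (3, 12, 5)],
    [(-6, 12, 2), (6, 5, 4)],
    [(6, 10, 1), (6, 3, 5)],
    [(-6, 11, 1), (-6, 13, 2), (6, 14, 6)],
    [(3, 12, 0), (-3, 9, 2), (3, 5, 3)],
    [(-3, 13, 0)],
    [(3, 14, 1), (-3, 7, 5), (-3, 11, 6)],
    [(-3, 10, 0), (3, 9, 1), (-3, 3, 3)],
    [(3, 11, 0)],
    [(3, 14, 2), (3, 7, 4), (-3, 13, 6)],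
    [(3, 6, 0), (-3, 5, 1), (3, 3, 2)],
    [(-3, 7, 0)],
    [(3, 14, 3), (3, 11, 4), (3, 13, 5)],
    [(1, 14, 0), (-1, 13, 1), (1, 11, 2), (-1, 7, 3)],
    [(2, 15, 0)]]

/-- The elements `(T, k)` such that the products of `θ_T` with the `k`-th Weyl tensor form a basis of
the ideal. -/
def relIdx : Fin 32 → Fin 16 × Fin 10 := ![
    (0, 6), (0, 7), (1, 6), (1, 7), (1, 0), (2, 6), (0, 0), (3, 6), (1, 1), (2, 3), (0, 1),
    (3, 3), (0, 3), (3, 1), (1, 3), (2, 1), (1, 2), (2, 4), (0, 2), (3, 4), (0, 4), (3, 2),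
    (1, 4), (2, 2), (0, 5), (3, 8), (1, 5), (2, 8), (1, 8), (1, 9), (0, 8), (0, 9)]

/-- Six times the coordinate functionals with respect to the basis of the ideal. -/
def relDualTerms : Fin 32 → List (ℤ × Fin 16 × Fin 7) := ![
    [(4, 12, 4), (2, 10, 5), (-2, 6, 6)],
    [(2, 12, 4), (-2, 10, 5), (-4, 6, 6)],
    [(4, 13, 4), (2, 11, 5), (-2, 7, 6)],
    [(2, 13, 4), (-2, 11, 5), (-4, 7, 6)],
    [(-6, 11, 3)],
    [(6, 14, 4)],
    [(-6, 10, 3)],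
    [(6, 15, 4)],
    [(-6, 7, 1), (6, 14, 5)],
    [(6, 14, 5)],
    [(-6, 6, 1)],
    [(6, 15, 5)],
    [(6, 12, 5)],
    [(-6, 15, 3)],
    [(6, 13, 5)],
    [(-6, 14, 3)],
    [(6, 13, 2)],
    [(6, 14, 6)],
    [(6, 12, 2)],
    [(6, 15, 6)],
    [(6, 6, 4)],
    [(6, 15, 2)],
    [(6, 14, 2), (6, 7, 4)],
    [(6, 14, 2)],
    [(-6, 10, 6)],
    [(6, 15, 1)],
    [(-6, 11, 6)],
    [(6, 14, 1)],
    [(4, 13, 1), (2, 11, 2), (-2, 7, 3)],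
    [(2, 13, 1), (-2, 11, 2), (-4, 7, 3)],
    [(4, 12, 1), (2, 10, 2), (-2, 6, 3)],
    [(2, 12, 1), (-2, 10, 2), (-4, 6, 3)]]

/-- This and the next two evaluations say that `dualTerms i` reads off six times the coefficient of
`θ_0` times the `i`-th generator, kills the generators themselves, and kills the ideal. Independence
of the generators and of their `θ_0`-multiples in `ℰ` rests on them. -/
theorem pair_dual_gen : ∀ i j, pair (dualTerms i) (genTerms j) = 0 := by decide +kernel

theorem pair_dual_mul_gen : ∀ i j,
    pair (dualTerms i) (mulTerms 1 (genTerms j)) = if i = j then 6 else 0 := by decide +kernel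

theorem pair_dual_weyl : ∀ i T k, pair (dualTerms i) (mulTerms T (weylTerms k)) = 0 := by
  decide +kernel

/-- The functional `u ↦ F (θ_T u)`. -/
def pullTerms (T : Fin 16) (F : List (ℤ × Fin 16 × Fin 7)) : List (ℤ × Fin 16 × Fin 7) :=
  (F.filter fun f => wedgeSign T (T ^^^ f.2.1) ≠ 0).map
    fun f => (f.1 * wedgeSign T (T ^^^ f.2.1), T ^^^ f.2.1, f.2.2)

/-- The parity `S ∆ {p} ∆ {q}` of `θ_S σ_a`, where `σ_a` acts on `θ_p, θ_q`. -/
def parity (k : Fin 16 × Fin 7) : Fin 16 := k.1 ^^^ mask k.2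

/-- Terms with all coefficients scaled. -/
def scaleTerms (n : ℤ) (V : List (ℤ × Fin 16 × Fin 7)) : List (ℤ × Fin 16 × Fin 7) :=
  V.map fun v => (Int.mul n v.1, v.2)

/-- The image of `θ_S σ_a`, for `k = (S, a)`, under `∑ F ⊗ V`, the sum over all pairs of a functional
`F` and a combination `V` in the list `R`. -/
def expandBy (k : Fin 16 × Fin 7) :
    List (List (ℤ × Fin 16 × Fin 7) × List (ℤ × Fin 16 × Fin 7)) → List (ℤ × Fin 16 × Fin 7)
  | [] => []
  | r :: R => match termCoeff k r.1 with
    | Int.ofNat 0 => expandBy k R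
    | n => scaleTerms n r.2 ++ expandBy k R

/-- `∑ F ⊗ V` is six times the identity on `θ_S σ_a`, for `k = (S, a)`. -/
def IsSixAt (k : Fin 16 × Fin 7)
    (R : List (List (ℤ × Fin 16 × Fin 7) × List (ℤ × Fin 16 × Fin 7))) : Prop :=
  (∀ t ∈ expandBy k R, parity t.2 = parity k) ∧
    ∀ b, termCoeff (parity k ^^^ mask b, b) (expandBy k R) = if b = k.2 then 6 else 0

instance (k R) : Decidable (IsSixAt k R) := inferInstanceAs (Decidable (_ ∧ _))

/-- Six times the identity of `ℒ`, in terms of the generators, `θ_0` times the generators, and the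
ideal. -/
def genResolution : List (List (ℤ × Fin 16 × Fin 7) × List (ℤ × Fin 16 × Fin 7)) :=
  (List.finRange 40).map (fun j => (pullTerms 1 (dualTerms j), genTerms j)) ++
    (List.finRange 40).map (fun j => (dualTerms j, mulTerms 1 (genTerms j))) ++
    (List.finRange 32).map fun m =>
      (relDualTerms m, mulTerms (relIdx m).1 (weylTerms (relIdx m).2))

/-- The spanning half, dual to the pairings above. The list has 40 + 40 + 32 = 112 entries, as many
as there are `θ_S σ_a`. The coefficient of a generator in `u` is obtained by applying to `θ_0 u` the
functional dual to `θ_0` times that generator, hence `pullTerms`. -/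
theorem isSixAt_genResolution : ∀ S a, IsSixAt (S, a) genResolution := by
  decide +kernel

/-- The coefficient of `θ_T` in the image of `θ_U` under the anchor, as a functional on `ℒ`. -/
def anchorTerms (U T : Fin 16) : List (ℤ × Fin 16 × Fin 7) :=
  (List.finRange 7).map fun a =>
    (derSign a U * wedgeSign (T ^^^ (U ^^^ mask a)) (U ^^^ mask a), T ^^^ (U ^^^ mask a), a)

/-- The coefficient in the contraction `θ_j ⌟ θ_S = ± θ_T`. -/
def contractSign (j : Fin 4) (S : Fin 16) : ℤ :=
  (if j = 0 then -1 else 1) * wedgeSign (bit j) (bit j ^^^ S)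

/-- The coefficient of `θ_T` in the Ricci contraction at `θ_i`, as a functional on `ℒ`. -/
def ricciTerms (i : Fin 4) (T : Fin 16) : List (ℤ × Fin 16 × Fin 7) :=
  (List.finRange 7).map fun a =>
    (actSign a i * contractSign (actIdx a i) (bit (actIdx a i) ^^^ T), bit (actIdx a i) ^^^ T, a)

/-- Six times the coordinate functionals on the space of Weyl tensors. -/
def weylDualTerms : Fin 10 → List (ℤ × Fin 16 × Fin 7) := ![
    [(6, 5, 6)],
    [(-6, 3, 6)],
    [(6, 3, 5)],
    [(-6, 3, 2)],
    [(-6, 3, 3)],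
    [(-6, 5, 3)],
    [(-6, 3, 1)],
    [(-6, 3, 1), (-6, 5, 2)],
    [(6, 3, 4)],
    [(6, 3, 4), (6, 5, 5)]]

/-- Bianchi identities and components of the Ricci contraction, with the dual elements of `ℒ`. -/
def weylEquations : List (List (ℤ × Fin 16 × Fin 7) × List (ℤ × Fin 16 × Fin 7)) := [
    (ricciTerms 0 1, [(3, 6, 6), (-6, 9, 3), (3, 10, 5), (-3, 12, 4)]),
    (ricciTerms 1 2, [(3, 6, 6), (-3, 10, 5), (-3, 12, 4)]),
    (ricciTerms 2 4, [(3, 6, 6), (3, 10, 5), (3, 12, 4)]),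
    (ricciTerms 3 8, [(-3, 6, 6), (-3, 10, 5), (3, 12, 4)]),
    (anchorTerms (bit 2) 7, [(6, 6, 2), (6, 9, 5), (-6, 10, 3)]),
    (anchorTerms (bit 3) 11, [(6, 9, 5)]),
    (ricciTerms 0 2, [(6, 9, 5), (-6, 10, 3)]),
    (anchorTerms (bit 1) 7, [(6, 6, 1), (6, 9, 4), (6, 12, 3)]),
    (anchorTerms (bit 3) 13, [(-6, 9, 4)]),
    (ricciTerms 0 4, [(-6, 9, 4), (-6, 12, 3)]),
    (anchorTerms (bit 0) 7, [(-6, 5, 1), (-6, 10, 4), (6, 12, 5)]),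
    (anchorTerms (bit 3) 14, [(-6, 10, 4)]),
    (ricciTerms 1 4, [(6, 10, 4), (-6, 12, 5)]),
    (anchorTerms (bit 1) 11, [(-6, 5, 4), (6, 10, 1), (-6, 12, 2)]),
    (anchorTerms (bit 2) 13, [(-6, 5, 4)]),
    (ricciTerms 0 8, [(6, 5, 4), (6, 12, 2)]),
    (anchorTerms (bit 0) 11, [(6, 6, 4), (-6, 9, 1), (6, 12, 6)]),
    (anchorTerms (bit 2) 14, [(-6, 6, 4)]),
    (ricciTerms 1 8, [(-6, 6, 4), (-6, 12, 6)]),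
    (anchorTerms (bit 0) 13, [(6, 6, 5), (-6, 9, 2), (-6, 10, 6)]),
    (anchorTerms (bit 1) 14, [(6, 6, 5)]),
    (ricciTerms 2 8, [(-6, 6, 5), (6, 10, 6)]),
    (anchorTerms (bit 0) 14, [(-3, 9, 6), (-3, 10, 2), (3, 12, 1)]),
    (anchorTerms (bit 1) 13, [(3, 9, 6), (3, 10, 2), (3, 12, 1)]),
    (anchorTerms (bit 2) 11, [(-3, 9, 6), (3, 10, 2), (3, 12, 1)]),
    (anchorTerms (bit 3) 7, [(6, 6, 3), (3, 9, 6), (3, 10, 2), (-3, 12, 1)])]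

/-- Six times the identity of `∧²W ⊗ so(W)`, in terms of the Weyl tensors and their equations. -/
def weylResolution : List (List (ℤ × Fin 16 × Fin 7) × List (ℤ × Fin 16 × Fin 7)) :=
  (List.finRange 10).map (fun k => (weylDualTerms k, weylTerms k)) ++ weylEquations

/-- There are 6 · 6 = 36 indices with `S` of size two and `a ≠ 0`, matched by ten Weyl tensors and
26 equations. Where all the equations vanish, only the ten tensors remain. -/
theorem isSixAt_weylResolution : ∀ S a, popCount (Fin.val S) = 2 → a ≠ 0 →
    IsSixAt (S, a) weylResolution := by
  decide +kernel

theorem weylTerms_support : ∀ k, ∀ t ∈ weylTerms k, popCount t.2.1.val = 2 ∧ t.2.2 ≠ 0 := by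
  decide +kernel

/-- Together with the next evaluation: the ten explicit tensors satisfy the Bianchi identities and
are trace-free. -/
theorem pair_anchor_weyl : ∀ i T k, pair (anchorTerms (bit i) T) (weylTerms k) = 0 := by
  decide +kernel

theorem pair_ricci_weyl : ∀ i T k, pair (ricciTerms i T) (weylTerms k) = 0 := by
  decide +kernel

/-! ### Coordinates on `ℒ` -/

section

variable {A : Type*} [CommRing A] [Algebra ℝ A] {W : Type*} [AddCommGroup W] [Module A W]
  {c : Set (LinearMap.BilinForm A W)} {θ : Module.Basis (Fin 4) A W} (hθ : IsConfFrame c θ)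

variable (c θ) in
/-- The component of an element of `ℒ` along `θ_S`. -/
noncomputable def comp (S : Fin 16) : L c →ₗ[A] CDerEnd c :=
  Finsupp.lapply S ∘ₗ (TensorProduct.equivFinsuppOfBasisLeft (monoBasis θ)).toLinearMap

theorem comp_tmul (S : Fin 16) (w : ExteriorAlgebra A W) (x : CDerEnd c) :
    comp c θ S (w ⊗ₜ x) = (monoBasis θ).repr w S • x :=
  TensorProduct.equivFinsuppOfBasisLeft_apply_tmul_apply _ _ _ _

omit [Algebra ℝ A] in
theorem monoBasis_repr_mono (S T : Fin 16) :
    (monoBasis θ).repr (mono θ S) T = if S = T then 1 else 0 := by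
  rw [← monoBasis_apply, Module.Basis.repr_self, Finsupp.single_apply]

theorem sum_mono_tmul_comp (u : L c) : u = ∑ S, mono θ S ⊗ₜ[A] comp c θ S u := by
  conv_lhs => rw [← (TensorProduct.equivFinsuppOfBasisLeft (N := CDerEnd c)
    (monoBasis θ)).symm_apply_apply u, TensorProduct.equivFinsuppOfBasisLeft_symm_apply,
    Finsupp.sum_fintype _ _ (by simp)]
  simp only [monoBasis_apply]
  rfl

variable (c θ) in
/-- The coefficient of `θ_S σ_a`, for `k = (S, a)`. -/
noncomputable def coef (k : Fin 16 × Fin 7) : L c →ₗ[A] A := sigCoord c θ k.2 ∘ₗ comp c θ k.1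

/-- The element `θ_S σ_a`, for `k = (S, a)`. -/
noncomputable def elt (k : Fin 16 × Fin 7) : L c := mono θ k.1 ⊗ₜ sig hθ k.2

theorem coef_elt (k l : Fin 16 × Fin 7) : coef c θ k (elt hθ l) = if k = l then 1 else 0 := by
  rw [coef, LinearMap.comp_apply, elt, comp_tmul, map_smul, monoBasis_repr_mono, sigCoord_sig,
    smul_eq_mul, ite_mul, one_mul, zero_mul, ← ite_and]
  exact if_congr (by rw [Prod.ext_iff, @eq_comm _ l.1]) rfl rfl

theorem der_add (D D' : Derivation ℝ A A) : der hθ (D + D') = der hθ D + der hθ D' :=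
  cDerEnd_ext (θ := θ) rfl fun i => by rw [CDerEnd.op_add, op_der, op_der, op_der, add_zero]

theorem der_smul (f : A) (D : Derivation ℝ A A) : der hθ (f • D) = f • der hθ D :=
  cDerEnd_ext (θ := θ) rfl fun i => by rw [CDerEnd.smul_op, op_der, op_der, smul_zero]

theorem der_zero : der hθ 0 = 0 := by
  simpa using der_smul hθ 0 0

theorem coef_der (k : Fin 16 × Fin 7) (w : ExteriorAlgebra A W) (D : Derivation ℝ A A) :
    coef c θ k (w ⊗ₜ der hθ D) = 0 := by
  rw [coef, LinearMap.comp_apply, comp_tmul, map_smul, sigCoord_der, smul_zero]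

variable (c θ) in
/-- The derivation in the component along `θ_S`. -/
noncomputable def derComp (S : Fin 16) : L c →ₗ[A] Derivation ℝ A A :=
  { toFun := fun u => (comp c θ S u).sym
    map_add' := fun u v => by rw [map_add]; rfl
    map_smul' := fun f u => by rw [map_smul]; rfl }

theorem derComp_tmul (S : Fin 16) (w : ExteriorAlgebra A W) (x : CDerEnd c) :
    derComp c θ S (w ⊗ₜ x) = (monoBasis θ).repr w S • x.sym := by
  change (comp c θ S (w ⊗ₜ x)).sym = _
  rw [comp_tmul]; rfl

theorem derComp_elt (S : Fin 16) (k : Fin 16 × Fin 7) : derComp c θ S (elt hθ k) = 0 := by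
  rw [elt, derComp_tmul, sym_sig, smul_zero]

/-- The coordinate form of `ℒ`. The derivation part is kept as `Der(A)`-valued components, because
`Der(A)` need not be free. -/
theorem eq_sum_coef (u : L c) :
    u = (∑ S, mono θ S ⊗ₜ[A] der hθ (derComp c θ S u)) + ∑ k, coef c θ k u • elt hθ k := by
  conv_lhs => rw [sum_mono_tmul_comp (θ := θ) u]
  rw [Fintype.sum_prod_type, ← Finset.sum_add_distrib]
  refine Finset.sum_congr rfl fun S _ => ?_
  conv_lhs => rw [cDerEnd_eq hθ (comp c θ S u)]
  rw [TensorProduct.tmul_add, TensorProduct.tmul_sum]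
  congr 1
  refine Finset.sum_congr rfl fun a _ => ?_
  rw [TensorProduct.tmul_smul]; rfl

/-- Used to identify a matrix entry with an integral functional: both sides are `A`-linear, so they
are compared on `θ_S D` and `θ_S σ_a` only. -/
theorem linearMap_ext {N : Type*} [AddCommGroup N] [Module A N] {f g : L c →ₗ[A] N}
    (h : ∀ S D, f (mono θ S ⊗ₜ der hθ D) = g (mono θ S ⊗ₜ der hθ D))
    (h' : ∀ k, f (elt hθ k) = g (elt hθ k)) : f = g := by
  refine LinearMap.ext fun u => ?_
  rw [eq_sum_coef hθ u]
  simp only [map_add, map_sum, map_smul, h, h']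

/-! ### Integral combinations -/

/-- The element of `ℒ` defined by a list of terms. -/
noncomputable def toL : List (ℤ × Fin 16 × Fin 7) → L c
  | [] => 0
  | v :: V => v.1 • elt hθ v.2 + toL V

variable (c θ) in
/-- The functional on `ℒ` defined by a list of terms. -/
noncomputable def evalTerms : List (ℤ × Fin 16 × Fin 7) → L c →ₗ[A] A
  | [] => 0
  | f :: F => f.1 • coef c θ f.2 + evalTerms F

/-- `termCoeff` is written with Boolean tests on numerals for the sake of evaluation; this is its
form for proofs. -/
theorem termCoeff_cons (k : Fin 16 × Fin 7) (v) (V : List (ℤ × Fin 16 × Fin 7)) :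
    termCoeff k (v :: V) = (if k = v.2 then v.1 else 0) + termCoeff k V := by
  have h : (Nat.beq k.1.val v.2.1.val && Nat.beq k.2.val v.2.2.val) = decide (k = v.2) := by
    rw [Bool.eq_iff_iff, Bool.and_eq_true, Nat.beq_eq, Nat.beq_eq, decide_eq_true_iff,
      Prod.ext_iff, Fin.ext_iff, Fin.ext_iff]
  rw [termCoeff, h]
  by_cases hk : k = v.2
  · simp [hk]
  · simp [hk]

theorem coef_toL (k : Fin 16 × Fin 7) (V : List (ℤ × Fin 16 × Fin 7)) :
    coef c θ k (toL hθ V) = termCoeff k V := by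
  induction V with
  | nil => simp [toL, termCoeff]
  | cons v V ih =>
    rw [toL, map_add, map_zsmul, coef_elt, ih, termCoeff_cons]
    push_cast
    simp

theorem derComp_toL (S : Fin 16) (V : List (ℤ × Fin 16 × Fin 7)) :
    derComp c θ S (toL hθ V) = 0 := by
  induction V with
  | nil => simp [toL]
  | cons v V ih => rw [toL, map_add, map_zsmul, derComp_elt, ih, smul_zero, add_zero]

/-- The bridge from the tables to `ℒ`: a pairing decided over `ℤ` becomes the value of a functional
over `A`. -/
theorem evalTerms_toL (F V : List (ℤ × Fin 16 × Fin 7)) :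
    evalTerms c θ F (toL hθ V) = pair F V := by
  induction F with
  | nil => simp [evalTerms, pair]
  | cons f F ih =>
    rw [evalTerms, LinearMap.add_apply, ih, LinearMap.smul_apply, coef_toL, pair]
    rw [show ∀ a b : ℤ, Int.add a b = a + b from fun _ _ => rfl,
      show ∀ a b : ℤ, Int.mul a b = a * b from fun _ _ => rfl]
    push_cast
    simp

theorem evalTerms_elt (F : List (ℤ × Fin 16 × Fin 7)) (k : Fin 16 × Fin 7) :
    evalTerms c θ F (elt hθ k) = termCoeff k F := by
  induction F with
  | nil => simp [evalTerms, termCoeff]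
  | cons f F ih =>
    rw [evalTerms, LinearMap.add_apply, ih, LinearMap.smul_apply, coef_elt, termCoeff_cons]
    simp only [eq_comm (a := k)]
    push_cast
    simp

theorem evalTerms_der (F : List (ℤ × Fin 16 × Fin 7)) (w : ExteriorAlgebra A W)
    (D : Derivation ℝ A A) : evalTerms c θ F (w ⊗ₜ der hθ D) = 0 := by
  induction F with
  | nil => simp [evalTerms]
  | cons f F ih =>
    rw [evalTerms, LinearMap.add_apply, ih, LinearMap.smul_apply, coef_der, smul_zero, add_zero]

theorem toL_append (V V' : List (ℤ × Fin 16 × Fin 7)) :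
    toL hθ (V ++ V') = toL hθ V + toL hθ V' := by
  induction V with
  | nil => simp [toL]
  | cons v V ih => rw [List.cons_append, toL, toL, ih, add_assoc]

theorem toL_scaleTerms (n : ℤ) (V : List (ℤ × Fin 16 × Fin 7)) :
    toL hθ (scaleTerms n V) = n • toL hθ V := by
  induction V with
  | nil => simp [toL, scaleTerms]
  | cons v V ih =>
    rw [scaleTerms, List.map_cons, ← scaleTerms, toL, ih, toL, smul_add, smul_smul]; rfl

theorem toL_mulTerms (T : Fin 16) (V : List (ℤ × Fin 16 × Fin 7)) :
    toL hθ (mulTerms T V) = mono θ T • toL hθ V := by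
  induction V with
  | nil => simp [toL, mulTerms]
  | cons v V ih =>
    have h : mono θ T • elt hθ v.2 = wedgeSign T v.2.1 • elt hθ (T ^^^ v.2.1, v.2.2) := by
      rw [elt, elt, TensorProduct.smul_tmul', smul_eq_mul, mono_mul, TensorProduct.smul_tmul']
    have h' : mono θ T • (v.1 • elt hθ v.2) = v.1 • mono θ T • elt hθ v.2 := smul_comm _ _ _
    rw [toL, smul_add, h', h, smul_smul, ← ih, mulTerms, mulTerms, List.filter_cons]
    by_cases hw : wedgeSign T v.2.1 = 0
    · simp [hw]
    · simp [hw, toL]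

theorem toL_expandBy (k : Fin 16 × Fin 7)
    (R : List (List (ℤ × Fin 16 × Fin 7) × List (ℤ × Fin 16 × Fin 7))) :
    toL hθ (expandBy k R) = (R.map fun r => termCoeff k r.1 • toL hθ r.2).sum := by
  induction R with
  | nil => simp [toL, expandBy]
  | cons r R ih =>
    rw [expandBy, List.map_cons, List.sum_cons, ← ih]
    split
    · next h => rw [h]; simp
    · next h => rw [toL_append, toL_scaleTerms]

/-- `IsSixAt` only inspects the seven indices with the parity of `k`. Its first clause guarantees
that no term of any other parity occurs, so those seven determine the whole element. -/
theorem six_smul_elt {k : Fin 16 × Fin 7}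
    {R : List (List (ℤ × Fin 16 × Fin 7) × List (ℤ × Fin 16 × Fin 7))} (h : IsSixAt k R) :
    (6 : ℤ) • elt hθ k = (R.map fun r => termCoeff k r.1 • toL hθ r.2).sum := by
  rw [← toL_expandBy]
  obtain ⟨h1, h2⟩ := h
  conv_rhs => rw [eq_sum_coef hθ (toL hθ (expandBy k R))]
  -- For a given parity the index `(S, a)` is determined by `a`, because `S` is the parity shifted
  -- back by `mask a`.
  have hz : ∀ l, l ≠ k → termCoeff l (expandBy k R) = 0 := by
    intro l hl
    by_cases hp : parity l = parity k
    · have hx : ∀ S T : Fin 16, S ^^^ T ^^^ T = S := by decide +kernel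
      have hlk : l = (parity k ^^^ mask l.2, l.2) := by
        rw [← hp, parity, hx]
      rw [hlk, h2 l.2, if_neg]
      intro hb
      apply hl
      rw [hlk, hb, parity, hx]
    · generalize expandBy k R = V at h1
      clear h2
      induction V with
      | nil => rfl
      | cons v V ih =>
        rw [termCoeff_cons, ih fun t ht => h1 t (List.mem_cons_of_mem _ ht), if_neg, add_zero]
        rintro rfl
        exact hp (h1 v List.mem_cons_self)
  have hx : parity k ^^^ mask k.2 = k.1 := by
    have hx : ∀ S T : Fin 16, S ^^^ T ^^^ T = S := by decide +kernel
    rw [parity, hx]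
  have hk := h2 k.2
  rw [hx, if_pos rfl] at hk
  simp only [coef_toL, derComp_toL]
  rw [Finset.sum_eq_zero, zero_add, Finset.sum_eq_single k]
  · rw [hk]; push_cast; module
  · intro l _ hl
    rw [hz l hl]; simp
  · simp
  · intro S _
    rw [der_zero, TensorProduct.tmul_zero]

/-- The resolution is only required at indices where `u` may have a nonzero coefficient. This
permits the Weyl resolution, which covers only `∧²W ⊗ so(W)`. -/
theorem six_smul_eq {u : L c} {R : List (List (ℤ × Fin 16 × Fin 7) × List (ℤ × Fin 16 × Fin 7))}
    (hu : ∀ S, derComp c θ S u = 0) (h : ∀ k, coef c θ k u = 0 ∨ IsSixAt k R) :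
    (6 : ℤ) • u = (R.map fun r => evalTerms c θ r.1 u • toL hθ r.2).sum := by
  let φ : L c →ₗ[A] L c := (R.map fun r => (evalTerms c θ r.1).smulRight (toL hθ r.2)).sum
  have hφ : ∀ u, φ u = (R.map fun r => evalTerms c θ r.1 u • toL hθ r.2).sum := by
    intro u
    clear h
    induction R with
    | nil => simp [φ]
    | cons r R ih => simp [φ, ← ih]
  rw [← hφ]
  have e : u = ∑ k, coef c θ k u • elt hθ k := by
    conv_lhs => rw [eq_sum_coef hθ u]
    simp [hu, der_zero]
  rw [e, map_sum, Finset.smul_sum]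
  refine Finset.sum_congr rfl fun k _ => ?_
  rw [map_smul, smul_comm]
  rcases h k with h | h
  · rw [h, zero_smul, zero_smul]
  · rw [six_smul_elt hθ h, hφ]
    simp only [evalTerms_elt]
    congr 3

end

section

variable {A : Type*} [CommRing A] [Algebra ℝ A] {W : Type*} [AddCommGroup W] [Module A W]
  {c : Set (LinearMap.BilinForm A W)} {θ : Module.Basis (Fin 4) A W} (hθ : IsConfFrame c θ)

/-! ### The representation in coordinates -/

theorem termCoeff_map_finRange (x : Fin 7 → ℤ) (y : Fin 7 → Fin 16) (S : Fin 16) (a : Fin 7) :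
    termCoeff (S, a) ((List.finRange 7).map fun b => (x b, y b, b)) =
      if S = y a then x a else 0 := by
  have h : ∀ l : List (Fin 7), l.Nodup → termCoeff (S, a) (l.map fun b => (x b, y b, b)) =
      if a ∈ l then (if S = y a then x a else 0) else 0 := by
    intro l hl
    induction l with
    | nil => rfl
    | cons b l ih =>
      rw [List.nodup_cons] at hl
      rw [List.map_cons, termCoeff_cons, ih hl.2]
      by_cases hab : a = b
      · subst hab
        simp [hl.1]
      · simp [hab]
  rw [h _ (List.nodup_finRange 7), if_pos (List.mem_finRange a)]

include hθ in
-- A matrix entry of the anchor is `A`-linear in `u`. It vanishes on `θ_S D`, since `D` annihilates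
-- monomials, and on `θ_S σ_a` it is a product of two signs.
theorem repr_anchor_mono (U T : Fin 16) (u : L c) :
    (monoBasis θ).repr (anchor c u (mono θ U)) T = evalTerms c θ (anchorTerms U T) u := by
  have key : (monoBasis θ).coord T ∘ₗ
      ({ toFun := fun u => anchor c u (mono θ U)
         map_add' := fun u v => by rw [map_add]; rfl
         map_smul' := fun f u => by rw [map_smul]; rfl } : L c →ₗ[A] ExteriorAlgebra A W) =
      evalTerms c θ (anchorTerms U T) := by
    refine linearMap_ext hθ (fun S D => ?_) fun k => ?_
    · rw [evalTerms_der, LinearMap.comp_apply]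
      change (monoBasis θ).repr (mono θ S * (der hθ D).onExt (mono θ U)) T = 0
      rw [onExt_der_mono, mul_zero]; simp
    · obtain ⟨S, a⟩ := k
      rw [evalTerms_elt, LinearMap.comp_apply]
      change (monoBasis θ).repr (mono θ S * (sig hθ a).onExt (mono θ U)) T = _
      have h : ∀ S T V : Fin 16, S ^^^ V = T ↔ S = T ^^^ V := by decide +kernel
      rw [onExt_sig_mono, mul_smul_comm, mono_mul, smul_smul, map_zsmul, Finsupp.smul_apply,
        monoBasis_repr_mono, anchorTerms, termCoeff_map_finRange]
      by_cases hS : S = T ^^^ (U ^^^ mask a)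
      · rw [if_pos ((h _ _ _).2 hS), if_pos hS, ← hS]; simp
      · rw [if_neg (mt (h _ _ _).1 hS), if_neg hS]; simp
  rw [← key]; rfl

include hθ in
-- The `σ_a` annihilate functions, so the anchor on functions sees exactly the derivation
-- components.
theorem repr_anchor_algebraMap (f : A) (S : Fin 16) (u : L c) :
    (monoBasis θ).repr (anchor c u (algebraMap A _ f)) S = derComp c θ S u f := by
  have key : (monoBasis θ).coord S ∘ₗ
      ({ toFun := fun u => anchor c u (algebraMap A _ f)
         map_add' := fun u v => by rw [map_add]; rfl
         map_smul' := fun f u => by rw [map_smul]; rfl } : L c →ₗ[A] ExteriorAlgebra A W) =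
      { toFun := fun u => derComp c θ S u f
        map_add' := fun u v => by rw [map_add]; rfl
        map_smul' := fun f u => by rw [map_smul]; rfl } := by
    refine linearMap_ext hθ (fun T D => ?_) fun k => ?_
    · change (monoBasis θ).repr (mono θ T * (der hθ D).onExt (algebraMap A _ f)) S =
        derComp c θ S (mono θ T ⊗ₜ der hθ D) f
      rw [derComp_tmul, CDerEnd.onExt_algebraMap, sym_der, ← Algebra.commutes, ← Algebra.smul_def,
        map_smul, Finsupp.smul_apply, smul_eq_mul, mul_comm]
      rfl
    · change (monoBasis θ).repr (mono θ k.1 * (sig hθ k.2).onExt (algebraMap A _ f)) S =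
        derComp c θ S (elt hθ k) f
      rw [derComp_elt, CDerEnd.onExt_algebraMap, sym_sig]
      simp
  exact LinearMap.congr_fun key u

variable (θ) in
/-- The element `θ_0 θ_1 θ_2 θ_3` of `Ω`. -/
noncomputable def volEl : Om A W := ⟨mono θ 15, mono_mem_extPow θ 15⟩

omit [Algebra ℝ A] in
theorem exists_smul_volEl (z : Om A W) : ∃ f : A, z = f • volEl θ := by
  obtain ⟨z, hz⟩ := z
  rw [extPow_eq_span θ] at hz
  have h : ∀ S : Fin 16, popCount S.val = 4 → S = 15 := by decide +kernel
  have : Submodule.span A {m | ∃ S : Fin 16, popCount S = 4 ∧ m = mono θ S} ≤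
      Submodule.span A {mono θ 15} := by
    rw [Submodule.span_le]
    rintro _ ⟨S, hS, rfl⟩
    rw [h S hS]
    exact Submodule.mem_span_singleton_self _
  obtain ⟨f, hf⟩ := Submodule.mem_span_singleton.1 (this hz)
  exact ⟨f, Subtype.ext hf.symm⟩

variable (θ) in
/-- The isomorphism `∧W → ∧W ⊗ Ω` defined by the volume element. -/
noncomputable def omEquiv : ExteriorAlgebra A W ≃ₗ[A] ExtOm A W :=
  (TensorProduct.rid A (ExteriorAlgebra A W)).symm ≪≫ₗ
    TensorProduct.congr (LinearEquiv.refl A _)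
      (LinearEquiv.ofBijective (LinearMap.toSpanSingleton A (Om A W) (volEl θ))
        ⟨by
          rw [← LinearMap.ker_eq_bot, LinearMap.ker_eq_bot']
          intro f hf
          have h := congrArg (fun z : Om A W => (monoBasis θ).repr (z : ExteriorAlgebra A W) 15) hf
          simpa [volEl, monoBasis_repr_mono] using h,
        fun z => by
          obtain ⟨f, hf⟩ := exists_smul_volEl (θ := θ) z
          exact ⟨f, hf.symm⟩⟩)

omit [Algebra ℝ A] in
theorem omEquiv_apply (x : ExteriorAlgebra A W) : omEquiv θ x = x ⊗ₜ volEl θ := by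
  simp only [omEquiv, LinearEquiv.trans_apply, TensorProduct.rid_symm_apply,
    TensorProduct.congr_tmul, LinearEquiv.refl_apply]
  change x ⊗ₜ[A] ((1 : A) • volEl θ) = _
  rw [one_smul]

/-- On the top exterior power an endomorphism acts by its trace, which is 4 for `σ_0` and 0 for
boosts and rotations. Thus `Ω` detects the `σ_0` component. -/
theorem onOm_sig (a : Fin 7) (z : Om A W) :
    (sig hθ a).onOm z = if a = 0 then (4 : ℤ) • z else 0 := by
  obtain ⟨f, rfl⟩ := exists_smul_volEl (θ := θ) z
  have h : ∀ a, derSign a 15 = if a = 0 then 4 else 0 := by decide +kernel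
  apply Subtype.ext
  rw [CDerEnd.onOm_smul, sym_sig]
  change (0 : A) • mono θ 15 + f • (sig hθ a).onExt (mono θ 15) = _
  rw [onExt_sig_mono, h]
  by_cases ha : a = 0
  · rw [if_pos ha, if_pos ha, ha]
    have h' : (15 : Fin 16) ^^^ mask 0 = 15 := by decide +kernel
    rw [h', zero_smul, zero_add, smul_comm]; rfl
  · rw [if_neg ha, if_neg ha]; simp

theorem onOm_der (D : Derivation ℝ A A) : (der hθ D).onOm (volEl θ) = 0 :=
  Subtype.ext (onExt_der_mono hθ D 15)

/-- The coefficient of `θ_T` in the image of `θ_U` under the representation on `∧W ⊗ Ω`, as a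
functional on `ℒ`. -/
def omTerms (U T : Fin 16) : List (ℤ × Fin 16 × Fin 7) :=
  (4 * wedgeSign (T ^^^ U) U, T ^^^ U, 0) :: anchorTerms U T

include hθ in
-- After trivialising `Ω` by the volume element, the representation differs from the anchor only by
-- four times multiplication with the `σ_0` component.
theorem repr_repOm_mono (U T : Fin 16) (u : L c) :
    (monoBasis θ).repr ((omEquiv θ).symm (repOm c u (mono θ U ⊗ₜ volEl θ))) T =
      evalTerms c θ (omTerms U T) u := by
  have key : (monoBasis θ).coord T ∘ₗ (omEquiv θ).symm.toLinearMap ∘ₗ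
      ({ toFun := fun u => repOm c u (mono θ U ⊗ₜ volEl θ)
         map_add' := fun u v => by rw [map_add]; rfl
         map_smul' := fun f u => by rw [map_smul]; rfl } : L c →ₗ[A] ExtOm A W) =
      evalTerms c θ (omTerms U T) := by
    refine linearMap_ext hθ (fun S D => ?_) fun k => ?_
    · rw [evalTerms_der, LinearMap.comp_apply]
      change (monoBasis θ).repr ((omEquiv θ).symm
        (mono θ S • (der hθ D).onExtOm (mono θ U ⊗ₜ volEl θ))) T = 0
      rw [CDerEnd.onExtOm_tmul, onExt_der_mono, onOm_der]
      simp
    · obtain ⟨S, a⟩ := k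
      have h : ∀ S T V : Fin 16, S ^^^ V = T ↔ S = T ^^^ V := by decide +kernel
      rw [omTerms, evalTerms, LinearMap.add_apply, LinearMap.smul_apply, coef_elt,
        ← repr_anchor_mono hθ, LinearMap.comp_apply]
      change (monoBasis θ).repr ((omEquiv θ).symm
        (mono θ S • (sig hθ a).onExtOm (mono θ U ⊗ₜ volEl θ))) T =
        _ + (monoBasis θ).repr (mono θ S * (sig hθ a).onExt (mono θ U)) T
      have e : mono θ S • (sig hθ a).onExtOm (mono θ U ⊗ₜ[A] volEl θ) =
          omEquiv θ (mono θ S * (sig hθ a).onExt (mono θ U) +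
            (if a = 0 then 4 else 0 : ℤ) • wedgeSign S U • mono θ (S ^^^ U)) := by
        rw [CDerEnd.onExtOm_tmul, onOm_sig, map_add, omEquiv_apply, smul_add,
          TensorProduct.smul_tmul', smul_eq_mul, ← mono_mul, map_zsmul, omEquiv_apply]
        congr 1
        split_ifs
        · rw [TensorProduct.tmul_smul, ← smul_eq_mul (mono θ S), ← TensorProduct.smul_tmul',
            smul_comm]
        · simp
      rw [e, LinearEquiv.symm_apply_apply, map_add, Finsupp.add_apply, add_comm]
      congr 1
      rw [map_zsmul, map_zsmul, Finsupp.smul_apply, Finsupp.smul_apply, monoBasis_repr_mono,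
        smul_smul]
      by_cases ha : a = 0
      · subst ha
        by_cases hS : S = T ^^^ U
        · rw [if_pos ((h _ _ _).2 hS), ← hS]; simp
        · have h' : ¬ (T ^^^ U, (0 : Fin 7)) = (S, 0) := fun e => hS (congrArg Prod.fst e).symm
          rw [if_neg (mt (h _ _ _).1 hS), if_neg h']; simp
      · have h' : ¬ (T ^^^ U, (0 : Fin 7)) = (S, a) := fun e => ha (congrArg Prod.snd e).symm
        rw [if_neg ha, if_neg h']; simp
  rw [← key]; rfl

omit [Algebra ℝ A] in
-- Contraction with `g(θ_j, -)` strikes out `θ_j`; the extra sign for `j = 0` is `g(θ_0, θ_0) = -1`.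
theorem contractLeft_mono {g : LinearMap.BilinForm A W}
    (hg : ∀ i j, g (θ i) (θ j) = mink A i j) (j : Fin 4) (S : Fin 16) :
    CliffordAlgebra.contractLeft (g (θ j)) (mono θ S) =
      contractSign j S • mono θ (bit j ^^^ S) := by
  induction S using mono_induction with
  | h0 =>
    have h : ∀ j, contractSign j 0 = 0 := by decide +kernel
    rw [h, zero_smul, mono_zero]
    exact CliffordAlgebra.contractLeft_one (Q := (0 : QuadraticForm A W)) (g (θ j))
  | h i S hi ih =>
    have h : ∀ (i j : Fin 4) (S : Fin 16), (∀ k ∈ elems S, i < k) →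
      (i = j → bit j ^^^ (bit i ^^^ S) = S ∧ contractSign j S = 0 ∧
        contractSign j (bit i ^^^ S) = if i = 0 then -1 else 1) ∧
      (i ≠ j → contractSign j (bit i ^^^ S) =
        - (contractSign j S * wedgeSign (bit i) (bit j ^^^ S))) := by decide +kernel
    obtain ⟨h1, h2⟩ := h i j S hi
    have e := CliffordAlgebra.contractLeft_ι_mul (Q := (0 : QuadraticForm A W)) (d := g (θ j))
      (θ i) (mono θ S)
    rw [mono_xor_bit θ hi]
    refine e.trans ?_
    rw [ih, hg, mink]
    change _ - ExteriorAlgebra.ι A (θ i) * _ = _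
    rw [mul_smul_comm, ι_mul_mono]
    by_cases hij : i = j
    · obtain ⟨h3, h4, h5⟩ := h1 hij
      rw [h3, h4, h5, if_pos hij.symm, hij]
      split_ifs <;> simp
    · rw [h2 hij, if_neg (Ne.symm hij), smul_smul, fin16_xor_left_comm]
      simp

include hθ in
theorem repr_ricci {g : LinearMap.BilinForm A W} (hg : ∀ i j, g (θ i) (θ j) = mink A i j)
    (i : Fin 4) (T : Fin 16) (u : L c) :
    (monoBasis θ).repr (ricci g (θ i) u) T = evalTerms c θ (ricciTerms i T) u := by
  have key : (monoBasis θ).coord T ∘ₗ ricci g (θ i) = evalTerms c θ (ricciTerms i T) := by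
    refine linearMap_ext hθ (fun S D => ?_) fun k => ?_
    · rw [evalTerms_der, LinearMap.comp_apply, ricci_tmul, op_der]; simp
    · obtain ⟨S, a⟩ := k
      have h : ∀ S T V : Fin 16, V ^^^ S = T ↔ S = V ^^^ T := by decide +kernel
      rw [evalTerms_elt, LinearMap.comp_apply, elt, ricci_tmul, op_sig, map_zsmul, map_zsmul,
        LinearMap.smul_apply, contractLeft_mono hg, map_zsmul, map_zsmul,
        Module.Basis.coord_apply, monoBasis_repr_mono, ricciTerms, termCoeff_map_finRange, smul_smul]
      by_cases hS : S = bit (actIdx a i) ^^^ T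
      · rw [if_pos ((h _ _ _).2 hS), if_pos hS, ← hS]; simp
      · rw [if_neg (mt (h _ _ _).1 hS), if_neg hS]; simp
  rw [← key]; rfl

end

section

variable {A : Type*} [CommRing A] [Algebra ℝ A] {W : Type*} [AddCommGroup W] [Module A W]
  {c : Set (LinearMap.BilinForm A W)} {θ : Module.Basis (Fin 4) A W} (hθ : IsConfFrame c θ)

/-! ### The algebraic Weyl tensors in coordinates -/

theorem elt_mem_gradeL (k : Fin 16 × Fin 7) : elt hθ k ∈ gradeL c (popCount k.1) :=
  Submodule.subset_span ⟨_, mono_mem_extPow θ k.1, _, rfl⟩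

theorem toL_mem {P : Submodule A (L c)} {V : List (ℤ × Fin 16 × Fin 7)}
    (h : ∀ t ∈ V, elt hθ t.2 ∈ P) : toL hθ V ∈ P := by
  induction V with
  | nil => exact zero_mem _
  | cons v V ih =>
    rw [toL]
    exact add_mem (zsmul_mem (h v List.mem_cons_self) _)
      (ih fun t ht => h t (List.mem_cons_of_mem _ ht))

theorem toL_mem_gradeL {V : List (ℤ × Fin 16 × Fin 7)} {n : ℕ}
    (h : ∀ t ∈ V, popCount t.2.1.val = n) : toL hθ V ∈ gradeL c n :=
  toL_mem hθ fun t ht => by rw [← h t ht]; exact elt_mem_gradeL hθ t.2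

/-- Elements of `∧²W` are central, so for degree two the anchor gives an ordinary derivation without
signs. -/
theorem anchor_mul {u : L c} (hu : u ∈ gradeL c 2) (a b : ExteriorAlgebra A W) :
    anchor c u (a * b) = anchor c u a * b + a * anchor c u b := by
  have key : ((AddMonoidHom.eval (a * b)).comp (anchor c).toAddMonoidHom) u =
      ((AddMonoidHom.mulRight b).comp ((AddMonoidHom.eval a).comp (anchor c).toAddMonoidHom) +
        (AddMonoidHom.mulLeft a).comp ((AddMonoidHom.eval b).comp (anchor c).toAddMonoidHom)) u := by
    refine gradeL_induction (fun w hw x => ?_) hu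
    simp only [AddMonoidHom.comp_apply, LinearMap.toAddMonoidHom_coe,
      AddMonoidHom.eval_apply_apply, anchor_tmul, AddMonoidHom.add_apply,
      AddMonoidHom.coe_mulRight, AddMonoidHom.coe_mulLeft, CDerEnd.onExt_mul]
    rw [mul_add, mul_assoc, ← mul_assoc w a, even_comm hw a, mul_assoc]
  exact key

include hθ in
-- A derivation of `∧W` vanishes once it vanishes on functions and on the frame; the first is the
-- condition on the derivation components.
theorem anchor_eq_zero {u : L c} (hu : u ∈ gradeL c 2) (h : ∀ S, derComp c θ S u = 0)
    (h' : ∀ i, anchor c u (mono θ (bit i)) = 0) : anchor c u = 0 := by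
  ext1 a
  have h0 : ∀ f : A, anchor c u (algebraMap A _ f) = 0 := by
    intro f
    apply (monoBasis θ).repr.injective
    ext S
    rw [repr_anchor_algebraMap hθ, h]; simp
  change anchor c u a = 0
  induction a using ExteriorAlgebra.induction with
  | algebraMap f => exact h0 f
  | ι w =>
    rw [← θ.sum_repr w, map_sum, map_sum]
    refine Finset.sum_eq_zero fun i _ => ?_
    rw [map_smul, ← mono_bit, Algebra.smul_def, anchor_mul hu, h', h0]
    simp
  | mul a b ha hb => rw [anchor_mul hu, ha, hb]; simp
  | add a b ha hb => rw [map_add, ha, hb, add_zero]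

theorem repOm_toL {V : List (ℤ × Fin 16 × Fin 7)} (hV : ∀ t ∈ V, t.2.2 ≠ 0)
    (a : ExteriorAlgebra A W) (z : Om A W) :
    repOm c (toL hθ V) (a ⊗ₜ z) = anchor c (toL hθ V) a ⊗ₜ z := by
  induction V with
  | nil => simp [toL]
  | cons v V ih =>
    have e : repOm c (elt hθ v.2) (a ⊗ₜ z) = anchor c (elt hθ v.2) a ⊗ₜ z := by
      rw [elt, repOm_tmul, CDerEnd.onExtOm_tmul, onOm_sig, if_neg (hV v List.mem_cons_self),
        TensorProduct.tmul_zero, add_zero, TensorProduct.smul_tmul']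
      rfl
    rw [toL, map_add, map_add, AddMonoidHom.add_apply, AddMonoidHom.add_apply,
      ih fun t ht => hV t (List.mem_cons_of_mem _ ht), TensorProduct.add_tmul, map_zsmul, map_zsmul,
      AddMonoidHom.smul_apply, AddMonoidHom.smul_apply, e]
    congr 1

theorem ricci_toL (g : LinearMap.BilinForm A W) (w : W) (V : List (ℤ × Fin 16 × Fin 7)) :
    ricci g w (toL hθ V) = ∑ i, θ.repr w i • ricci g (θ i) (toL hθ V) := by
  induction V with
  | nil => simp [toL]
  | cons v V ih =>
    have e : ricci g w (elt hθ v.2) = ∑ i, θ.repr w i • ricci g (θ i) (elt hθ v.2) := by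
      conv_lhs => rw [elt, ricci_tmul, ← θ.sum_repr w]
      simp only [map_sum, CDerEnd.op_smul, sym_sig, LinearMap.sum_apply]
      refine Finset.sum_congr rfl fun i _ => ?_
      rw [elt, ricci_tmul]
      simp
    rw [toL, map_add, map_zsmul, ih, e, Finset.smul_sum, ← Finset.sum_add_distrib]
    refine Finset.sum_congr rfl fun i _ => ?_
    rw [map_add, map_zsmul, smul_add, smul_comm]

theorem toL_weylTerms_mem (k : Fin 10) : toL hθ (weylTerms k) ∈ weyl c := by
  have hk := weylTerms_support k
  have h2 : toL hθ (weylTerms k) ∈ gradeL c 2 := toL_mem_gradeL hθ fun t ht => (hk t ht).1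
  have ha : anchor c (toL hθ (weylTerms k)) = 0 := by
    refine anchor_eq_zero hθ h2 (fun S => derComp_toL hθ S _) fun i => ?_
    apply (monoBasis θ).repr.injective
    ext T
    rw [repr_anchor_mono hθ, evalTerms_toL, pair_anchor_weyl]; simp
  refine ⟨h2, repL_eq_zero.2 ⟨ha, ?_⟩, fun g' hg' w => ?_⟩
  · refine CDerEnd.extOm_induction fun a z => ?_
    rw [repOm_toL hθ fun t ht => (hk t ht).2, ha]; simp
  -- The Ricci contraction is linear in `g`, and all members of the class are multiples of the one
  -- that is diagonal in the frame.
  · obtain ⟨g, -, hg, hu⟩ := hθ.exists_rep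
    obtain ⟨r, rfl⟩ := hu g' hg'
    have e : ∀ u : L c, ricci ((r : A) • g) w u = (r : A) • ricci g w u := by
      intro u
      induction u using TensorProduct.induction_on with
      | zero => simp
      | add u v hu hv => rw [map_add, map_add, hu, hv, smul_add]
      | tmul a x => simp
    rw [e, ricci_toL, Finset.sum_eq_zero, smul_zero]
    intro i _
    have : ricci g (θ i) (toL hθ (weylTerms k)) = 0 := by
      apply (monoBasis θ).repr.injective
      ext T
      rw [repr_ricci hθ hg, evalTerms_toL, pair_ricci_weyl]; simp
    rw [this, smul_zero]

omit [Algebra ℝ A] in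
theorem repr_extPow {w : ExteriorAlgebra A W} {n : ℕ} (hw : w ∈ ⋀[A]^n W) {S : Fin 16}
    (hS : popCount S ≠ n) : (monoBasis θ).repr w S = 0 := by
  rw [extPow_eq_span θ] at hw
  induction hw using Submodule.span_induction with
  | zero => simp
  | add x y _ _ hx hy => rw [map_add, Finsupp.add_apply, hx, hy, add_zero]
  | smul f x _ hx => rw [map_smul, Finsupp.smul_apply, hx, smul_zero]
  | mem x hx =>
    obtain ⟨T, hT, rfl⟩ := hx
    rw [monoBasis_repr_mono, if_neg]
    rintro rfl
    exact hS hT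

theorem comp_gradeL {u : L c} {n : ℕ} (hu : u ∈ gradeL c n) {S : Fin 16} (hS : popCount S ≠ n) :
    comp c θ S u = 0 := by
  induction hu using Submodule.span_induction with
  | zero => simp
  | add x y _ _ hx hy => rw [map_add, hx, hy, add_zero]
  | smul f x _ hx => rw [map_smul, hx, smul_zero]
  | mem x hx =>
    obtain ⟨w, hw, y, rfl⟩ := hx
    rw [comp_tmul, repr_extPow hw hS, zero_smul]

include hθ in
theorem derComp_eq_zero {u : L c} (hu : repL c u = 0) (S : Fin 16) : derComp c θ S u = 0 := by
  ext f
  rw [← repr_anchor_algebraMap hθ, (repL_eq_zero.1 hu).1]; simp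

/-- Nonzero integers are units in a real algebra, so they act injectively on every module over it.
-/
theorem zsmul_cancel {N : Type*} [AddCommGroup N] [Module A N] {n : ℤ} (hn : n ≠ 0) {x : N}
    (h : n • x = 0) : x = 0 := by
  have h2 : IsUnit (n : A) := by
    have := (IsUnit.mk0 (n : ℝ) (by exact_mod_cast hn)).map (algebraMap ℝ A)
    rwa [map_intCast] at this
  rw [← Int.cast_smul_eq_zsmul A] at h
  exact (h2.smul_eq_zero).1 h

/-- Triviality of the action removes the derivation and `σ_0` components and gives the Bianchi
equations; the Ricci condition gives the rest. The resolution of the identity then leaves only the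
ten explicit tensors. -/
theorem six_smul_weyl {u : L c} (hu : u ∈ weyl c) :
    (6 : ℤ) • u = ((List.finRange 10).map fun k =>
      evalTerms c θ (weylDualTerms k) u • toL hθ (weylTerms k)).sum := by
  obtain ⟨h2, hr, hric⟩ := hu
  have hd := derComp_eq_zero hθ hr
  have hA : ∀ U T, evalTerms c θ (anchorTerms U T) u = 0 := by
    intro U T
    rw [← repr_anchor_mono hθ, (repL_eq_zero.1 hr).1]; simp
  have hR : ∀ i T, evalTerms c θ (ricciTerms i T) u = 0 := by
    obtain ⟨g, hgc, hg, -⟩ := hθ.exists_rep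
    intro i T
    rw [← repr_ricci hθ hg, hric g hgc]; simp
  -- Acting on `1 ⊗ vol` returns four times the `σ_0` component, beside an anchor term that
  -- vanishes.
  have h0 : ∀ S, coef c θ (S, 0) u = 0 := by
    intro S
    have h := repr_repOm_mono hθ 0 S u
    have hx : ∀ S : Fin 16, wedgeSign (S ^^^ 0) 0 = 1 ∧ S ^^^ 0 = S := by decide +kernel
    rw [(repL_eq_zero.1 hr).2, omTerms, evalTerms, LinearMap.add_apply, hA, (hx S).1, (hx S).2,
      add_zero, LinearMap.smul_apply] at h
    refine zsmul_cancel (A := A) (n := 4) (by norm_num) ?_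
    simpa using h.symm
  rw [six_smul_eq hθ (R := weylResolution) hd fun k => ?_]
  -- Each functional in `weylEquations` is a matrix entry of the anchor or a component of the Ricci
  -- contraction, so `hA` and `hR` kill it.
  · have e : (weylEquations.map fun r => evalTerms c θ r.1 u • toL hθ r.2).sum = 0 := by
      simp only [weylEquations, List.map_cons, List.map_nil, hA, hR, zero_smul, List.sum_cons,
        List.sum_nil, add_zero]
    rw [weylResolution, List.map_append, List.sum_append, List.map_map, e, add_zero]
    rfl
  · obtain ⟨S, a⟩ := k
    by_cases ha : a = 0
    · subst ha; exact Or.inl (h0 S)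
    · by_cases hS : popCount S.val = 2
      · exact Or.inr (isSixAt_weylResolution S a hS ha)
      · left
        rw [coef, LinearMap.comp_apply, comp_gradeL h2 hS, map_zero]

include hθ in
-- Over `A`, the ideal is spanned by monomials times Weyl tensors, and six times a Weyl tensor is a
-- combination of the tabulated ones. So the functionals descend to `ℰ`.
theorem evalTerms_dual_weylIdeal (j : Fin 40) {u : L c} (hu : u ∈ weylIdeal c) :
    evalTerms c θ (dualTerms j) u = 0 := by
  have key : ∀ T, ∀ u ∈ weyl c, evalTerms c θ (dualTerms j) (mono θ T • u) = 0 := by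
    intro T u hu
    apply zsmul_cancel (A := A) (n := 6) (by norm_num)
    rw [← map_zsmul, smul_comm, six_smul_weyl hθ hu]
    generalize List.finRange 10 = l
    induction l with
    | nil => simp
    | cons k l ih =>
      rw [List.map_cons, List.sum_cons, smul_add, map_add, ih, smul_comm, ← toL_mulTerms, map_smul,
        evalTerms_toL, pair_dual_weyl]
      simp
  induction hu using Submodule.closure_induction with
  | zero => simp
  | add u v _ _ hu hv => rw [map_add, hu, hv, add_zero]
  | smul_mem a u hu =>
    rw [← (monoBasis θ).sum_repr a, Finset.sum_smul, map_sum]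
    refine Finset.sum_eq_zero fun T _ => ?_
    rw [smul_assoc, map_smul, monoBasis_apply, key T u hu, smul_zero]

end

section

variable {A : Type*} [CommRing A] [Algebra ℝ A] {W : Type*} [AddCommGroup W] [Module A W]
  {c : Set (LinearMap.BilinForm A W)} {θ : Module.Basis (Fin 4) A W} (hθ : IsConfFrame c θ)

/-! ### The generators of `ℰ` -/

/-- The class of `θ_S σ_a` in `ℰ`. -/
noncomputable def eltE (S : Fin 16) (a : Fin 7) : E c := (weylIdeal c).mkQ (elt hθ (S, a))

/-- The generators of `ℰ_G` that do not involve derivations. -/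
noncomputable def genE (j : Fin 40) : E c := (weylIdeal c).mkQ (toL hθ (genTerms j))

theorem mkE_mono (S : Fin 16) (a : Fin 7) : mkE (mono θ S) (sig hθ a) = eltE hθ S a := rfl

theorem mkE_neg (w : ExteriorAlgebra A W) (x : CDerEnd c) : mkE (-w) x = -mkE w x := by
  rw [mkE, mkE, TensorProduct.neg_tmul, map_neg]

theorem mkQ_toL_nil : (weylIdeal c).mkQ (toL hθ []) = 0 := map_zero _

theorem mkQ_toL_cons (n : ℤ) (S : Fin 16) (a : Fin 7) (V : List (ℤ × Fin 16 × Fin 7)) :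
    (weylIdeal c).mkQ (toL hθ ((n, S, a) :: V)) =
      (n : A) • eltE hθ S a + (weylIdeal c).mkQ (toL hθ V) := by
  rw [toL, map_add, map_zsmul]
  congr 1

omit [Algebra ℝ A] in
theorem th_eq_mono : th0 θ = mono θ 1 ∧ th θ 0 = mono θ 2 ∧ th θ 1 = mono θ 4 ∧
    th θ 2 = mono θ 8 :=
  ⟨(mono_bit θ 0).symm, (mono_bit θ 1).symm, (mono_bit θ 2).symm, (mono_bit θ 3).symm⟩

omit [Algebra ℝ A] in
theorem mono_mul_eq {S T U : Fin 16} {n : ℤ} (h : wedgeSign S T = n ∧ S ^^^ T = U) :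
    mono θ S * mono θ T = n • mono θ U := by
  rw [mono_mul, h.1, h.2]

omit [Algebra ℝ A] in
theorem mono_products :
    mono θ 1 * mono θ 2 = mono θ 3 ∧ mono θ 1 * mono θ 4 = mono θ 5 ∧
    mono θ 1 * mono θ 8 = mono θ 9 ∧ mono θ 2 * mono θ 4 = mono θ 6 ∧
    mono θ 4 * mono θ 8 = mono θ 12 ∧ mono θ 8 * mono θ 2 = -mono θ 10 ∧
    mono θ 5 * mono θ 8 = mono θ 13 ∧ mono θ 9 * mono θ 2 = -mono θ 11 ∧
    mono θ 3 * mono θ 4 = mono θ 7 ∧ mono θ 6 * mono θ 8 = mono θ 14 := by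
  refine ⟨?_, ?_, ?_, ?_, ?_, ?_, ?_, ?_, ?_, ?_⟩ <;>
    first
      | exact (mono_mul_eq (by decide +kernel)).trans (one_smul ℤ _)
      | exact (mono_mul_eq (by decide +kernel)).trans (neg_one_zsmul _)

theorem sig_eq : sigma0 hθ = sig hθ 0 ∧ boost hθ 0 = sig hθ 1 ∧ boost hθ 1 = sig hθ 2 ∧
    boost hθ 2 = sig hθ 3 ∧ rot hθ 1 2 = sig hθ 4 ∧ rot hθ 2 0 = sig hθ 5 ∧
    rot hθ 0 1 = sig hθ 6 :=
  ⟨rfl, rfl, rfl, rfl, rfl, rfl, rfl⟩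

theorem derSet_neg (w : ExteriorAlgebra A W) : derSet hθ (-w) = derSet hθ w := by
  have h : ∀ w : ExteriorAlgebra A W, derSet hθ (-w) ⊆ derSet hθ w := by
    rintro w _ ⟨D, rfl⟩
    refine ⟨-D, ?_⟩
    have e : der hθ (-D) = -der hθ D := by
      rw [← neg_one_smul A D, der_smul, neg_one_smul]
    rw [mkE, mkE, e, TensorProduct.neg_tmul, TensorProduct.tmul_neg]
  refine (h w).antisymm ?_
  conv_lhs => rw [← neg_neg w]
  exact h (-w)

theorem int_smul_E (x : E c) : ((1 : ℤ) : A) • x = x ∧ ((-1 : ℤ) : A) • x = -x ∧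
    ((2 : ℤ) : A) • x = (2 : A) • x ∧ ((-2 : ℤ) : A) • x = -((2 : A) • x) ∧
    ((3 : ℤ) : A) • x = (3 : A) • x ∧ (2 : A) • -x = -((2 : A) • x) := by
  refine ⟨(Int.cast_smul_eq_zsmul A 1 x).trans (one_zsmul x),
    (Int.cast_smul_eq_zsmul A (-1) x).trans (neg_one_zsmul x), ?_, ?_, ?_, smul_neg (2 : A) x⟩
  · rw [Int.cast_ofNat]
  · rw [Int.cast_neg, Int.cast_ofNat]
    exact neg_smul (2 : A) x
  · rw [Int.cast_ofNat]

-- Matches the generators of the statement with the integer table. The table uses increasing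
-- monomials, so that for instance `θ_3 θ_1` enters with a sign; for the rows `ω Der(A)` the sign is
-- immaterial by `derSet_neg`.
set_option linter.unusedSimpArgs false in
theorem gens_eq :
    (gen000 hθ =
    derSet hθ (mono θ 0) ∪
       {genE hθ 0, genE hθ 1, genE hθ 2, genE hθ 3, genE hθ 4}) ∧
    (gen200 hθ 0 1 2 =
    {genE hθ 5}) ∧
    (gen200 hθ 1 2 0 =
    {genE hθ 6}) ∧
    (gen200 hθ 2 0 1 =
    {genE hθ 7}) ∧
    (gen011 hθ 0 1 2 =
    derSet hθ (mono θ 2) ∪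
       {genE hθ 8, genE hθ 9, genE hθ 10, genE hθ 11, genE hθ 12, genE hθ 13, genE hθ 14}) ∧
    (gen011 hθ 1 2 0 =
    derSet hθ (mono θ 4) ∪
       {genE hθ 15, genE hθ 16, genE hθ 17, genE hθ 18, genE hθ 19, genE hθ 20, genE hθ 21}) ∧
    (gen011 hθ 2 0 1 =
    derSet hθ (mono θ 8) ∪
       {genE hθ 22, genE hθ 23, genE hθ 24, genE hθ 25, genE hθ 26, genE hθ 27, genE hθ 28}) ∧
    (gen211 hθ 0 1 2 =
    derSet hθ (mono θ 12) ∪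
       {genE hθ 29, genE hθ 30, genE hθ 31}) ∧
    (gen211 hθ 1 2 0 =
    derSet hθ (mono θ 10) ∪
       {genE hθ 32, genE hθ 33, genE hθ 34}) ∧
    (gen211 hθ 2 0 1 =
    derSet hθ (mono θ 6) ∪
       {genE hθ 35, genE hθ 36, genE hθ 37}) ∧
    (gen222 hθ =
    derSet hθ (mono θ 14) ∪
       {genE hθ 38, genE hθ 39}) := by
  obtain ⟨t0, t1, t2, t3⟩ := th_eq_mono (θ := θ)
  obtain ⟨m1, m2, m3, m4, m5, m6, m7, m8, m9, m10⟩ := mono_products (θ := θ)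
  obtain ⟨s0, s1, s2, s3, s4, s5, s6⟩ := sig_eq hθ
  have e1 := fun x : E c => (int_smul_E x).1
  have e2 := fun x : E c => (int_smul_E x).2.1
  have e3 := fun x : E c => (int_smul_E x).2.2.1
  have e4 := fun x : E c => (int_smul_E x).2.2.2.1
  have e5 := fun x : E c => (int_smul_E x).2.2.2.2.1
  have e6 := fun x : E c => (int_smul_E x).2.2.2.2.2
  refine ⟨?_, ?_, ?_, ?_, ?_, ?_, ?_, ?_, ?_, ?_, ?_⟩ <;>
  simp only [gen000, gen200, gen011, gen211, gen222, genE, genTerms, Matrix.cons_val,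
    mkQ_toL_cons, mkQ_toL_nil, t0, t1, t2, t3, m1, m2, m3, m4, m5, m6, m7, m8, m9, m10,
    s0, s1, s2, s3, s4, s5, s6, mkE_neg, mkE_mono, derSet_neg, ← mono_zero θ,
    e1, e2, e3, e4, e5, e6, add_zero, sub_eq_add_neg, neg_neg, add_assoc]

end

/-! ### Families of submodules separated by a family of kernels -/

/-- The submodules `X i` and their images under `t`, which has square zero, together span `M`, and
they are separated by the submodules `Q i`: all `X j`, and all `t (X j)` for `j ≠ i`, lie in `Q i`,
and `t (X i)` meets `Q i` only in zero. -/
structure IsSeparated {R M ι : Type*} [CommRing R] [AddCommGroup M] [Module R M] (t : M →ₗ[R] M)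
    (X Q : ι → Submodule R M) : Prop where
  sq_zero : ∀ x, t (t x) = 0
  le_ker : ∀ i j, X j ≤ Q i
  map_le_ker : ∀ i j, i ≠ j → (X j).map t ≤ Q i
  eq_zero : ∀ i, ∀ x ∈ X i, t x ∈ Q i → x = 0
  sup_eq_top : (⨆ i, X i) ⊔ (⨆ i, X i).map t = ⊤

namespace IsSeparated

variable {R M ι : Type*} [CommRing R] [AddCommGroup M] [Module R M] {t : M →ₗ[R] M}
  {X Q : ι → Submodule R M}

variable (t X) in
/-- The sum of the `X i` and `t (X i)` for `i ∈ K`. -/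
def supOn (K : Set ι) : Submodule R M := ⨆ i ∈ K, (X i ⊔ (X i).map t)

theorem supOn_mono {K K' : Set ι} (h : K ⊆ K') : supOn t X K ≤ supOn t X K' :=
  biSup_mono fun _ hi => h hi

variable (t X) in
theorem supOn_eq (K : Set ι) : supOn t X K = (⨆ i ∈ K, X i) ⊔ (⨆ i ∈ K, X i).map t := by
  simp only [supOn, Submodule.map_iSup, iSup_sup_eq]

variable (h : IsSeparated t X Q)
include h

theorem mem_iSup_ker {x : M} (hx : x ∈ ⨆ i, X i) (i : ι) : x ∈ Q i :=
  (iSup_le (h.le_ker i) : (⨆ j, X j) ≤ Q i) hx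

/-- Write `x` as a finite sum of elements of the `X i`. For `i ∉ K` the images under `t` of all
other terms lie in `Q i`, hence so does the image of the `i`-th term, which is then zero. -/
theorem mem_biSup {K : Set ι} {x : M} (hx : x ∈ ⨆ i, X i) (hK : ∀ i ∉ K, t x ∈ Q i) :
    x ∈ ⨆ i ∈ K, X i := by
  classical
  rw [Submodule.mem_iSup_iff_exists_finsupp] at hx
  obtain ⟨f, hf, rfl⟩ := hx
  refine Submodule.sum_mem _ fun i hi => ?_
  by_cases hiK : i ∈ K
  · exact (le_biSup X hiK) (hf i)
  · have e : f i = 0 := by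
      refine h.eq_zero i _ (hf i) ?_
      have h1 := hK i hiK
      rw [Finsupp.sum, map_sum, ← Finset.add_sum_erase _ _ hi] at h1
      refine (Submodule.add_mem_iff_left _ (Submodule.sum_mem _ fun j hj => ?_)).1 h1
      exact h.map_le_ker i j (Finset.ne_of_mem_erase hj).symm ⟨_, hf j, rfl⟩
    rw [e]; exact zero_mem _

/-- Write `x = u + t v` with `u`, `v` in the sum of the `X i`. Since `u` lies in every `Q i`, the
condition on `x` tests `v`; since `t x = t u`, the condition on `t x` tests `u`. Membership becomes
a condition for each index separately, as if there were a basis. -/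
theorem mem_supOn {K : Set ι} {x : M} :
    x ∈ supOn t X K ↔ ∀ i ∉ K, x ∈ Q i ∧ t x ∈ Q i := by
  constructor
  · intro hx i hi
    rw [supOn_eq] at hx
    obtain ⟨u, hu, _, ⟨v, hv, rfl⟩, rfl⟩ := Submodule.mem_sup.1 hx
    have key : ∀ u ∈ ⨆ i ∈ K, X i, t u ∈ Q i := fun u hu =>
      (iSup₂_le fun j hj => Submodule.map_le_iff_le_comap.1
        (h.map_le_ker i j fun e => hi (e ▸ hj)) :
        (⨆ i ∈ K, X i) ≤ (Q i).comap t) hu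
    refine ⟨add_mem (h.mem_iSup_ker (iSup₂_le_iSup (· ∈ K) X hu) i) (key v hv), ?_⟩
    rw [map_add, h.sq_zero, add_zero]
    exact key u hu
  · intro hx
    have := h.sup_eq_top ▸ Submodule.mem_top (x := x)
    obtain ⟨u, hu, _, ⟨v, hv, rfl⟩, rfl⟩ := Submodule.mem_sup.1 this
    rw [supOn_eq]
    refine Submodule.add_mem_sup (h.mem_biSup hu fun i hi => ?_)
      ⟨v, h.mem_biSup hv fun i hi => ?_, rfl⟩
    · have := (hx i hi).2
      rwa [map_add, h.sq_zero, add_zero] at this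
    · exact (Submodule.add_mem_iff_right _ (h.mem_iSup_ker hu i)).1 (hx i hi).1

theorem supOn_inf (K K' : Set ι) : supOn t X K ⊓ supOn t X K' = supOn t X (K ∩ K') := by
  ext x
  rw [Submodule.mem_inf, h.mem_supOn, h.mem_supOn, h.mem_supOn]
  constructor
  · rintro ⟨h1, h2⟩ i hi
    by_cases hK : i ∈ K
    · exact h2 i fun hK' => hi ⟨hK, hK'⟩
    · exact h1 i hK
  · exact fun h1 => ⟨fun i hi => h1 i fun h => hi h.1, fun i hi => h1 i fun h => hi h.2⟩

theorem supOn_univ : supOn t X Set.univ = ⊤ :=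
  eq_top_iff.2 fun _ _ => h.mem_supOn.2 fun _ hi => absurd trivial hi

theorem supOn_disjoint {K K' : Set ι} (hK : Disjoint K K') :
    Disjoint (supOn t X K) (supOn t X K') := by
  rw [disjoint_iff, h.supOn_inf, Set.disjoint_iff_inter_eq_empty.1 hK]
  simp [supOn]

theorem injOn : Set.InjOn t (⨆ i, X i : Submodule R M) := by
  intro x hx y hy e
  -- With no index admitted, the conclusion places `x - y` in the empty sum.
  have := h.mem_biSup (K := ∅) (sub_mem hx hy) fun i _ => by
    rw [map_sub, e, sub_self]; exact zero_mem _
  simpa [sub_eq_zero] using this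

theorem isCompl : IsCompl (⨆ i, X i) ((⨆ i, X i).map t) := by
  refine ⟨Submodule.disjoint_def.2 ?_, codisjoint_iff.2 h.sup_eq_top⟩
  rintro _ hx ⟨y, hy, rfl⟩
  exact h.injOn hx (zero_mem _) (by rw [h.sq_zero, map_zero])

/-- The grading by the values of a weight function. -/
theorem isInternal {κ : Type*} [DecidableEq κ] (w : ι → κ) :
    DirectSum.IsInternal fun a => supOn t X {i | w i = a} := by
  rw [DirectSum.isInternal_submodule_iff_iSupIndep_and_iSup_eq_top]
  constructor
  · intro a
    refine (h.supOn_disjoint (K := {i | w i = a}) (K' := {i | w i ≠ a})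
      (Set.disjoint_left.2 fun i hi hi' => hi' hi)).mono_right (iSup₂_le fun b hb => ?_)
    exact supOn_mono fun i (hi : w i = b) => (hi.trans_ne hb : w i ≠ a)
  · refine eq_top_iff.2 (h.supOn_univ ▸ iSup₂_le fun i _ => ?_)
    exact le_iSup_of_le (w i) (le_biSup (fun i => X i ⊔ (X i).map t) (rfl : w i = w i))

omit h in
theorem iSup_supOn {κ : Type*} (w : ι → κ) (p : κ → Prop) :
    ⨆ (a : κ) (_ : p a), supOn t X {i | w i = a} = supOn t X {i | p (w i)} := by
  refine le_antisymm (iSup₂_le fun a ha => supOn_mono fun i (hi : w i = a) => ?_)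
    (iSup₂_le fun i hi => ?_)
  · exact (hi ▸ ha : p (w i))
  · exact le_iSup₂_of_le (w i) hi (le_biSup (fun i => X i ⊔ (X i).map t) (rfl : w i = w i))

theorem indep : iSupIndep X := fun i => by
  refine (h.supOn_disjoint (K := {i}) (K' := {j | j ≠ i})
    (Set.disjoint_left.2 fun j hj hj' => hj' hj)).mono ?_ (iSup₂_le fun j hj => ?_)
  · exact le_sup_left.trans (le_biSup (fun i => X i ⊔ (X i).map t) rfl)
  · exact le_sup_left.trans (le_biSup (fun i => X i ⊔ (X i).map t) hj)

theorem free_biSup (K : Set ι) (hX : ∀ i, Module.Free R (X i)) :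
    Module.Free R (⨆ i ∈ K, X i : Submodule R M) := by
  classical
  have hind : iSupIndep fun i : K => X i := h.indep.comp Subtype.val_injective
  rw [iSup_subtype', Submodule.iSup_eq_range_dfinsupp_lsum]
  exact Module.Free.of_equiv (LinearEquiv.ofInjective _ hind.dfinsupp_lsum_injective)

end IsSeparated

section

variable {A : Type*} [CommRing A] [Algebra ℝ A] {W : Type*} [AddCommGroup W] [Module A W]
  {c : Set (LinearMap.BilinForm A W)} {θ : Module.Basis (Fin 4) A W}

/-! ### Freeness over the exterior algebra in `θ_0` -/

omit [Algebra ℝ A] in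
theorem th0_mul_self : th0 θ * th0 θ = 0 := ExteriorAlgebra.ι_sq_zero _

theorem mulTh0_apply (x : E c) : mulTh0 c θ x = th0 θ • x := rfl

theorem mulTh0_mulTh0 (x : E c) : mulTh0 c θ (mulTh0 c θ x) = 0 := by
  rw [mulTh0_apply, mulTh0_apply, smul_smul, th0_mul_self, zero_smul]

omit [Algebra ℝ A] in
theorem exists_of_mem_adjoin_th0 {b : ExteriorAlgebra A W} (hb : b ∈ Algebra.adjoin A {th0 θ}) :
    ∃ r s : A, b = algebraMap A _ r + s • th0 θ := by
  induction hb using Algebra.adjoin_induction with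
  | mem x hx => exact ⟨0, 1, by rw [Set.mem_singleton_iff.1 hx]; simp⟩
  | algebraMap r => exact ⟨r, 0, by simp⟩
  | add x y _ _ hx hy =>
    obtain ⟨r, s, rfl⟩ := hx
    obtain ⟨r', s', rfl⟩ := hy
    exact ⟨r + r', s + s', by rw [map_add, add_smul]; abel⟩
  | mul x y _ _ hx hy =>
    obtain ⟨r, s, rfl⟩ := hx
    obtain ⟨r', s', rfl⟩ := hy
    refine ⟨r * r', r * s' + s * r', ?_⟩
    have e1 : s • th0 θ * algebraMap A _ r' = (s * r') • th0 θ := by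
      rw [← Algebra.commutes, ← Algebra.smul_def, smul_smul, mul_comm]
    have e2 : algebraMap A _ r * s' • th0 θ = (r * s') • th0 θ := by
      rw [← Algebra.smul_def, smul_smul]
    rw [add_mul, mul_add, mul_add, e1, e2, smul_mul_smul_comm, th0_mul_self, smul_zero, add_zero,
      map_mul, add_smul, add_assoc]

theorem add_smul_th0_smul (r s : A) (x : E c) :
    (algebraMap A (ExteriorAlgebra A W) r + s • th0 θ) • x = r • x + mulTh0 c θ (s • x) := by
  rw [add_smul, algebraMap_smul, map_smul, mulTh0_apply, smul_assoc]

/-- The sum of `N` and `θ_0 N`, as a module over the exterior algebra in `θ_0`. -/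
noncomputable def th0Span (θ : Module.Basis (Fin 4) A W) (N : Submodule A (E c)) :
    Submodule (Algebra.adjoin A {th0 θ}) (E c) where
  carrier := (N ⊔ N.map (mulTh0 c θ) : Submodule A (E c))
  add_mem' := add_mem
  zero_mem' := zero_mem _
  smul_mem' := by
    rintro ⟨b, hb⟩ x hx
    obtain ⟨r, s, rfl⟩ := exists_of_mem_adjoin_th0 hb
    obtain ⟨u, hu, _, ⟨v, hv, rfl⟩, rfl⟩ := Submodule.mem_sup.1 hx
    change (algebraMap A (ExteriorAlgebra A W) r + s • th0 θ) • (u + mulTh0 c θ v) ∈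
      N ⊔ N.map (mulTh0 c θ)
    have e : mulTh0 c θ (u + mulTh0 c θ v) = mulTh0 c θ u := by
      rw [map_add, mulTh0_mulTh0, add_zero]
    rw [add_smul_th0_smul, map_smul (mulTh0 c θ) s, e]
    exact add_mem (Submodule.smul_mem _ r hx)
      (Submodule.smul_mem _ s (Submodule.mem_sup_right ⟨u, hu, rfl⟩))

/-- An `A`-basis of `N` stays a basis over `A ⊕ A θ_0`. A relation with coefficients `r + s θ_0`
splits into its parts in `N` and in `θ_0 N`, and `θ_0` is injective on `N`. -/
theorem isFreeOverTh0_sup {N : Submodule A (E c)} [Module.Free A N]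
    (hd : Disjoint N (N.map (mulTh0 c θ))) (hi : Set.InjOn (mulTh0 c θ) N) :
    IsFreeOverTh0 θ (N ⊔ N.map (mulTh0 c θ)) := by
  refine ⟨th0Span θ N, rfl, ?_⟩
  let e := Module.Free.chooseBasis A N
  let v : Module.Free.ChooseBasisIndex A N → th0Span θ N := fun i =>
    ⟨e i, Submodule.mem_sup_left (e i).2⟩
  have hli : LinearIndependent (Algebra.adjoin A {th0 θ}) v := by
    rw [linearIndependent_iff']
    intro s f hf
    choose r r' hr using fun i => exists_of_mem_adjoin_th0 (f i).2
    -- The relation, sorted into the two summands that `hd` separates.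
    have hsum : (∑ i ∈ s, r i • e i : N).1 + mulTh0 c θ (∑ i ∈ s, r' i • e i : N).1 = 0 := by
      have h1 := congrArg Subtype.val hf
      rw [← Submodule.subtype_apply, map_sum] at h1
      rw [← Submodule.subtype_apply, ← Submodule.subtype_apply, map_sum, map_sum, map_sum,
        ← Finset.sum_add_distrib]
      refine Eq.trans (Finset.sum_congr rfl fun i _ => ?_) h1
      change r i • (e i : E c) + mulTh0 c θ (r' i • (e i : E c)) = (f i).1 • (e i : E c)
      rw [hr i, add_smul_th0_smul]
    have h1 : (∑ i ∈ s, r i • e i : N).1 = 0 := by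
      refine Submodule.disjoint_def.1 hd _ (Subtype.property _) ?_
      rw [eq_neg_of_add_eq_zero_left hsum]
      exact neg_mem ⟨_, Subtype.property _, rfl⟩
    have h2 : (∑ i ∈ s, r' i • e i : N).1 = 0 := by
      refine hi (Subtype.property _) (zero_mem N) ?_
      rw [map_zero]
      rwa [h1, zero_add] at hsum
    have k1 := linearIndependent_iff'.1 e.linearIndependent s r (Subtype.ext h1)
    have k2 := linearIndependent_iff'.1 e.linearIndependent s r' (Subtype.ext h2)
    intro i hi
    refine Subtype.ext ?_
    rw [hr i, k1 i hi, k2 i hi, map_zero, zero_smul, add_zero]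
    rfl
  have hsp : ⊤ ≤ Submodule.span (Algebra.adjoin A {th0 θ}) (Set.range v) := by
    have key : ∀ u : N, (⟨u, Submodule.mem_sup_left u.2⟩ : th0Span θ N) ∈
        Submodule.span (Algebra.adjoin A {th0 θ}) (Set.range v) := by
      intro u
      have hu := e.mem_span u
      induction hu using Submodule.span_induction with
      | mem x hx =>
        obtain ⟨i, rfl⟩ := hx
        exact Submodule.subset_span ⟨i, rfl⟩
      | zero => exact zero_mem _
      | add x y _ _ hx hy => exact add_mem hx hy
      | smul r x _ hx =>
        have := Submodule.smul_mem _ (algebraMap A (Algebra.adjoin A {th0 θ}) r) hx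
        convert this using 1
        refine Subtype.ext ?_
        change r • (x : E c) = algebraMap A (ExteriorAlgebra A W) r • (x : E c)
        rw [algebraMap_smul]
    rintro ⟨x, hx⟩ -
    obtain ⟨u, hu, _, ⟨w, hw, rfl⟩, rfl⟩ := Submodule.mem_sup.1 hx
    have := add_mem (key ⟨u, hu⟩) (Submodule.smul_mem _
      (⟨th0 θ, Algebra.subset_adjoin rfl⟩ : Algebra.adjoin A {th0 θ}) (key ⟨w, hw⟩))
    exact this
  exact Module.Free.of_basis (Module.Basis.mk hli hsp)

end

/-! ### The explicit decomposition of `ℰ` -/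

/-- The monomials in `θ_1, θ_2, θ_3`. -/
def derMask : Fin 8 → Fin 16 := ![0, 2, 4, 6, 8, 10, 12, 14]

/-- The weights of the components of `ℰ_G`: the generators, and the derivations times a monomial in
`θ_1, θ_2, θ_3`. -/
def weight : Fin 40 ⊕ Fin 8 → ℕ × ℕ × ℕ :=
  Sum.elim genWeight ![(0, 0, 0), (0, 1, 1), (1, 0, 1), (1, 1, 2), (1, 1, 0), (1, 2, 1), (2, 1, 1),
    (2, 2, 2)]

theorem derMask_ne : ∀ s s', derMask s ≠ derMask s' ^^^ 1 := by decide +kernel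

theorem derMask_injective : ∀ s s', derMask s ^^^ 1 = derMask s' ^^^ 1 → s = s' := by
  decide +kernel

theorem wedgeSign_derMask : ∀ s, wedgeSign 1 (derMask s) = 1 ∧ 1 ^^^ derMask s = derMask s ^^^ 1 := by
  decide +kernel

theorem exists_derMask : ∀ S : Fin 16, ∃ s, S = derMask s ∨ S = derMask s ^^^ 1 := by
  decide +kernel

section

variable {A : Type*} [CommRing A] [Algebra ℝ A] {W : Type*} [AddCommGroup W] [Module A W]
  {c : Set (LinearMap.BilinForm A W)} {θ : Module.Basis (Fin 4) A W} (hθ : IsConfFrame c θ)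

/-- The quotient map `ℒ → ℰ`. -/
noncomputable def toE (c : Set (LinearMap.BilinForm A W)) : L c →ₗ[A] E c :=
  (weylIdeal c).mkQ.restrictScalars A

theorem toE_surjective : Function.Surjective (toE c) := (weylIdeal c).mkQ_surjective

theorem toE_mem_map {P : Submodule A (L c)} (hP : ∀ u ∈ weylIdeal c, u ∈ P) {u : L c} :
    toE c u ∈ P.map (toE c) ↔ u ∈ P := by
  refine ⟨?_, fun h => ⟨u, h, rfl⟩⟩
  rintro ⟨v, hv, e⟩
  have : v - u ∈ weylIdeal c := (Submodule.Quotient.eq _).1 e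
  have := sub_mem hv (hP _ this)
  rwa [sub_sub_cancel] at this

theorem toE_smul (w : ExteriorAlgebra A W) (u : L c) : toE c (w • u) = w • toE c u := rfl

/-- The map `D ↦ θ_S D`. -/
noncomputable def derL (S : Fin 16) : Derivation ℝ A A →ₗ[A] L c where
  toFun D := mono θ S ⊗ₜ der hθ D
  map_add' D D' := by rw [der_add, TensorProduct.tmul_add]
  map_smul' f D := by rw [der_smul, TensorProduct.tmul_smul]; rfl

theorem derL_apply (S : Fin 16) (D : Derivation ℝ A A) :
    derL hθ S D = mono θ S ⊗ₜ der hθ D := rfl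

/-- The components of `ℰ_G`, in `ℒ`. -/
noncomputable def XL : Fin 40 ⊕ Fin 8 → Submodule A (L c) :=
  Sum.elim (fun j => Submodule.span A {toL hθ (genTerms j)})
    (fun s => LinearMap.range (derL hθ (derMask s)))

/-- The components of `ℰ_G`. -/
noncomputable def compE (i : Fin 40 ⊕ Fin 8) : Submodule A (E c) := (XL hθ i).map (toE c)

variable (c θ) in
/-- The elements of `ℒ` whose component along `θ_0` times a component of `ℰ_G` vanishes. -/
noncomputable def kerL : Fin 40 ⊕ Fin 8 → Submodule A (L c) :=
  Sum.elim (fun j => LinearMap.ker (evalTerms c θ (dualTerms j)))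
    (fun s => LinearMap.ker (derComp c θ (derMask s ^^^ 1)))

variable (c θ) in
/-- The elements of `ℰ` whose component along `θ_0` times a component of `ℰ_G` vanishes. -/
noncomputable def kerE (i : Fin 40 ⊕ Fin 8) : Submodule A (E c) := (kerL c θ i).map (toE c)

include hθ in
-- The kernels contain the ideal: the dual functionals vanish on it, and since it acts trivially its
-- elements have no derivation components.
theorem toE_mem_kerE {i : Fin 40 ⊕ Fin 8} {u : L c} : toE c u ∈ kerE c θ i ↔ u ∈ kerL c θ i := by
  refine toE_mem_map fun u hu => ?_
  rcases i with j | s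
  · exact evalTerms_dual_weylIdeal hθ j hu
  · exact derComp_eq_zero hθ (repL_weylIdeal hu) _

theorem XL_le_kerL (i j : Fin 40 ⊕ Fin 8) : XL hθ j ≤ kerL c θ i := by
  rcases j with j | s
  · refine (Submodule.span_singleton_le_iff_mem _ _).2 ?_
    rcases i with i | s
    · change evalTerms c θ _ _ = 0
      rw [evalTerms_toL, pair_dual_gen, Int.cast_zero]
    · exact derComp_toL hθ _ _
  · rintro _ ⟨D, rfl⟩
    rcases i with i | s'
    · exact evalTerms_der hθ _ _ D
    · change derComp c θ _ _ = 0
      rw [derL_apply, derComp_tmul, monoBasis_repr_mono, if_neg (derMask_ne s s'), zero_smul]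

theorem mono_one_smul_derL (s : Fin 8) (D : Derivation ℝ A A) :
    mono θ 1 • derL hθ (derMask s) D = derL hθ (derMask s ^^^ 1) D := by
  rw [derL_apply, TensorProduct.smul_tmul', smul_eq_mul, mono_mul, (wedgeSign_derMask s).1,
    (wedgeSign_derMask s).2, one_smul]
  rfl

theorem smul_XL_mem_kerL {i j : Fin 40 ⊕ Fin 8} (hij : i ≠ j) {u : L c} (hu : u ∈ XL hθ j) :
    mono θ 1 • u ∈ kerL c θ i := by
  rcases j with j | s
  · obtain ⟨f, rfl⟩ := Submodule.mem_span_singleton.1 hu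
    rw [smul_comm]
    refine Submodule.smul_mem _ f ?_
    rw [← toL_mulTerms]
    rcases i with i | s
    · change evalTerms c θ _ _ = 0
      rw [evalTerms_toL, pair_dual_mul_gen, if_neg fun h => hij (congrArg Sum.inl h),
        Int.cast_zero]
    · exact derComp_toL hθ _ _
  · obtain ⟨D, rfl⟩ := hu
    rw [mono_one_smul_derL]
    rcases i with i | s'
    · exact evalTerms_der hθ _ _ D
    · change derComp c θ _ _ = 0
      rw [derL_apply, derComp_tmul, monoBasis_repr_mono,
        if_neg fun h => hij (congrArg Sum.inr (derMask_injective s s' h).symm), zero_smul]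

/-- For a generator, the pairing with its own dual functional is 6, which is invertible. For `θ_S D`
with `0 ∉ S`, the component of `θ_0 θ_S D` along `θ_0 θ_S` is `D` itself. -/
theorem eq_zero_of_mem_XL {i : Fin 40 ⊕ Fin 8} {u : L c} (hu : u ∈ XL hθ i)
    (h : mono θ 1 • u ∈ kerL c θ i) : u = 0 := by
  rcases i with j | s
  · obtain ⟨f, rfl⟩ := Submodule.mem_span_singleton.1 hu
    change evalTerms c θ _ _ = 0 at h
    rw [smul_comm, ← toL_mulTerms, map_smul, evalTerms_toL, pair_dual_mul_gen, if_pos rfl,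
      smul_eq_mul, mul_comm, ← zsmul_eq_mul] at h
    rw [zsmul_cancel (A := A) (n := 6) (by norm_num) h, zero_smul]
  · obtain ⟨D, rfl⟩ := hu
    change derComp c θ _ _ = 0 at h
    rw [mono_one_smul_derL, derL_apply, derComp_tmul, monoBasis_repr_mono, if_pos rfl,
      one_smul] at h
    change D = 0 at h
    rw [h, map_zero]

theorem toE_toL_genTerms_mem (j : Fin 40) : toE c (toL hθ (genTerms j)) ∈ compE hθ (Sum.inl j) :=
  ⟨_, Submodule.subset_span rfl, rfl⟩

theorem mem_of_six_smul {N : Type*} [AddCommGroup N] [Module A N] {P : Submodule A N} {x : N}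
    (h : (6 : ℤ) • x ∈ P) : x ∈ P := by
  have := P.smul_mem (algebraMap ℝ A 6⁻¹) h
  rwa [← Int.cast_smul_eq_zsmul A, smul_smul,
    show ((6 : ℤ) : A) = algebraMap ℝ A 6 by rw [map_ofNat, Int.cast_ofNat], ← map_mul, inv_mul_cancel₀ (by norm_num),
    map_one, one_smul] at this

/-- The terms `θ_S D` are covered according to whether `S` contains 0. For `θ_S σ_a` the resolution
applies: its last 32 entries lie in the ideal and vanish in `ℰ`. -/
theorem sup_compE_eq_top :
    (⨆ i, compE hθ i) ⊔ (⨆ i, compE hθ i).map (mulTh0 c θ) = ⊤ := by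
  set P := (⨆ i, compE hθ i) ⊔ (⨆ i, compE hθ i).map (mulTh0 c θ) with hP
  have h0 : ∀ i, ∀ u ∈ XL hθ i, toE c u ∈ ⨆ i, compE hθ i := fun i u hu =>
    Submodule.mem_iSup_of_mem i ⟨u, hu, rfl⟩
  have h1 : ∀ i, ∀ u ∈ XL hθ i, toE c (mono θ 1 • u) ∈ P := fun i u hu => by
    refine Submodule.mem_sup_right ⟨_, h0 i u hu, ?_⟩
    rw [toE_smul, show mono θ 1 = th0 θ from mono_bit θ 0]
    rfl
  have hR : ∀ r ∈ genResolution, toE c (toL hθ r.2) ∈ P := by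
    intro r hr
    rw [genResolution, List.mem_append, List.mem_append, List.mem_map, List.mem_map,
      List.mem_map] at hr
    rcases hr with (⟨j, -, rfl⟩ | ⟨j, -, rfl⟩) | ⟨m, -, rfl⟩
    · exact Submodule.mem_sup_left (h0 (Sum.inl j) _ (Submodule.subset_span rfl))
    · simp only [toL_mulTerms]
      exact h1 (Sum.inl j) _ (Submodule.subset_span rfl)
    · simp only [toL_mulTerms]
      have : mono θ (relIdx m).1 • toL hθ (weylTerms (relIdx m).2) ∈ weylIdeal c :=
        Submodule.smul_mem _ _ (Submodule.subset_span (toL_weylTerms_mem hθ _))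
      rw [show toE c _ = 0 from (Submodule.Quotient.mk_eq_zero _).2 this]
      exact zero_mem _
  refine eq_top_iff.2 fun e _ => ?_
  obtain ⟨u, rfl⟩ := toE_surjective e
  rw [eq_sum_coef hθ u, map_add, map_sum, map_sum]
  refine add_mem (sum_mem fun S _ => ?_) (sum_mem fun k _ => ?_)
  · change toE c (derL hθ S _) ∈ P
    obtain ⟨s, rfl | rfl⟩ := exists_derMask S
    · exact Submodule.mem_sup_left (h0 (Sum.inr s) _ ⟨_, rfl⟩)
    · rw [← mono_one_smul_derL]
      exact h1 (Sum.inr s) _ ⟨_, rfl⟩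
  · rw [map_smul]
    refine P.smul_mem _ (mem_of_six_smul ?_)
    rw [← map_zsmul, six_smul_elt hθ (isSixAt_genResolution k.1 k.2), map_list_sum, List.map_map]
    refine list_sum_mem fun x hx => ?_
    obtain ⟨r, hr, rfl⟩ := List.mem_map.1 hx
    rw [Function.comp_apply, map_zsmul]
    exact zsmul_mem (hR r hr) _

/-- The interface between the tables and the rest: direct sums, intersections and freeness in `ℰ`
are derived from this by bookkeeping with weights. -/
theorem isSeparated_compE : IsSeparated (mulTh0 c θ) (compE hθ) (kerE c θ) where
  sq_zero := mulTh0_mulTh0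
  le_ker i j := by
    rintro _ ⟨u, hu, rfl⟩
    exact ⟨u, XL_le_kerL hθ i j hu, rfl⟩
  map_le_ker i j hij := by
    rintro _ ⟨_, ⟨u, hu, rfl⟩, rfl⟩
    exact ⟨_, smul_XL_mem_kerL hθ hij hu, by rw [show mono θ 1 = th0 θ from mono_bit θ 0]; rfl⟩
  eq_zero i := by
    rintro _ ⟨u, hu, rfl⟩ h
    rw [mulTh0_apply, ← toE_smul, ← show mono θ 1 = th0 θ from mono_bit θ 0,
      toE_mem_kerE hθ] at h
    rw [eq_zero_of_mem_XL hθ hu h, map_zero]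
  sup_eq_top := sup_compE_eq_top hθ

end

/-! ### The graded pieces `G_α ℰ` as sums of components -/

section

variable {A : Type*} [CommRing A] [Algebra ℝ A] {W : Type*} [AddCommGroup W] [Module A W]
  {c : Set (LinearMap.BilinForm A W)} {θ : Module.Basis (Fin 4) A W} (hθ : IsConfFrame c θ)

theorem genE_mem_gens (j : Fin 40) : genE hθ j ∈ gens hθ (genWeight j) := by
  obtain ⟨g1, g2, g3, g4, g5, g6, g7, g8, g9, g10, g11⟩ := gens_eq hθ
  fin_cases j <;>
    first
      | (change _ ∈ gen000 hθ; rw [g1]; simp)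
      | (change _ ∈ gen200 hθ 0 1 2; rw [g2]; simp)
      | (change _ ∈ gen200 hθ 1 2 0; rw [g3]; simp)
      | (change _ ∈ gen200 hθ 2 0 1; rw [g4]; simp)
      | (change _ ∈ gen011 hθ 0 1 2; rw [g5]; simp)
      | (change _ ∈ gen011 hθ 1 2 0; rw [g6]; simp)
      | (change _ ∈ gen011 hθ 2 0 1; rw [g7]; simp)
      | (change _ ∈ gen211 hθ 0 1 2; rw [g8]; simp)
      | (change _ ∈ gen211 hθ 1 2 0; rw [g9]; simp)
      | (change _ ∈ gen211 hθ 2 0 1; rw [g10]; simp)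
      | (change _ ∈ gen222 hθ; rw [g11]; simp)

theorem derSet_subset_gens (s : Fin 8) :
    derSet hθ (mono θ (derMask s)) ⊆ gens hθ (weight (Sum.inr s)) := by
  obtain ⟨g1, g2, g3, g4, g5, g6, g7, g8, g9, g10, g11⟩ := gens_eq hθ
  fin_cases s
  · change _ ⊆ gen000 hθ; rw [g1]; exact Set.subset_union_left
  · change _ ⊆ gen011 hθ 0 1 2; rw [g5]; exact Set.subset_union_left
  · change _ ⊆ gen011 hθ 1 2 0; rw [g6]; exact Set.subset_union_left
  · change _ ⊆ gen211 hθ 2 0 1; rw [g10]; exact Set.subset_union_left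
  · change _ ⊆ gen011 hθ 2 0 1; rw [g7]; exact Set.subset_union_left
  · change _ ⊆ gen211 hθ 1 2 0; rw [g9]; exact Set.subset_union_left
  · change _ ⊆ gen211 hθ 0 1 2; rw [g8]; exact Set.subset_union_left
  · change _ ⊆ gen222 hθ; rw [g11]; exact Set.subset_union_left

theorem mem_gens {α : ℕ × ℕ × ℕ} {e : E c} (he : e ∈ gens hθ α) :
    (∃ j, genWeight j = α ∧ e = genE hθ j) ∨
      ∃ s, weight (Sum.inr s) = α ∧ e ∈ derSet hθ (mono θ (derMask s)) := by
  obtain ⟨g1, g2, g3, g4, g5, g6, g7, g8, g9, g10, g11⟩ := gens_eq hθ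
  unfold gens at he
  split at he
  · rw [g1] at he
    rcases he with he | rfl | rfl | rfl | rfl | rfl
    · exact Or.inr ⟨0, rfl, he⟩
    all_goals exact Or.inl ⟨_, rfl, rfl⟩
  · rw [g2] at he; exact Or.inl ⟨_, rfl, he⟩
  · rw [g3] at he; exact Or.inl ⟨_, rfl, he⟩
  · rw [g4] at he; exact Or.inl ⟨_, rfl, he⟩
  · rw [g5] at he
    rcases he with he | rfl | rfl | rfl | rfl | rfl | rfl | rfl
    · exact Or.inr ⟨1, rfl, he⟩
    all_goals exact Or.inl ⟨_, rfl, rfl⟩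
  · rw [g6] at he
    rcases he with he | rfl | rfl | rfl | rfl | rfl | rfl | rfl
    · exact Or.inr ⟨2, rfl, he⟩
    all_goals exact Or.inl ⟨_, rfl, rfl⟩
  · rw [g7] at he
    rcases he with he | rfl | rfl | rfl | rfl | rfl | rfl | rfl
    · exact Or.inr ⟨4, rfl, he⟩
    all_goals exact Or.inl ⟨_, rfl, rfl⟩
  · rw [g8] at he
    rcases he with he | rfl | rfl | rfl
    · exact Or.inr ⟨6, rfl, he⟩
    all_goals exact Or.inl ⟨_, rfl, rfl⟩
  · rw [g9] at he
    rcases he with he | rfl | rfl | rfl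
    · exact Or.inr ⟨5, rfl, he⟩
    all_goals exact Or.inl ⟨_, rfl, rfl⟩
  · rw [g10] at he
    rcases he with he | rfl | rfl | rfl
    · exact Or.inr ⟨3, rfl, he⟩
    all_goals exact Or.inl ⟨_, rfl, rfl⟩
  · rw [g11] at he
    rcases he with he | rfl | rfl
    · exact Or.inr ⟨7, rfl, he⟩
    all_goals exact Or.inl ⟨_, rfl, rfl⟩
  · exact he.elim

/-- Replaces the tabulated generating sets by the weight function on the 48 components. -/
theorem GG_eq (α : ℕ × ℕ × ℕ) : GG hθ α = ⨆ i ∈ {i | weight i = α}, compE hθ i := by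
  refine le_antisymm (Submodule.span_le.2 fun e he => ?_) (iSup₂_le ?_)
  · rcases mem_gens hθ he with ⟨j, hj, rfl⟩ | ⟨s, hs, D, rfl⟩
    · exact le_biSup (compE hθ) (i := Sum.inl j) hj (toE_toL_genTerms_mem hθ j)
    · exact le_biSup (compE hθ) (i := Sum.inr s) hs ⟨_, ⟨D, rfl⟩, rfl⟩
  · rintro (j | s) rfl
    · rw [compE, Submodule.map_le_iff_le_comap]
      exact (Submodule.span_singleton_le_iff_mem _ _).2 (Submodule.subset_span (genE_mem_gens hθ j))
    · rintro _ ⟨_, ⟨D, rfl⟩, rfl⟩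
      exact Submodule.subset_span (derSet_subset_gens hθ s ⟨D, rfl⟩)

theorem EG_eq : EG hθ = ⨆ i, compE hθ i := by
  rw [EG]
  simp only [GG_eq]
  refine le_antisymm (iSup_le fun α => iSup₂_le fun i _ => le_iSup _ i)
    (iSup_le fun i => le_iSup_of_le (weight i) (le_biSup (compE hθ) rfl))

variable (θ) in
/-- The sum of the components with indices in `K`, and their products with `θ_0`. -/
noncomputable abbrev sumE (K : Set (Fin 40 ⊕ Fin 8)) : Submodule A (E c) :=
  IsSeparated.supOn (mulTh0 c θ) (compE hθ) K

theorem G_eq (α : ℕ × ℕ × ℕ) : G hθ α = sumE θ hθ {i | weight i = α} := by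
  rw [G, GG_eq, sumE, IsSeparated.supOn_eq]

theorem iSup_G (p : ℕ × ℕ × ℕ → Prop) :
    ⨆ (α : ℕ × ℕ × ℕ) (_ : p α), G hθ α = sumE θ hθ {i | p (weight i)} := by
  simp only [G_eq]
  exact IsSeparated.iSup_supOn weight p

/-- A component injects into `ℰ`, because its elements are recognised by functionals that factor
through the quotient. -/
theorem free_compE_of_range {N : Type*} [AddCommGroup N] [Module A N] [Module.Free A N]
    (f : N →ₗ[A] L c) (hf : ∀ x, f x = 0 → x = 0) {i : Fin 40 ⊕ Fin 8}
    (e : XL hθ i = LinearMap.range f) : Module.Free A (compE hθ i) := by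
  rw [compE, e, ← LinearMap.range_comp]
  refine Module.Free.of_equiv (LinearEquiv.ofInjective (toE c ∘ₗ f)
    ((injective_iff_map_eq_zero _).2 fun x hx => hf x ?_))
  -- If `f x` lies in the ideal, then so does `θ_0 (f x)`, and the `i`-th functional vanishes there.
  refine eq_zero_of_mem_XL hθ (i := i) (e ▸ ⟨x, rfl⟩) ?_
  rw [← toE_mem_kerE hθ, toE_smul]
  change mono θ 1 • (toE c ∘ₗ f) x ∈ _
  rw [hx, smul_zero]
  exact zero_mem _

theorem free_compE [Module.Free A (Derivation ℝ A A)] (i : Fin 40 ⊕ Fin 8) :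
    Module.Free A (compE hθ i) := by
  rcases i with j | s
  · refine free_compE_of_range hθ (LinearMap.toSpanSingleton A (L c) (toL hθ (genTerms j)))
      (fun x hx => ?_) (LinearMap.range_toSpanSingleton _).symm
    have h := congrArg (fun u => evalTerms c θ (dualTerms j) (mono θ 1 • u)) hx
    simp only [LinearMap.toSpanSingleton_apply] at h
    rw [smul_comm, ← toL_mulTerms, map_smul, evalTerms_toL, pair_dual_mul_gen, if_pos rfl,
      smul_eq_mul, mul_comm, ← zsmul_eq_mul, smul_zero, map_zero] at h
    exact zsmul_cancel (A := A) (n := 6) (by norm_num) h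
  · refine free_compE_of_range hθ (derL hθ (derMask s)) (fun D hD => ?_) rfl
    have h := congrArg (derComp c θ (derMask s)) hD
    rw [derL_apply, derComp_tmul, monoBasis_repr_mono, if_pos rfl, one_smul, map_zero] at h
    exact h

theorem isFreeOverTh0_sumE [Module.Free A (Derivation ℝ A A)] (K : Set (Fin 40 ⊕ Fin 8)) :
    IsFreeOverTh0 θ (sumE θ hθ K) := by
  have h := isSeparated_compE hθ
  have hle : ⨆ i ∈ K, compE hθ i ≤ ⨆ i, compE hθ i := iSup₂_le_iSup _ _
  have := h.free_biSup K (free_compE hθ)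
  rw [sumE, IsSeparated.supOn_eq]
  exact isFreeOverTh0_sup (h.isCompl.disjoint.mono hle (Submodule.map_mono hle))
    (h.injOn.mono hle)

end

/-! ### Filtrations defined by a weight -/

section

variable {A : Type*} [CommRing A] {X : Type*} [AddCommGroup X] [Module A X]

theorem isGradedSubspace_of_le {𝒜 : ℕ → Submodule A X} {S : Submodule A X} {n : ℕ} (h : S ≤ 𝒜 n) :
    IsGradedSubspace 𝒜 S :=
  le_antisymm (le_iSup_of_le n (le_inf le_rfl h)) (iSup_le fun _ => inf_le_left)

theorem isGradedSubspace_iSup {𝒜 : ℕ → Submodule A X} {κ : Sort*} {S : κ → Submodule A X}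
    (h : ∀ i, IsGradedSubspace 𝒜 (S i)) : IsGradedSubspace 𝒜 (⨆ i, S i) := by
  refine le_antisymm (iSup_le fun i => ?_) (iSup_le fun _ => inf_le_left)
  rw [h i]
  exact iSup_mono fun n => inf_le_inf_right _ (h i ▸ le_iSup S i)

/-- A family of submodules indexed by the subsets of `ι` that respects the Boolean operations. -/
structure IsBooleanFamily {ι : Type*} (S : Set ι → Submodule A X) : Prop where
  inf : ∀ K K', S K ⊓ S K' = S (K ∩ K')
  sup : ∀ K K', S K ⊔ S K' = S (K ∪ K')
  empty : S ∅ = ⊥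
  univ : S Set.univ = ⊤

namespace IsBooleanFamily

variable {ι : Type*} {S : Set ι → Submodule A X} (h : IsBooleanFamily S) (w : ι → ℕ)

theorem map {Y : Type*} [AddCommGroup Y] [Module A Y] (h : IsBooleanFamily S) (e : X ≃ₗ[A] Y) :
    IsBooleanFamily fun K => (S K).map (e : X →ₗ[A] Y) where
  inf K K' := by rw [← h.inf, Submodule.map_inf _ e.injective]
  sup K K' := by rw [← h.sup, Submodule.map_sup]
  empty := by rw [h.empty, Submodule.map_bot]
  univ := by rw [h.univ, Submodule.map_top, LinearEquiv.range]

include h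

theorem mono {K K' : Set ι} (hK : K ⊆ K') : S K ≤ S K' := by
  rw [← Set.union_eq_right.2 hK, ← h.sup]
  exact le_sup_left

/-- An index of weight at most `p + 1` either has the parity of `p + 1`, or has the parity of `p`
and then weight at most `p`. -/
theorem ofLead_eq (p : ℕ) : ofLead (fun p => S {i | w i ≤ p ∧ (w i : ZMod 2) = p}) p =
    S {i | w i ≤ p} := by
  cases p with
  | zero =>
    refine congrArg S (Set.ext fun i => ⟨fun hi => hi.1, fun hi => ⟨hi, ?_⟩⟩)
    rw [Nat.le_zero.1 hi]
  | succ p =>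
    rw [ofLead, h.sup]
    refine congrArg S (Set.ext fun i => ?_)
    simp only [Set.mem_union, Set.mem_ofPred_eq, ZMod.natCast_eq_natCast_iff, Nat.ModEq]
    omega

theorem lead_eq (p : ℕ) :
    lead (fun j => S {i | (w i : ZMod 2) = j})
      (ofLead fun p => S {i | w i ≤ p ∧ (w i : ZMod 2) = p}) p =
    S {i | w i ≤ p ∧ (w i : ZMod 2) = p} := by
  rw [lead, h.ofLead_eq, h.inf]
  rfl

theorem isZ2Filtration {𝒜 : ℕ → Submodule A X} (hg : ∀ K, IsGradedSubspace 𝒜 (S K)) {m : ℕ}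
    (hm : ∀ i, w i ≤ m) :
    IsZ2Filtration 𝒜 (fun j => S {i | (w i : ZMod 2) = j})
      (ofLead fun p => S {i | w i ≤ p ∧ (w i : ZMod 2) = p}) where
  graded_part _ := hg _
  graded p := by rw [h.ofLead_eq]; exact hg _
  isCompl := by
    refine ⟨disjoint_iff.2 ?_, codisjoint_iff.2 ?_⟩
    · rw [h.inf, ← h.empty]
      refine congrArg S (Set.eq_empty_of_forall_notMem ?_)
      rintro i ⟨hi, hi'⟩
      exact zero_ne_one ((hi : (w i : ZMod 2) = 0).symm.trans hi')
    · rw [h.sup, ← h.univ]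
      refine congrArg S (Set.eq_univ_of_forall fun i => ?_)
      have : ∀ z : ZMod 2, z = 0 ∨ z = 1 := by decide
      exact this _
  mono p := by
    rw [h.ofLead_eq, h.ofLead_eq]
    exact h.mono fun i hi => le_trans hi p.le_succ
  exhaust := by
    refine ⟨m, ?_⟩
    rw [h.ofLead_eq, ← h.univ]
    exact congrArg S (Set.eq_univ_of_forall hm)
  split_zero := by rw [h.lead_eq]; rfl
  split_succ p := by rw [h.lead_eq, h.lead_eq]; rfl

end IsBooleanFamily

end

/-! ### The filtration of `∧W` -/

/-- The degree in `θ_2, θ_3` of the monomial `θ_S`. -/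
def deg23 (S : Fin 16) : ℕ := S.val / 4 % 2 + S.val / 8 % 2

theorem deg23_le (S : Fin 16) : deg23 S ≤ 2 := by
  unfold deg23; omega

theorem deg23_xor : ∀ S T, wedgeSign S T = 0 ∨ deg23 (S ^^^ T) = deg23 S + deg23 T := by
  decide +kernel

/-- The masks 3 and 12 select the factors in `W_0` and in `W_1`. The former come first in increasing
order, so no sign arises. -/
theorem mono_split : ∀ S : Fin 16, wedgeSign (S &&& 3) (S &&& 12) = 1 ∧
    (S &&& 3) ^^^ (S &&& 12) = S ∧ deg23 (S &&& 12) = deg23 S ∧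
    (S &&& 3 = 0 ∨ S &&& 3 = 1 ∨ S &&& 3 = 2 ∨ S &&& 3 = 3) ∧
    (S &&& 12 = 0 ∨ S &&& 12 = 4 ∨ S &&& 12 = 8 ∨ S &&& 12 = 12) := by
  decide +kernel

section

variable {A : Type*} [CommRing A] {W : Type*} [AddCommGroup W] [Module A W]
  (θ : Module.Basis (Fin 4) A W)

/-- The span of the monomials with indices in `K`. -/
noncomputable def monoSpan (K : Set (Fin 16)) : Submodule A (ExteriorAlgebra A W) :=
  Submodule.span A (mono θ '' K)

theorem coe_monoBasis : ⇑(monoBasis θ) = mono θ := funext fun S => monoBasis_apply θ S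

theorem mem_monoSpan {K : Set (Fin 16)} {x : ExteriorAlgebra A W} :
    x ∈ monoSpan θ K ↔ ∀ S ∉ K, (monoBasis θ).repr x S = 0 := by
  rw [monoSpan, ← coe_monoBasis, Module.Basis.mem_span_image]
  constructor
  · exact fun h S hS => by_contra fun h' => hS (h (Finsupp.mem_support_iff.2 h'))
  · exact fun h S hS => by_contra fun h' => Finsupp.mem_support_iff.1 hS (h S h')

theorem mono_mem_monoSpan {K : Set (Fin 16)} {S : Fin 16} (h : S ∈ K) : mono θ S ∈ monoSpan θ K :=
  Submodule.subset_span ⟨S, h, rfl⟩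

theorem monoSpan_eq_iSup (K : Set (Fin 16)) :
    monoSpan θ K = ⨆ S ∈ K, Submodule.span A {mono θ S} := by
  rw [monoSpan, Submodule.span_eq_iSup_of_singleton_spans, iSup_image]

theorem isBooleanFamily_monoSpan : IsBooleanFamily (monoSpan θ) where
  inf K K' := by
    ext x
    rw [Submodule.mem_inf, mem_monoSpan, mem_monoSpan, mem_monoSpan]
    constructor
    · rintro ⟨h1, h2⟩ i hi
      by_cases hK : i ∈ K
      · exact h2 i fun hK' => hi ⟨hK, hK'⟩
      · exact h1 i hK
    · exact fun h1 => ⟨fun i hi => h1 i fun h => hi h.1, fun i hi => h1 i fun h => hi h.2⟩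
  sup K K' := by rw [monoSpan, monoSpan, monoSpan, Set.image_union, Submodule.span_union]
  empty := by rw [monoSpan, Set.image_empty, Submodule.span_empty]
  univ := by rw [monoSpan, Set.image_univ, span_range_mono]

theorem isGradedSubspace_monoSpan (K : Set (Fin 16)) :
    IsGradedSubspace (fun n => ⋀[A]^n W) (monoSpan θ K) := by
  rw [monoSpan_eq_iSup]
  refine isGradedSubspace_iSup fun S => isGradedSubspace_iSup fun _ => ?_
  exact isGradedSubspace_of_le (𝒜 := fun n => ⋀[A]^n W) (n := popCount S)
    ((Submodule.span_singleton_le_iff_mem _ _).2 (mono_mem_extPow θ S))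

theorem monoSpan_mul_le (j k : ℕ) :
    monoSpan θ {S | deg23 S = j} * monoSpan θ {S | deg23 S = k} ≤
      monoSpan θ {S | deg23 S = j + k} := by
  rw [monoSpan, monoSpan, Submodule.span_mul_span, Submodule.span_le]
  rintro _ ⟨_, ⟨S, rfl, rfl⟩, _, ⟨T, rfl, rfl⟩, rfl⟩
  change mono θ S * mono θ T ∈ _
  rw [mono_mul]
  rcases deg23_xor S T with h | h
  · rw [h, zero_smul]; exact zero_mem _
  · exact zsmul_mem (mono_mem_monoSpan θ h) _

theorem frameDecomp_zero (a b c d : Fin 4) :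
    frameDecomp θ a b c d 0 = Submodule.span A {θ a, θ b} := if_pos rfl

theorem frameDecomp_one (a b c d : Fin 4) :
    frameDecomp θ a b c d 1 = Submodule.span A {θ c, θ d} := if_neg (by decide)

theorem adjoin_le_monoSpan :
    Subalgebra.toSubmodule (Algebra.adjoin A
      (ExteriorAlgebra.ι A '' (frameDecomp θ 0 1 2 3 0 : Set W))) ≤
      monoSpan θ {S | deg23 S = 0} := by
  intro x hx
  have h1 : (1 : ExteriorAlgebra A W) ∈ monoSpan θ {S | deg23 S = 0} :=
    mono_mem_monoSpan θ (S := 0) rfl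
  rw [Subalgebra.mem_toSubmodule] at hx
  induction hx using Algebra.adjoin_induction with
  | mem x hx =>
    obtain ⟨w, hw, rfl⟩ := hx
    rw [SetLike.mem_coe, frameDecomp_zero] at hw
    induction hw using Submodule.span_induction with
    | mem w hw =>
      rcases hw with rfl | rfl
      · rw [← mono_bit]; exact mono_mem_monoSpan θ rfl
      · rw [← mono_bit]; exact mono_mem_monoSpan θ rfl
    | zero => rw [map_zero]; exact zero_mem _
    | add u v _ _ hu hv => rw [map_add]; exact add_mem hu hv
    | smul r u _ hu => rw [map_smul]; exact Submodule.smul_mem _ r hu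
  | algebraMap r => rw [Algebra.algebraMap_eq_smul_one]; exact Submodule.smul_mem _ r h1
  | add x y _ _ hx hy => exact add_mem hx hy
  | mul x y _ _ hx hy => exact monoSpan_mul_le θ 0 0 (Submodule.mul_mem_mul hx hy)

theorem map_ι_le_monoSpan :
    (frameDecomp θ 0 1 2 3 1).map (ExteriorAlgebra.ι A) ≤ monoSpan θ {S | deg23 S = 1} := by
  rw [frameDecomp_one, Submodule.map_le_iff_le_comap, Submodule.span_le]
  rintro w (rfl | rfl)
  · rw [SetLike.mem_coe, Submodule.mem_comap, ← mono_bit]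
    exact mono_mem_monoSpan θ rfl
  · rw [SetLike.mem_coe, Submodule.mem_comap, ← mono_bit]
    exact mono_mem_monoSpan θ rfl

/-- One inclusion holds because the degree in `θ_2, θ_3` is additive on nonzero products of
monomials; the other splits a monomial into its `W_0` and `W_1` factors. -/
theorem extPiece_eq (k : ℕ) :
    extPiece (frameDecomp θ 0 1 2 3) k = monoSpan θ {S | deg23 S = k} := by
  refine le_antisymm ?_ (Submodule.span_le.2 ?_)
  · have hpow : ∀ k, (frameDecomp θ 0 1 2 3 1).map (ExteriorAlgebra.ι A) ^ k ≤
        monoSpan θ {S | deg23 S = k} := by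
      intro k
      induction k with
      | zero =>
        rw [pow_zero, Submodule.one_le]
        exact mono_mem_monoSpan θ (S := 0) rfl
      | succ k ih =>
        rw [pow_succ]
        exact (mul_le_mul' ih (map_ι_le_monoSpan θ)).trans (monoSpan_mul_le θ k 1)
    have := (mul_le_mul' (adjoin_le_monoSpan θ) (hpow k)).trans (monoSpan_mul_le θ 0 k)
    rwa [zero_add] at this
  · rintro _ ⟨S, rfl, rfl⟩
    obtain ⟨h1, h2, h3, h4, h5⟩ := mono_split S
    have e : mono θ S = mono θ (S &&& 3) * mono θ (S &&& 12) := by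
      rw [mono_mul, h1, h2, one_smul]
    have hι : ∀ i, i = 0 ∨ i = 1 → ExteriorAlgebra.ι A (θ i) ∈ Algebra.adjoin A
        (ExteriorAlgebra.ι A '' (frameDecomp θ 0 1 2 3 0 : Set W)) := fun i hi => by
      refine Algebra.subset_adjoin ⟨θ i, ?_, rfl⟩
      rw [SetLike.mem_coe, frameDecomp_zero]
      rcases hi with rfl | rfl <;> exact Submodule.subset_span (by simp)
    have hι' : ∀ i, i = 2 ∨ i = 3 → ExteriorAlgebra.ι A (θ i) ∈
        (frameDecomp θ 0 1 2 3 1).map (ExteriorAlgebra.ι A) := fun i hi => by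
      refine ⟨θ i, ?_, rfl⟩
      rw [SetLike.mem_coe, frameDecomp_one]
      rcases hi with rfl | rfl <;> exact Submodule.subset_span (by simp)
    have m : ∀ i j T, wedgeSign (bit i) (bit j) = 1 → bit i ^^^ bit j = T →
        mono θ T = ExteriorAlgebra.ι A (θ i) * ExteriorAlgebra.ι A (θ j) := by
      rintro i j _ h rfl
      rw [← mono_bit, ← mono_bit, mono_mul, h, one_smul]
    rw [SetLike.mem_coe, e, ← h3]
    refine Submodule.mul_mem_mul ?_ ?_
    · rw [Subalgebra.mem_toSubmodule]
      rcases h4 with h | h | h | h <;> rw [h]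
      · exact one_mem _
      · rw [show (1 : Fin 16) = bit 0 from rfl, mono_bit]; exact hι 0 (Or.inl rfl)
      · rw [show (2 : Fin 16) = bit 1 from rfl, mono_bit]; exact hι 1 (Or.inr rfl)
      · rw [m 0 1 3 (by decide +kernel) (by decide +kernel)]
        exact mul_mem (hι 0 (Or.inl rfl)) (hι 1 (Or.inr rfl))
    · rcases h5 with h | h | h | h <;> rw [h]
      · rw [show deg23 0 = 0 from rfl, pow_zero]; exact Submodule.one_le.1 le_rfl
      · rw [show deg23 4 = 1 from rfl, pow_one, show (4 : Fin 16) = bit 2 from rfl, mono_bit]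
        exact hι' 2 (Or.inl rfl)
      · rw [show deg23 8 = 1 from rfl, pow_one, show (8 : Fin 16) = bit 3 from rfl, mono_bit]
        exact hι' 3 (Or.inr rfl)
      · rw [m 2 3 12 (by decide +kernel) (by decide +kernel), show deg23 12 = 2 from rfl, pow_two]
        exact Submodule.mul_mem_mul (hι' 2 (Or.inl rfl)) (hι' 3 (Or.inr rfl))

theorem iSup_monoSpan (p : ℕ → Prop) :
    ⨆ (k : ℕ) (_ : p k), monoSpan θ {S | deg23 S = k} = monoSpan θ {S | p (deg23 S)} := by
  refine le_antisymm (iSup₂_le fun k hk => ?_) (Submodule.span_le.2 ?_)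
  · exact (isBooleanFamily_monoSpan θ).mono fun S (hS : deg23 S = k) => (hS ▸ hk : p (deg23 S))
  · rintro _ ⟨S, hS, rfl⟩
    exact Submodule.mem_iSup_of_mem _ (Submodule.mem_iSup_of_mem hS (mono_mem_monoSpan θ rfl))

theorem extPart_eq :
    extPart (frameDecomp θ 0 1 2 3) = fun i => monoSpan θ {S | (deg23 S : ZMod 2) = i} := by
  funext i
  simp only [extPart, extPiece_eq]
  exact iSup_monoSpan θ fun k => (k : ZMod 2) = i

theorem extLead_eq :
    extLead (frameDecomp θ 0 1 2 3) =
      fun p => monoSpan θ {S | deg23 S ≤ p ∧ (deg23 S : ZMod 2) = p} := by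
  funext p
  simp only [extLead, extPiece_eq]
  exact iSup_monoSpan θ fun k => k ≤ p ∧ (k : ZMod 2) = p

end

/-! ### Increasing monomials, minimality of the filtration of `∧W`, and the filtration of `∧W ⊗ Ω`
-/

section

variable {A : Type*} [CommRing A] {W : Type*} [AddCommGroup W] [Module A W]
  (θ : Module.Basis (Fin 4) A W)

/-- The bitmask of a set of indices. -/
def bitmask (s : Finset (Fin 4)) : Fin 16 :=
  ((List.finRange 4).filter (· ∈ s)).foldr (fun i S => bit i ^^^ S) 0

theorem elems_bitmask : ∀ s, elems (bitmask s) = (List.finRange 4).filter (· ∈ s) := by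
  decide +kernel

theorem deg23_bitmask : ∀ s, deg23 (bitmask s) = (s ∩ {2, 3}).card := by decide +kernel

theorem bitmask_surjective : ∀ S, ∃ s, bitmask s = S := by decide +kernel

theorem sort_eq (s : Finset (Fin 4)) :
    s.sort (· ≤ ·) = (List.finRange 4).filter (· ∈ s) := by
  refine List.Perm.eq_of_pairwise (le := (· ≤ ·)) (fun a b _ _ => le_antisymm)
    (s.pairwise_sort (· ≤ ·)) ((List.pairwise_le_finRange 4).filter _) ?_
  refine (List.perm_ext_iff_of_nodup (s.sort_nodup _) ((List.nodup_finRange 4).filter _)).2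
    fun i => ?_
  simp

theorem mono_bitmask (s : Finset (Fin 4)) :
    mono θ (bitmask s) = ((s.sort (· ≤ ·)).map fun i => ExteriorAlgebra.ι A (θ i)).prod := by
  rw [sort_eq, mono, elems_bitmask]

theorem leadMonomials_eq (p : ℕ) :
    leadMonomials θ p = mono θ '' {S | deg23 S ≤ p ∧ (deg23 S : ZMod 2) = p} := by
  ext m
  constructor
  · rintro ⟨s, h1, h2, rfl⟩
    refine ⟨bitmask s, ⟨?_, ?_⟩, mono_bitmask θ s⟩
    · rwa [deg23_bitmask]
    · rw [deg23_bitmask, ZMod.natCast_eq_natCast_iff]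
      exact h2
  · rintro ⟨S, ⟨h1, h2⟩, rfl⟩
    obtain ⟨s, rfl⟩ := bitmask_surjective S
    rw [deg23_bitmask] at h1 h2
    exact ⟨s, h1, (ZMod.natCast_eq_natCast_iff _ _ _).1 h2, mono_bitmask θ s⟩

theorem extLead_eq_span (p : ℕ) :
    extLead (frameDecomp θ 0 1 2 3) p = Submodule.span A (leadMonomials θ p) := by
  rw [extLead_eq, leadMonomials_eq]; rfl

theorem isZ2Filtration_ext :
    IsZ2Filtration (fun n => ⋀[A]^n W) (extPart (frameDecomp θ 0 1 2 3))
      (ofLead (extLead (frameDecomp θ 0 1 2 3))) := by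
  rw [extPart_eq, extLead_eq]
  exact (isBooleanFamily_monoSpan θ).isZ2Filtration deg23 (isGradedSubspace_monoSpan θ) deg23_le

theorem lead_ext (p : ℕ) :
    lead (extPart (frameDecomp θ 0 1 2 3)) (ofLead (extLead (frameDecomp θ 0 1 2 3))) p =
      extLead (frameDecomp θ 0 1 2 3) p := by
  rw [extPart_eq, extLead_eq]
  exact (isBooleanFamily_monoSpan θ).lead_eq deg23 p

theorem ofLead_ext_two : ofLead (extLead (frameDecomp θ 0 1 2 3)) 2 = ⊤ := by
  rw [extLead_eq, (isBooleanFamily_monoSpan θ).ofLead_eq, ← (isBooleanFamily_monoSpan θ).univ]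
  exact congrArg _ (Set.eq_univ_of_forall deg23_le)

theorem extLead_mul_le (p q : ℕ) :
    extLead (frameDecomp θ 0 1 2 3) p * extLead (frameDecomp θ 0 1 2 3) q ≤
      extLead (frameDecomp θ 0 1 2 3) (p + q) := by
  simp only [extLead_eq]
  rw [monoSpan, monoSpan, Submodule.span_mul_span, Submodule.span_le]
  rintro _ ⟨_, ⟨S, ⟨h1, h2⟩, rfl⟩, _, ⟨T, ⟨h3, h4⟩, rfl⟩, rfl⟩
  change mono θ S * mono θ T ∈ _
  rw [mono_mul]
  rcases deg23_xor S T with h | h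
  · rw [h, zero_smul]; exact zero_mem _
  · refine zsmul_mem (mono_mem_monoSpan θ ?_) _
    refine ⟨h ▸ add_le_add h1 h3, ?_⟩
    rw [h, Nat.cast_add, Nat.cast_add, h2, h4]

theorem respectsExt :
    RespectsExt (frameDecomp θ 0 1 2 3) (extPart (frameDecomp θ 0 1 2 3))
      (ofLead (extLead (frameDecomp θ 0 1 2 3))) where
  one_mem := by
    rw [lead_ext, extLead_eq]
    exact mono_mem_monoSpan θ (K := {S | deg23 S ≤ 0 ∧ (deg23 S : ZMod 2) = 0}) (S := 0)
      ⟨le_rfl, rfl⟩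
  mul_mem p q a ha b hb := by
    rw [lead_ext] at ha hb ⊢
    exact extLead_mul_le θ p q (Submodule.mul_mem_mul ha hb)
  ι_zero w hw := by
    rw [lead_ext, extLead_eq]
    refine (isBooleanFamily_monoSpan θ).mono ?_ (adjoin_le_monoSpan θ
      (Algebra.subset_adjoin ⟨w, hw, rfl⟩))
    exact fun S (hS : deg23 S = 0) => ⟨hS.le, by rw [hS]⟩
  ι_one w hw := by
    rw [lead_ext, extLead_eq]
    refine (isBooleanFamily_monoSpan θ).mono ?_ (map_ι_le_monoSpan θ ⟨w, hw, rfl⟩)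
    exact fun S (hS : deg23 S = 1) => ⟨hS.le, by rw [hS]⟩

/-- The filtration of `∧W` is the smallest one that respects the algebra structure. -/
theorem extLead_le {V : ZMod 2 → Submodule A W} {P : ZMod 2 → Submodule A (ExteriorAlgebra A W)}
    {F : ℕ → Submodule A (ExteriorAlgebra A W)} (hF : IsZ2Filtration (fun n => ⋀[A]^n W) P F)
    (h : RespectsExt V P F) (p : ℕ) : extLead V p ≤ lead P F p := by
  have hmul : ∀ p q, lead P F p * lead P F q ≤ lead P F (p + q) := fun p q =>
    Submodule.mul_le.2 (h.mul_mem p q)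
  have h0 : Subalgebra.toSubmodule (Algebra.adjoin A (ExteriorAlgebra.ι A '' (V 0 : Set W))) ≤
      lead P F 0 := by
    intro x hx
    rw [Subalgebra.mem_toSubmodule] at hx
    induction hx using Algebra.adjoin_induction with
    | mem x hx =>
      obtain ⟨w, hw, rfl⟩ := hx
      exact h.ι_zero w hw
    | algebraMap r =>
      rw [Algebra.algebraMap_eq_smul_one]
      exact Submodule.smul_mem _ r h.one_mem
    | add x y _ _ hx hy => exact add_mem hx hy
    | mul x y _ _ hx hy => exact h.mul_mem 0 0 x hx y hy
  have h1 : ∀ k, (V 1).map (ExteriorAlgebra.ι A) ^ k ≤ lead P F k := by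
    intro k
    induction k with
    | zero => rw [pow_zero, Submodule.one_le]; exact h.one_mem
    | succ k ih =>
      rw [pow_succ]
      exact (mul_le_mul' ih (Submodule.map_le_iff_le_comap.2 h.ι_one)).trans (hmul k 1)
  refine iSup₂_le fun k hk => ?_
  have h2 : extPiece V k ≤ lead P F k := by
    have := (mul_le_mul' h0 (h1 k)).trans (hmul 0 k)
    rwa [zero_add] at this
  refine h2.trans (inf_le_inf (monotone_nat_of_le_succ hF.mono hk.1) ?_)
  rw [hk.2]

/-! ### The filtration of `∧W ⊗ Ω` -/

/-- Since `Ω` is free on the volume element, every statement about `S ⊗ Ω` is transported from `∧W`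
along `omEquiv`. -/
theorem tensOm_eq (S : Submodule A (ExteriorAlgebra A W)) :
    tensOm S = S.map (omEquiv θ : ExteriorAlgebra A W →ₗ[A] ExtOm A W) := by
  refine le_antisymm (Submodule.span_le.2 ?_) ?_
  · rintro _ ⟨w, hw, z, rfl⟩
    obtain ⟨f, rfl⟩ := exists_smul_volEl (θ := θ) z
    refine ⟨f • w, S.smul_mem f hw, ?_⟩
    rw [LinearEquiv.coe_coe, omEquiv_apply, TensorProduct.smul_tmul]
  · rintro _ ⟨w, hw, rfl⟩
    exact Submodule.subset_span ⟨w, hw, volEl θ, omEquiv_apply (θ := θ) w⟩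

include θ in
theorem isGradedSubspace_tensOm {S : Submodule A (ExteriorAlgebra A W)}
    (h : IsGradedSubspace (fun n => ⋀[A]^n W) S) :
    IsGradedSubspace (fun n => tensOm (⋀[A]^n W)) (tensOm S) := by
  unfold IsGradedSubspace at h ⊢
  conv_lhs => rw [h]
  simp only [tensOm_eq θ, Submodule.map_iSup, Submodule.map_inf _ (omEquiv θ).injective]

theorem isBooleanFamily_tensOm : IsBooleanFamily fun K => tensOm (monoSpan θ K) := by
  simp only [tensOm_eq θ]
  exact (isBooleanFamily_monoSpan θ).map (omEquiv θ)

theorem isZ2Filtration_tensOm :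
    IsZ2Filtration (fun n => tensOm (⋀[A]^n W))
      (fun i => tensOm (extPart (frameDecomp θ 0 1 2 3) i))
      (ofLead fun p => tensOm (extLead (frameDecomp θ 0 1 2 3) p)) := by
  rw [extPart_eq, extLead_eq]
  exact (isBooleanFamily_tensOm θ).isZ2Filtration deg23
    (fun K => isGradedSubspace_tensOm θ (isGradedSubspace_monoSpan θ K)) deg23_le

theorem lead_tensOm (p : ℕ) :
    lead (fun i => tensOm (extPart (frameDecomp θ 0 1 2 3) i))
      (ofLead fun p => tensOm (extLead (frameDecomp θ 0 1 2 3) p)) p =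
      tensOm (extLead (frameDecomp θ 0 1 2 3) p) := by
  rw [extPart_eq, extLead_eq]
  exact (isBooleanFamily_tensOm θ).lead_eq deg23 p

end

/-! ### Parities and degrees of the table entries -/

theorem deg23_xor_cast : ∀ S T : Fin 16,
    (deg23 (S ^^^ T) : ZMod 2) = (deg23 S : ZMod 2) + (deg23 T : ZMod 2) := by decide +kernel

theorem xor_mask_cancel : ∀ (U T : Fin 16) (V : Fin 16), T ^^^ (U ^^^ V) ^^^ V = T ^^^ U := by
  decide +kernel

/-- Each generator, and its product with `θ_0`, is homogeneous. The degree is taken in `Fin 5` so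
that its existence is decidable. -/
theorem exists_degree_gen : ∀ j, (∃ n : Fin 5, ∀ t ∈ genTerms j, popCount t.2.1.val = n.val) ∧
    ∃ n : Fin 5, ∀ t ∈ mulTerms 1 (genTerms j), popCount t.2.1.val = n.val := by decide +kernel

/-- The first weight modulo 2 is the `ℤ/2`-degree of a generator. Here this is checked on the
functionals, below on the generators; both are needed for `partE_eq`. -/
theorem dualTerms_parity : ∀ j, ∀ f ∈ dualTerms j,
    (deg23 (parity f.2) : ZMod 2) = ((genWeight j).1 : ZMod 2) := by decide +kernel

theorem genTerms_parity : ∀ j, ∀ f ∈ genTerms j,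
    (deg23 (parity f.2) : ZMod 2) = ((genWeight j).1 : ZMod 2) := by decide +kernel

theorem derMask_parity : ∀ s,
    (deg23 (derMask s) : ZMod 2) = ((weight (Sum.inr s)).1 : ZMod 2) ∧
      (deg23 (derMask s ^^^ 1) : ZMod 2) = ((weight (Sum.inr s)).1 : ZMod 2) := by decide +kernel

theorem anchorTerms_parity {U T : Fin 16} {f : ℤ × Fin 16 × Fin 7} (hf : f ∈ anchorTerms U T) :
    parity f.2 = T ^^^ U := by
  obtain ⟨a, -, rfl⟩ := List.mem_map.1 hf
  exact xor_mask_cancel U T (mask a)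

theorem omTerms_parity {U T : Fin 16} {f : ℤ × Fin 16 × Fin 7} (hf : f ∈ omTerms U T) :
    parity f.2 = T ^^^ U := by
  rcases List.mem_cons.1 hf with rfl | hf
  · have h : ∀ S : Fin 16, S ^^^ mask 0 = S := by decide +kernel
    exact h _
  · exact anchorTerms_parity hf

section

variable {A : Type*} [CommRing A] [Algebra ℝ A] {W : Type*} [AddCommGroup W] [Module A W]
  {c : Set (LinearMap.BilinForm A W)} {θ : Module.Basis (Fin 4) A W} (hθ : IsConfFrame c θ)

/-! ### The degree and the parity of the components -/

theorem isBooleanFamily_sumE : IsBooleanFamily (sumE θ hθ) where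
  inf := (isSeparated_compE hθ).supOn_inf
  sup K K' := by simp only [sumE, IsSeparated.supOn]; exact iSup_union.symm
  empty := by simp [sumE, IsSeparated.supOn]
  univ := (isSeparated_compE hθ).supOn_univ

theorem map_toE_le {S : Submodule A (L c)} {n : ℕ} (h : S ≤ gradeL c n) :
    S.map (toE c) ≤ gradeE c n := Submodule.map_mono h

theorem map_mulTh0_map_toE (S : Submodule A (L c)) :
    (S.map (toE c)).map (mulTh0 c θ) =
      (S.map (Algebra.lsmul A A (L c) (mono θ 1))).map (toE c) := by
  rw [← Submodule.map_comp, ← Submodule.map_comp]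
  congr 1
  refine LinearMap.ext fun u => ?_
  rw [LinearMap.comp_apply, LinearMap.comp_apply, mulTh0_apply, ← toE_smul,
    show th0 θ = mono θ 1 from (mono_bit θ 0).symm]
  rfl

theorem exists_compE_le (i : Fin 40 ⊕ Fin 8) :
    (∃ n, compE hθ i ≤ gradeE c n) ∧ ∃ n, (compE hθ i).map (mulTh0 c θ) ≤ gradeE c n := by
  rw [compE, map_mulTh0_map_toE]
  rcases i with j | s
  · obtain ⟨⟨n, hn⟩, m, hm⟩ := exists_degree_gen j
    refine ⟨⟨n, map_toE_le ?_⟩, m, map_toE_le ?_⟩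
    · exact (Submodule.span_singleton_le_iff_mem _ _).2 (toL_mem_gradeL hθ hn)
    · rw [XL, Sum.elim_inl, Submodule.map_span, Set.image_singleton]
      refine (Submodule.span_singleton_le_iff_mem _ _).2 ?_
      change mono θ 1 • toL hθ (genTerms j) ∈ _
      rw [← toL_mulTerms]
      exact toL_mem_gradeL hθ hm
  · have h : ∀ (S : Fin 16) (D), derL hθ S D ∈ gradeL c (popCount S) := fun S D =>
      Submodule.subset_span ⟨_, mono_mem_extPow θ S, _, rfl⟩
    refine ⟨⟨popCount (derMask s), map_toE_le ?_⟩, popCount (derMask s ^^^ 1 : Fin 16),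
      map_toE_le ?_⟩
    · rintro _ ⟨D, rfl⟩
      exact h _ D
    · rintro _ ⟨_, ⟨D, rfl⟩, rfl⟩
      change mono θ 1 • derL hθ (derMask s) D ∈ _
      rw [mono_one_smul_derL]
      exact h _ D

theorem isGradedSubspace_sumE (K : Set (Fin 40 ⊕ Fin 8)) :
    IsGradedSubspace (gradeE c) (sumE θ hθ K) := by
  refine isGradedSubspace_iSup fun i => isGradedSubspace_iSup fun _ => ?_
  obtain ⟨⟨n, hn⟩, m, hm⟩ := exists_compE_le hθ i
  rw [sup_eq_iSup]
  refine isGradedSubspace_iSup fun b => ?_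
  cases b
  · exact isGradedSubspace_of_le hm
  · exact isGradedSubspace_of_le hn

omit [Algebra ℝ A] in
theorem mem_frameDecomp {j : ZMod 2} {w : W} (hw : w ∈ frameDecomp θ 0 1 2 3 j) {i : Fin 4}
    (hi : (deg23 (bit i) : ZMod 2) ≠ j) : θ.repr w i = 0 := by
  have key : ∀ a b : Fin 4, w ∈ Submodule.span A {θ a, θ b} → i ≠ a → i ≠ b →
      θ.repr w i = 0 := by
    intro a b hw ha hb
    obtain ⟨r, s, rfl⟩ := Submodule.mem_span_pair.1 hw
    simp [ha.symm, hb.symm]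
  have hj : ∀ j : ZMod 2, j = 0 ∨ j = 1 := by decide
  rcases hj j with rfl | rfl
  · rw [frameDecomp_zero] at hw
    refine key 0 1 hw ?_ ?_ <;> rintro rfl <;> exact hi (by decide +kernel)
  · rw [frameDecomp_one] at hw
    refine key 2 3 hw ?_ ?_ <;> rintro rfl <;> exact hi (by decide +kernel)

omit [Algebra ℝ A] in
theorem basis_mem_frameDecomp (i : Fin 4) :
    θ i ∈ frameDecomp θ 0 1 2 3 (deg23 (bit i) : ZMod 2) := by
  have h : ∀ i : Fin 4, ((deg23 (bit i) : ZMod 2) = 0 ∧ (i = 0 ∨ i = 1)) ∨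
      ((deg23 (bit i) : ZMod 2) = 1 ∧ (i = 2 ∨ i = 3)) := by decide +kernel
  rcases h i with ⟨h1, rfl | rfl⟩ | ⟨h1, rfl | rfl⟩
  · rw [h1, frameDecomp_zero]; exact Submodule.subset_span (by simp)
  · rw [h1, frameDecomp_zero]; exact Submodule.subset_span (by simp)
  · rw [h1, frameDecomp_one]; exact Submodule.subset_span (by simp)
  · rw [h1, frameDecomp_one]; exact Submodule.subset_span (by simp)

theorem sigCoord_part {b : ZMod 2} {x : CDerEnd c}
    (hx : x ∈ CDerEnd.part c (frameDecomp θ 0 1 2 3) b) {a : Fin 7}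
    (ha : (deg23 (mask a) : ZMod 2) ≠ b) : sigCoord c θ a x = 0 := by
  refine mem_frameDecomp (hx _ _ (basis_mem_frameDecomp (ends a).2)) fun h => ha ?_
  rw [mask, deg23_xor_cast, h, add_right_comm, CharTwo.add_self_eq_zero, zero_add]

/-- An odd `x` maps both `θ_0` and `f θ_0` into `W_1`, so `D(f) θ_0` lies in `W_0 ∩ W_1` and `D(f) =
0`. -/
theorem sym_part {b : ZMod 2} {x : CDerEnd c}
    (hx : x ∈ CDerEnd.part c (frameDecomp θ 0 1 2 3) b) (hb : 0 ≠ b) : x.sym = 0 := by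
  ext f
  have h0 : θ 0 ∈ frameDecomp θ 0 1 2 3 0 := basis_mem_frameDecomp 0
  have h1 := hx 0 _ (Submodule.smul_mem _ f h0)
  rw [x.op_smul] at h1
  have h2 := (Submodule.add_mem_iff_left _ (Submodule.smul_mem _ f (hx 0 _ h0))).1 h1
  have := mem_frameDecomp h2 (i := 0) (by rwa [zero_add])
  simpa using this

theorem sig_mem_part (a : Fin 7) :
    sig hθ a ∈ CDerEnd.part c (frameDecomp θ 0 1 2 3) (deg23 (mask a) : ZMod 2) := by
  have h1 : (sig hθ a).sym = 0 := sym_sig hθ a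
  have key : ∀ i, (sig hθ a).op (θ i) ∈
      frameDecomp θ 0 1 2 3 ((deg23 (bit i) : ZMod 2) + (deg23 (mask a) : ZMod 2)) := by
    intro i
    rw [op_sig]
    by_cases h : actSign a i = 0
    · rw [h, zero_smul]; exact zero_mem _
    · rw [← deg23_xor_cast, ← bit_actIdx a i h]
      exact zsmul_mem (basis_mem_frameDecomp _) _
  have pair : ∀ (p q : Fin 4) (i : ZMod 2), (deg23 (bit p) : ZMod 2) = i →
      (deg23 (bit q) : ZMod 2) = i → ∀ w ∈ Submodule.span A {θ p, θ q},
      (sig hθ a).op w ∈ frameDecomp θ 0 1 2 3 (i + (deg23 (mask a) : ZMod 2)) := by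
    rintro p q i hp hq w hw
    obtain ⟨r, s, rfl⟩ := Submodule.mem_span_pair.1 hw
    rw [map_add, CDerEnd.op_smul, CDerEnd.op_smul, h1]
    simp only [Derivation.coe_zero, Pi.zero_apply, zero_smul, zero_add]
    exact add_mem (Submodule.smul_mem _ r (hp ▸ key p)) (Submodule.smul_mem _ s (hq ▸ key q))
  intro j w hw
  have hj : ∀ j : ZMod 2, j = 0 ∨ j = 1 := by decide
  rcases hj j with rfl | rfl
  · rw [frameDecomp_zero] at hw
    exact pair 0 1 0 (by decide +kernel) (by decide +kernel) w hw
  · rw [frameDecomp_one] at hw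
    exact pair 2 3 1 (by decide +kernel) (by decide +kernel) w hw

theorem der_mem_part (D : Derivation ℝ A A) :
    der hθ D ∈ CDerEnd.part c (frameDecomp θ 0 1 2 3) 0 := by
  have pair : ∀ (p q : Fin 4), ∀ w ∈ Submodule.span A {θ p, θ q},
      (der hθ D).op w ∈ Submodule.span A {θ p, θ q} := by
    rintro p q w hw
    obtain ⟨r, s, rfl⟩ := Submodule.mem_span_pair.1 hw
    rw [map_add, CDerEnd.op_smul, CDerEnd.op_smul, op_der, op_der, smul_zero, smul_zero, add_zero,
      add_zero]
    exact add_mem (Submodule.smul_mem _ _ (Submodule.subset_span (by simp)))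
      (Submodule.smul_mem _ _ (Submodule.subset_span (by simp)))
  intro j w hw
  rw [add_zero]
  have hj : ∀ j : ZMod 2, j = 0 ∨ j = 1 := by decide
  rcases hj j with rfl | rfl
  · rw [frameDecomp_zero] at hw ⊢; exact pair _ _ w hw
  · rw [frameDecomp_one] at hw ⊢; exact pair _ _ w hw

theorem mono_tmul_mem_partL (S : Fin 16) {b : ZMod 2} {x : CDerEnd c}
    (hx : x ∈ CDerEnd.part c (frameDecomp θ 0 1 2 3) b) :
    mono θ S ⊗ₜ x ∈ partL c (frameDecomp θ 0 1 2 3) ((deg23 S : ZMod 2) + b) := by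
  refine Submodule.subset_span ⟨_, b, rfl, mono θ S, ?_, x, hx, rfl⟩
  rw [extPart_eq]
  exact mono_mem_monoSpan θ (K := {T | (deg23 T : ZMod 2) = deg23 S}) rfl

theorem elt_mem_partL (k : Fin 16 × Fin 7) :
    elt hθ k ∈ partL c (frameDecomp θ 0 1 2 3) (deg23 (parity k) : ZMod 2) := by
  rw [parity, deg23_xor_cast]
  exact mono_tmul_mem_partL _ (sig_mem_part hθ k.2)

theorem derL_mem_partL (S : Fin 16) (D : Derivation ℝ A A) :
    derL hθ S D ∈ partL c (frameDecomp θ 0 1 2 3) (deg23 S : ZMod 2) := by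
  have := mono_tmul_mem_partL S (der_mem_part hθ D)
  rwa [add_zero] at this

theorem coef_partL {i : ZMod 2} {u : L c} (hu : u ∈ partL c (frameDecomp θ 0 1 2 3) i)
    {k : Fin 16 × Fin 7} (hk : (deg23 (parity k) : ZMod 2) ≠ i) : coef c θ k u = 0 := by
  refine LinearMap.mem_ker.1 ((Submodule.span_le (p := LinearMap.ker (coef c θ k))).2 ?_ hu)
  rintro _ ⟨a, b, rfl, w, hw, x, hx, rfl⟩
  change sigCoord c θ k.2 (comp c θ k.1 (w ⊗ₜ x)) = 0
  rw [comp_tmul, map_smul]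
  by_cases h : (deg23 k.1 : ZMod 2) = a
  · rw [sigCoord_part hx fun h' => hk ?_, smul_zero]
    rw [parity, deg23_xor_cast, h, h']
  · rw [extPart_eq] at hw
    rw [(mem_monoSpan θ).1 hw k.1 h, zero_smul]

theorem derComp_partL {i : ZMod 2} {u : L c} (hu : u ∈ partL c (frameDecomp θ 0 1 2 3) i)
    {S : Fin 16} (hS : (deg23 S : ZMod 2) ≠ i) : derComp c θ S u = 0 := by
  refine LinearMap.mem_ker.1 ((Submodule.span_le (p := LinearMap.ker (derComp c θ S))).2 ?_ hu)
  rintro _ ⟨a, b, rfl, w, hw, x, hx, rfl⟩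
  rw [SetLike.mem_coe, LinearMap.mem_ker, derComp_tmul]
  by_cases h : (deg23 S : ZMod 2) = a
  · rw [sym_part hx fun h' => hS ?_, smul_zero]
    rw [h, ← h', add_zero]
  · rw [extPart_eq] at hw
    rw [(mem_monoSpan θ).1 hw S h, zero_smul]

theorem evalTerms_eq_zero {F : List (ℤ × Fin 16 × Fin 7)} {u : L c}
    (h : ∀ f ∈ F, coef c θ f.2 u = 0) : evalTerms c θ F u = 0 := by
  induction F with
  | nil => rfl
  | cons f F ih =>
    rw [evalTerms, LinearMap.add_apply, LinearMap.smul_apply, h f List.mem_cons_self, smul_zero,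
      zero_add]
    exact ih fun g hg => h g (List.mem_cons_of_mem _ hg)

theorem partL_le_kerL {i : ZMod 2} {l : Fin 40 ⊕ Fin 8} (h : ((weight l).1 : ZMod 2) ≠ i) :
    partL c (frameDecomp θ 0 1 2 3) i ≤ kerL c θ l := by
  intro u hu
  rcases l with j | s
  · refine evalTerms_eq_zero fun f hf => coef_partL hu ?_
    rwa [dualTerms_parity j f hf]
  · refine derComp_partL hu ?_
    rwa [(derMask_parity s).2]

theorem mono_one_smul_mem_partL {i : ZMod 2} {u : L c}
    (hu : u ∈ partL c (frameDecomp θ 0 1 2 3) i) :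
    mono θ 1 • u ∈ partL c (frameDecomp θ 0 1 2 3) i := by
  refine (Submodule.span_le (p := (partL c (frameDecomp θ 0 1 2 3) i).comap
    (Algebra.lsmul A A (L c) (mono θ 1)))).2 ?_ hu
  rintro _ ⟨a, b, rfl, w, hw, x, hx, rfl⟩
  refine Submodule.subset_span ⟨a, b, rfl, mono θ 1 * w, ?_, x, hx, rfl⟩
  rw [extPart_eq] at hw ⊢
  refine (Submodule.span_le (p := (monoSpan θ {S | (deg23 S : ZMod 2) = a}).comap
    (LinearMap.mulLeft A (mono θ 1)))).2 ?_ hw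
  rintro _ ⟨S, hS, rfl⟩
  rw [SetLike.mem_coe, Submodule.mem_comap, LinearMap.mulLeft_apply, mono_mul]
  refine zsmul_mem (mono_mem_monoSpan θ ?_) _
  change (deg23 (1 ^^^ S) : ZMod 2) = a
  rw [deg23_xor_cast, show (deg23 1 : ZMod 2) = 0 from rfl, zero_add]
  exact hS

theorem XL_le_partL (l : Fin 40 ⊕ Fin 8) :
    XL hθ l ≤ partL c (frameDecomp θ 0 1 2 3) ((weight l).1 : ZMod 2) := by
  rcases l with j | s
  · refine (Submodule.span_singleton_le_iff_mem _ _).2 (toL_mem hθ fun t ht => ?_)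
    rw [weight, Sum.elim_inl, ← genTerms_parity j t ht]
    exact elt_mem_partL hθ t.2
  · rintro _ ⟨D, rfl⟩
    rw [← (derMask_parity s).1]
    exact derL_mem_partL hθ _ D

/-- An element of parity `i` has nonzero coordinates only at `θ_S σ_a` and `θ_S D` of parity `i`,
while each functional involves a single parity. So the functionals of the other components vanish on
it, and also after multiplication by the even element `θ_0`. -/
theorem partE_eq : partE c (frameDecomp θ 0 1 2 3) =
    fun i => sumE θ hθ {l | ((weight l).1 : ZMod 2) = i} := by
  funext i
  refine le_antisymm ?_ (iSup₂_le ?_)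
  · rintro _ ⟨u, hu, rfl⟩
    refine (isSeparated_compE hθ).mem_supOn.2 fun l hl => ⟨?_, ?_⟩
    · exact (toE_mem_kerE hθ).2 (partL_le_kerL hl hu)
    · rw [mulTh0_apply, show th0 θ = mono θ 1 from (mono_bit θ 0).symm]
      exact (toE_mem_kerE hθ (u := mono θ 1 • u)).2
        (partL_le_kerL hl (mono_one_smul_mem_partL hu))
  · rintro l rfl
    refine sup_le (Submodule.map_mono (XL_le_partL hθ l)) ?_
    rw [compE, map_mulTh0_map_toE]
    refine Submodule.map_mono ?_
    rintro _ ⟨u, hu, rfl⟩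
    exact mono_one_smul_mem_partL (XL_le_partL hθ l hu)

end

/-! ### Matrix entries that separate the first weights 0 and 2 -/

/-- The coefficient of `θ_T` in the image of `θ_U` (for `b = false`) or of `θ_U ⊗ ω` (for `b = true`)
under the representation, as a functional on `ℒ`. -/
def repTerms (b : Bool) (U T : Fin 16) : List (ℤ × Fin 16 × Fin 7) :=
  bif b then omTerms U T else anchorTerms U T

/-- The dual functionals to the generators of weight `(2, _, _)`, in terms of the coefficients of the
representation that map `∧(V 0)` to multiples of `θ_2 θ_3`. -/
def leadDual (j : Fin 40) : List (ℤ × Bool × Fin 16 × Fin 16) :=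
  if j = 5 then [(12, false, 2, 13)] else
  if j = 29 then [(12, false, 1, 13)] else
  if j = 30 then [(-3, true, 0, 13)] else
  if j = 31 then [(3, true, 0, 13), (-12, false, 2, 15)] else
  if j = 38 then [(-4, false, 1, 15)] else
  if j = 39 then [(2, true, 0, 15)] else []

/-- Whatever separates first weight 2 from first weight 0 is visible in how `∧W_0` and `∧W_0 ⊗ Ω`
are mapped out of themselves. The factor 4 comes from `σ_0` acting on `Ω` by 4. The summand `Ω` is
indispensable: for `j = 39` the functional reads off `θ_0 θ_1 θ_2 θ_3 σ_0`, which acts by zero on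
`∧W`. -/
theorem leadDual_spec : ∀ j, (genWeight j).1 = 2 → ∀ S a,
    4 * termCoeff (S, a) (dualTerms j) =
      ((leadDual j).map fun r => r.1 * termCoeff (S, a) (repTerms r.2.1 r.2.2.1 r.2.2.2)).sum := by
  decide +kernel

theorem leadDual_deg : ∀ j, ∀ r ∈ leadDual j, deg23 r.2.2.1 = 0 ∧ deg23 r.2.2.2 ≠ 0 := by
  decide +kernel

/-- The generators of first weight 0 have no matrix entries leading out of `∧W_0` or `∧W_0 ⊗ Ω`. -/
theorem pair_repTerms_gen : ∀ b U, deg23 U = 0 → ∀ T, deg23 T ≠ 0 → ∀ j, (genWeight j).1 = 0 →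
    pair (repTerms b U T) (genTerms j) = 0 := by decide +kernel

theorem derMask_weight : ∀ s,
    ((weight (Sum.inr s)).1 = 0 → deg23 (derMask s) = 0) ∧
      ((weight (Sum.inr s)).1 = 2 → deg23 (derMask s ^^^ 1) ≠ 0) := by decide +kernel

theorem weight_le : ∀ j, (genWeight j).1 ≤ 2 := by decide +kernel

theorem weight_fst_le (l : Fin 40 ⊕ Fin 8) : (weight l).1 ≤ 2 := by
  have h : ∀ s, (weight (Sum.inr s)).1 ≤ 2 := by decide +kernel
  rcases l with j | s
  · exact weight_le j
  · exact h s

/-- For `m ≤ 2` and `p ≥ 1` the congruence already implies `m ≤ p`. This is why the filtration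
conditions are empty beyond `p = 0`. -/
theorem le_and_cast_iff {m p : ℕ} (hp : p ≠ 0) (hm : m ≤ 2) :
    m ≤ p ∧ (m : ZMod 2) = p ↔ (m : ZMod 2) = p := by
  simp only [ZMod.natCast_eq_natCast_iff, Nat.ModEq]
  omega

theorem le_zero_and_cast_iff {m : ℕ} : m ≤ 0 ∧ (m : ZMod 2) = (0 : ℕ) ↔ m = 0 := by
  constructor
  · exact fun h => Nat.le_zero.1 h.1
  · rintro rfl; exact ⟨le_rfl, rfl⟩

section

variable {A : Type*} [CommRing A] [Algebra ℝ A] {W : Type*} [AddCommGroup W] [Module A W]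
  {c : Set (LinearMap.BilinForm A W)} {θ : Module.Basis (Fin 4) A W} (hθ : IsConfFrame c θ)

/-! ### The action on the filtration of the representation space -/

theorem anchor_smul_right (u : L c) (f : A) (a : ExteriorAlgebra A W) :
    anchor c u (f • a) = f • anchor c u a + anchor c u (algebraMap A _ f) * a := by
  induction u using TensorProduct.induction_on with
  | zero => simp
  | add u v hu hv => simp only [map_add, AddMonoidHom.add_apply, hu, hv, smul_add, add_mul]; abel
  | tmul w x =>
    rw [anchor_tmul, anchor_tmul, anchor_tmul, x.onExt_smul, x.onExt_algebraMap, mul_add,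
      mul_smul_comm, mul_smul_comm, mul_assoc, ← Algebra.smul_def, mul_smul_comm, add_comm]

theorem repOm_smul_right (u : L c) (f : A) (y : ExtOm A W) :
    repOm c u (f • y) = f • repOm c u y + anchor c u (algebraMap A _ f) • y := by
  induction u using TensorProduct.induction_on with
  | zero => simp
  | add u v hu hv => simp only [map_add, AddMonoidHom.add_apply, hu, hv, smul_add, add_smul]; abel
  | tmul w x =>
    have h := x.onExtOm_lmul (algebraMap A _ f) y
    rw [algebraMap_smul, x.onExt_algebraMap, algebraMap_smul, algebraMap_smul] at h
    rw [repOm_tmul, repOm_tmul, anchor_tmul, h, x.onExt_algebraMap, smul_add, mul_smul,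
      algebraMap_smul, smul_comm w f, add_comm]

omit [Algebra ℝ A] in
theorem smul_omEquiv (w a : ExteriorAlgebra A W) : w • omEquiv θ a = omEquiv θ (w * a) := by
  rw [omEquiv_apply, omEquiv_apply, TensorProduct.smul_tmul', smul_eq_mul]

include hθ in
theorem anchor_algebraMap_eq (u : L c) (f : A) :
    anchor c u (algebraMap A _ f) = ∑ S, derComp c θ S u f • mono θ S := by
  rw [← (monoBasis θ).sum_repr (anchor c u (algebraMap A _ f))]
  refine Finset.sum_congr rfl fun S _ => ?_
  rw [repr_anchor_algebraMap hθ, monoBasis_apply]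

include hθ in
-- The action is not `A`-linear in `x`, so matrix entries alone do not control it on the `A`-span of
-- monomials. The second hypothesis controls the extra term, in which the derivation components
-- differentiate the coefficients.
theorem repL_mem {K K' : Set (Fin 16)} {u : L c}
    (h : ∀ b, ∀ U ∈ K, ∀ T ∉ K', evalTerms c θ (repTerms b U T) u = 0)
    (h' : ∀ S, derComp c θ S u = 0 ∨ ∀ U ∈ K, wedgeSign S U = 0 ∨ S ^^^ U ∈ K')
    {x : RepSpace A W} (hx : x ∈ (monoSpan θ K).prod (tensOm (monoSpan θ K))) :
    repL c u x ∈ (monoSpan θ K').prod (tensOm (monoSpan θ K')) := by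
  -- This is the extra Leibniz term: the derivative of the coefficient `f`, times the element
  -- itself.
  have hD : ∀ f : A, ∀ a ∈ monoSpan θ K, anchor c u (algebraMap A _ f) * a ∈ monoSpan θ K' := by
    intro f a ha
    refine (Submodule.span_le (p := (monoSpan θ K').comap
      (LinearMap.mulLeft A (anchor c u (algebraMap A _ f))))).2 ?_ ha
    rintro _ ⟨U, hU, rfl⟩
    rw [SetLike.mem_coe, Submodule.mem_comap, LinearMap.mulLeft_apply, anchor_algebraMap_eq hθ,
      Finset.sum_mul]
    refine Submodule.sum_mem _ fun S _ => ?_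
    rcases h' S with hS | hS
    · rw [hS, Derivation.coe_zero, Pi.zero_apply, zero_smul, zero_mul]; exact zero_mem _
    · rw [smul_mul_assoc, mono_mul]
      refine Submodule.smul_mem _ _ ?_
      rcases hS U hU with h0 | h1
      · rw [h0, zero_smul]; exact zero_mem _
      · exact zsmul_mem (mono_mem_monoSpan θ h1) _
  obtain ⟨x, y⟩ := x
  obtain ⟨h1, h2⟩ := Submodule.mem_prod.1 hx
  refine Submodule.mem_prod.2 ⟨?_, ?_⟩
  · change anchor c u x ∈ _
    change x ∈ monoSpan θ K at h1
    clear hx h2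
    induction h1 using Submodule.span_induction with
    | mem a ha =>
      obtain ⟨U, hU, rfl⟩ := ha
      refine (mem_monoSpan θ).2 fun T hT => ?_
      rw [repr_anchor_mono hθ]
      exact h false U hU T hT
    | zero => rw [map_zero]; exact zero_mem _
    | add a b _ _ ha hb => rw [map_add]; exact add_mem ha hb
    | smul f a ha iha =>
      rw [anchor_smul_right]
      exact add_mem (Submodule.smul_mem _ f iha) (hD f a ha)
  · change repOm c u y ∈ _
    change y ∈ _ at h2
    rw [tensOm_eq θ] at h2 ⊢
    obtain ⟨a, ha, e⟩ := h2
    rw [← e, LinearEquiv.coe_coe]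
    clear e h1 hx
    induction ha using Submodule.span_induction with
    | mem a ha =>
      obtain ⟨U, hU, rfl⟩ := ha
      refine ⟨(omEquiv θ).symm (repOm c u (omEquiv θ (mono θ U))), ?_,
        (omEquiv θ).apply_symm_apply _⟩
      refine (mem_monoSpan θ).2 fun T hT => ?_
      rw [omEquiv_apply, repr_repOm_mono hθ]
      exact h true U hU T hT
    | zero => rw [map_zero, map_zero]; exact zero_mem _
    | add a b _ _ ha hb => rw [map_add, map_add]; exact add_mem ha hb
    | smul f a ha iha =>
      rw [map_smul, repOm_smul_right, smul_omEquiv]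
      exact add_mem (Submodule.smul_mem _ f iha) ⟨_, hD f a ha, rfl⟩

include hθ in
-- Each `θ_S σ_a` shifts monomials by its parity, so a matrix entry from `θ_U` to `θ_T` involves
-- only coordinates of parity `T ∆ U`.
theorem repL_partL {i j : ZMod 2} {u : L c} (hu : u ∈ partL c (frameDecomp θ 0 1 2 3) i)
    {x : RepSpace A W} (hx : x ∈ (extPart (frameDecomp θ 0 1 2 3) j).prod
      (tensOm (extPart (frameDecomp θ 0 1 2 3) j))) :
    repL c u x ∈ (extPart (frameDecomp θ 0 1 2 3) (j + i)).prod
      (tensOm (extPart (frameDecomp θ 0 1 2 3) (j + i))) := by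
  rw [extPart_eq] at hx ⊢
  refine repL_mem hθ (fun b U hU T hT => ?_) (fun S => ?_) hx
  · have key : (deg23 (T ^^^ U) : ZMod 2) ≠ i := by
      rw [deg23_xor_cast, show (deg23 U : ZMod 2) = j from hU]
      rintro rfl
      refine hT ?_
      change (deg23 T : ZMod 2) = j + (deg23 T + j)
      rw [add_left_comm, CharTwo.add_self_eq_zero, add_zero]
    refine evalTerms_eq_zero fun f hf => coef_partL hu ?_
    cases b
    · rwa [anchorTerms_parity hf]
    · rwa [omTerms_parity hf]
  · by_cases hS : (deg23 S : ZMod 2) = i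
    · refine Or.inr fun U hU => Or.inr ?_
      change (deg23 (S ^^^ U) : ZMod 2) = j + i
      rw [deg23_xor_cast, hS, show (deg23 U : ZMod 2) = j from hU, add_comm]
    · exact Or.inl (derComp_partL hu hS)

omit [Algebra ℝ A] in
theorem extLead_of_ne_zero {p : ℕ} (hp : p ≠ 0) :
    extLead (frameDecomp θ 0 1 2 3) p = extPart (frameDecomp θ 0 1 2 3) p := by
  rw [extLead_eq, extPart_eq]
  exact congrArg (monoSpan θ) (Set.ext fun S => le_and_cast_iff hp (deg23_le S))

omit [Algebra ℝ A] in
theorem extLead_zero :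
    extLead (frameDecomp θ 0 1 2 3) 0 = monoSpan θ {S | deg23 S = 0} := by
  rw [extLead_eq]
  exact congrArg (monoSpan θ) (Set.ext fun S => le_zero_and_cast_iff)

omit [Algebra ℝ A] in
theorem repLead_le (p : ℕ) : repLead (frameDecomp θ 0 1 2 3) p ≤
    (extPart (frameDecomp θ 0 1 2 3) p).prod (tensOm (extPart (frameDecomp θ 0 1 2 3) p)) := by
  have h : extLead (frameDecomp θ 0 1 2 3) p ≤ extPart (frameDecomp θ 0 1 2 3) p :=
    iSup₂_mono' fun k hk => ⟨k, hk.2, le_rfl⟩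
  refine Submodule.prod_mono h ?_
  rw [tensOm_eq θ, tensOm_eq θ]
  exact Submodule.map_mono h

omit [Algebra ℝ A] in
theorem repLead_of_ne_zero {p : ℕ} (hp : p ≠ 0) : repLead (frameDecomp θ 0 1 2 3) p =
    (extPart (frameDecomp θ 0 1 2 3) p).prod (tensOm (extPart (frameDecomp θ 0 1 2 3) p)) := by
  rw [repLead, extLead_of_ne_zero hp]

include hθ in
-- When `q + p ≠ 0` the target is the full parity part of the representation space, so the
-- requirement is automatic.
theorem repE_partE {p : ℕ} {e : E c} (he : e ∈ partE c (frameDecomp θ 0 1 2 3) p) {q : ℕ}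
    (hpq : q + p ≠ 0) {x : RepSpace A W} (hx : x ∈ repLead (frameDecomp θ 0 1 2 3) q) :
    repE c e x ∈ repLead (frameDecomp θ 0 1 2 3) (q + p) := by
  obtain ⟨u, hu, rfl⟩ := he
  rw [repLead_of_ne_zero hpq, Nat.cast_add]
  exact repL_partL hθ hu (repLead_le q hx)

include hθ in
theorem leadE_of_ne_zero {p : ℕ} (hp : p ≠ 0) :
    leadE c (frameDecomp θ 0 1 2 3) p = partE c (frameDecomp θ 0 1 2 3) p :=
  le_antisymm (fun _ he => he.1) fun _ he =>
    ⟨he, fun q _ hx => repE_partE hθ he (by omega) hx⟩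

include hθ in
theorem mem_leadE_zero {e : E c} : e ∈ leadE c (frameDecomp θ 0 1 2 3) 0 ↔
    e ∈ partE c (frameDecomp θ 0 1 2 3) 0 ∧
      ∀ x ∈ repLead (frameDecomp θ 0 1 2 3) 0, repE c e x ∈ repLead (frameDecomp θ 0 1 2 3) 0 := by
  have e0 : ((0 : ℕ) : ZMod 2) = 0 := rfl
  constructor
  · exact fun he => ⟨e0 ▸ he.1, he.2 0⟩
  · intro he
    refine ⟨e0.symm ▸ he.1, fun q x hx => ?_⟩
    rcases eq_or_ne q 0 with rfl | hq
    · exact he.2 x hx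
    · exact repE_partE hθ (p := 0) (e0.symm ▸ he.1) hq hx

include hθ in
-- Monomials detect the matrix entries, and functions, which belong to `F_{◁0}`, detect the
-- derivation components.
theorem preserves_repLead_zero {u : L c} :
    (∀ x ∈ repLead (frameDecomp θ 0 1 2 3) 0, repL c u x ∈ repLead (frameDecomp θ 0 1 2 3) 0) ↔
      (∀ b U, deg23 U = 0 → ∀ T, deg23 T ≠ 0 → evalTerms c θ (repTerms b U T) u = 0) ∧
        ∀ S, deg23 S ≠ 0 → derComp c θ S u = 0 := by
  rw [repLead, extLead_zero]
  constructor
  · intro h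
    refine ⟨fun b U hU T hT => ?_, fun S hS => ?_⟩
    · have hm : mono θ U ∈ monoSpan θ {S | deg23 S = 0} := mono_mem_monoSpan θ hU
      cases b
      · have := (Submodule.mem_prod.1 (h (mono θ U, 0) ⟨hm, zero_mem _⟩)).1
        have := (mem_monoSpan θ).1 this T hT
        rwa [repL_apply, repr_anchor_mono hθ] at this
      · have := (Submodule.mem_prod.1 (h (0, mono θ U ⊗ₜ volEl θ)
          ⟨zero_mem _, Submodule.subset_span ⟨_, hm, _, rfl⟩⟩)).2
        rw [tensOm_eq θ] at this
        obtain ⟨a, ha, e⟩ := this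
        have h1 := (mem_monoSpan θ).1 ha T hT
        rw [← (omEquiv θ).symm_apply_apply a] at h1
        rw [LinearEquiv.coe_coe] at e
        rw [e, repL_apply, repr_repOm_mono hθ] at h1
        exact h1
    · ext f
      have hm : algebraMap A _ f ∈ monoSpan θ {S | deg23 S = 0} := by
        rw [Algebra.algebraMap_eq_smul_one]
        exact Submodule.smul_mem _ f (mono_mem_monoSpan θ (S := 0) rfl)
      have := (Submodule.mem_prod.1 (h (algebraMap A _ f, 0) ⟨hm, zero_mem _⟩)).1
      have := (mem_monoSpan θ).1 this S hS
      rwa [repL_apply, repr_anchor_algebraMap hθ] at this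
  · rintro ⟨h1, h2⟩ x hx
    refine repL_mem hθ (fun b U hU T hT => h1 b U hU T hT) (fun S => ?_) hx
    by_cases hS : deg23 S = 0
    · refine Or.inr fun U hU => ?_
      rcases deg23_xor S U with h | h
      · exact Or.inl h
      · refine Or.inr (h.trans ?_)
        rw [hS, show deg23 U = 0 from hU]
    · exact Or.inl (h2 S hS)

theorem sum_map_evalTerms_apply (R : List (ℤ × Bool × Fin 16 × Fin 16)) (u : L c) :
    (R.map fun r => r.1 • evalTerms c θ (repTerms r.2.1 r.2.2.1 r.2.2.2)).sum u =
      (R.map fun r => r.1 • evalTerms c θ (repTerms r.2.1 r.2.2.1 r.2.2.2) u).sum := by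
  induction R with
  | nil => rfl
  | cons r R ih =>
    rw [List.map_cons, List.sum_cons, LinearMap.add_apply, ih, List.map_cons, List.sum_cons,
      LinearMap.smul_apply]

theorem evalTerms_leadDual {j : Fin 40} (hj : (genWeight j).1 = 2) (hθ : IsConfFrame c θ) (u : L c) :
    (4 : ℤ) • evalTerms c θ (dualTerms j) u =
      ((leadDual j).map fun r =>
        r.1 • evalTerms c θ (repTerms r.2.1 r.2.2.1 r.2.2.2) u).sum := by
  rw [← sum_map_evalTerms_apply, ← LinearMap.smul_apply]
  congr 1
  refine linearMap_ext hθ (fun S D => ?_) fun k => ?_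
  · rw [sum_map_evalTerms_apply, LinearMap.smul_apply, evalTerms_der, smul_zero]
    refine (List.sum_eq_zero fun x hx => ?_).symm
    obtain ⟨r, -, rfl⟩ := List.mem_map.1 hx
    rw [evalTerms_der, smul_zero]
  · have h := congrArg (Int.cast : ℤ → A) (leadDual_spec j hj k.1 k.2)
    rw [Int.cast_mul] at h
    rw [sum_map_evalTerms_apply, LinearMap.smul_apply]
    simp only [evalTerms_elt hθ, zsmul_eq_mul]
    rw [h]
    generalize leadDual j = R
    induction R with
    | nil => exact Int.cast_zero
    | cons r R ih =>
      rw [List.map_cons, List.sum_cons, List.map_cons, List.sum_cons, Int.cast_add, ih,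
        Int.cast_mul]

include hθ in
-- The functional of a component of first weight 2 is, up to a unit, a combination of entries that
-- vanish on preserving elements. For `θ_S D` it is a derivation component along a monomial outside
-- `∧W_0`.
theorem mem_kerL_of_preserves {l : Fin 40 ⊕ Fin 8} (hl : (weight l).1 = 2) {u : L c}
    (h : ∀ x ∈ repLead (frameDecomp θ 0 1 2 3) 0,
      repL c u x ∈ repLead (frameDecomp θ 0 1 2 3) 0) : u ∈ kerL c θ l := by
  obtain ⟨h1, h2⟩ := (preserves_repLead_zero hθ).1 h
  rcases l with j | s
  · refine zsmul_cancel (A := A) (n := 4) (by norm_num) ?_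
    rw [evalTerms_leadDual hl hθ]
    refine List.sum_eq_zero fun x hx => ?_
    obtain ⟨r, hr, rfl⟩ := List.mem_map.1 hx
    obtain ⟨d1, d2⟩ := leadDual_deg j r hr
    rw [h1 r.2.1 _ d1 _ d2, smul_zero]
  · exact h2 _ ((derMask_weight s).2 hl)

theorem XL_preserves {l : Fin 40 ⊕ Fin 8} (hl : (weight l).1 = 0) {u : L c} (hu : u ∈ XL hθ l) :
    ∀ x ∈ repLead (frameDecomp θ 0 1 2 3) 0, repL c u x ∈ repLead (frameDecomp θ 0 1 2 3) 0 := by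
  rw [preserves_repLead_zero hθ]
  rcases l with j | s
  · obtain ⟨f, rfl⟩ := Submodule.mem_span_singleton.1 hu
    refine ⟨fun b U hU T hT => ?_, fun S _ => ?_⟩
    · rw [map_smul, evalTerms_toL, pair_repTerms_gen b U hU T hT j hl, Int.cast_zero, smul_zero]
    · rw [map_smul, derComp_toL, smul_zero]
  · obtain ⟨D, rfl⟩ := hu
    refine ⟨fun b U hU T hT => evalTerms_der hθ _ _ D, fun S hS => ?_⟩
    rw [derL_apply, derComp_tmul, monoBasis_repr_mono, if_neg, zero_smul]
    rintro rfl
    exact hS ((derMask_weight s).1 hl)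

/-- Holds because `θ_0 ∈ W_0`. It is needed because membership in a sum of components is tested on
both `e` and `θ_0 e`. -/
theorem th0_smul_preserves {e : E c}
    (h : ∀ x ∈ repLead (frameDecomp θ 0 1 2 3) 0, repE c e x ∈ repLead (frameDecomp θ 0 1 2 3) 0) :
    ∀ x ∈ repLead (frameDecomp θ 0 1 2 3) 0,
      repE c (mulTh0 c θ e) x ∈ repLead (frameDecomp θ 0 1 2 3) 0 := by
  intro x hx
  obtain ⟨u, rfl⟩ := toE_surjective e
  have hm : ∀ a ∈ extLead (frameDecomp θ 0 1 2 3) 0,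
      th0 θ * a ∈ extLead (frameDecomp θ 0 1 2 3) 0 := by
    intro a ha
    refine extLead_mul_le θ 0 0 (Submodule.mul_mem_mul ?_ ha)
    rw [extLead_zero, show th0 θ = mono θ 1 from (mono_bit θ 0).symm]
    exact mono_mem_monoSpan θ rfl
  have e1 : repE c (mulTh0 c θ (toE c u)) x = th0 θ • repE c (toE c u) x := repL_smul (th0 θ) u x
  rw [e1]
  obtain ⟨h1, h2⟩ := Submodule.mem_prod.1 (h x hx)
  refine Submodule.mem_prod.2 ⟨hm _ h1, ?_⟩
  rw [tensOm_eq θ] at h2 ⊢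
  obtain ⟨a, ha, e⟩ := h2
  refine ⟨th0 θ * a, hm a ha, ?_⟩
  rw [LinearEquiv.coe_coe] at e ⊢
  rw [← smul_omEquiv, e]
  rfl

/-- For `p ≥ 1` only parity matters. For `p = 0` an even element has components of first weight 0
and 2 only, and preserving `∧W_0` and `∧W_0 ⊗ Ω` is exactly what rules out weight 2. -/
theorem leadE_eq : leadE c (frameDecomp θ 0 1 2 3) =
    fun p => sumE θ hθ {l | (weight l).1 ≤ p ∧ ((weight l).1 : ZMod 2) = p} := by
  funext p
  rcases eq_or_ne p 0 with rfl | hp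
  · simp only [le_zero_and_cast_iff]
    refine le_antisymm (fun e he => ?_) (iSup₂_le fun l (hl : (weight l).1 = 0) => ?_)
    · obtain ⟨h1, h2⟩ := (mem_leadE_zero hθ).1 he
      rw [partE_eq hθ] at h1
      have h3 := (isSeparated_compE hθ).mem_supOn.1 h1
      have key : ∀ e : E c, (∀ x ∈ repLead (frameDecomp θ 0 1 2 3) 0,
          repE c e x ∈ repLead (frameDecomp θ 0 1 2 3) 0) → ∀ l, (weight l).1 = 2 →
          e ∈ kerE c θ l := by
        intro e h l hl
        obtain ⟨u, rfl⟩ := toE_surjective e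
        exact (toE_mem_kerE hθ).2 (mem_kerL_of_preserves hθ hl h)
      refine (isSeparated_compE hθ).mem_supOn.2 fun l (hl : ¬ (weight l).1 = 0) => ?_
      by_cases h2' : (weight l).1 = 2
      · exact ⟨key e h2 l h2', key _ (th0_smul_preserves h2) l h2'⟩
      -- Weights are at most 2, so only weight 1 is left, and it is excluded by parity.
      · have hw : (weight l).1 = 1 := by
          have := weight_fst_le l
          omega
        refine h3 l fun h' => ?_
        change ((weight l).1 : ZMod 2) = 0 at h'
        rw [hw] at h'
        exact one_ne_zero h'
    · have h0 : compE hθ l ⊔ (compE hθ l).map (mulTh0 c θ) ≤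
          partE c (frameDecomp θ 0 1 2 3) 0 := by
        rw [partE_eq hθ]
        refine le_biSup (fun l => compE hθ l ⊔ (compE hθ l).map (mulTh0 c θ)) ?_
        change ((weight l).1 : ZMod 2) = 0
        rw [hl]; rfl
      have h1 : ∀ e ∈ compE hθ l, ∀ x ∈ repLead (frameDecomp θ 0 1 2 3) 0,
          repE c e x ∈ repLead (frameDecomp θ 0 1 2 3) 0 := by
        rintro _ ⟨u, hu, rfl⟩
        exact XL_preserves hθ hl hu
      refine sup_le (fun e he => ?_) ?_
      · exact (mem_leadE_zero hθ).2 ⟨h0 (Submodule.mem_sup_left he), h1 e he⟩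
      · rintro _ ⟨e, he, rfl⟩
        exact (mem_leadE_zero hθ).2 ⟨h0 (Submodule.mem_sup_right ⟨e, he, rfl⟩),
          th0_smul_preserves (h1 e he)⟩
  · rw [leadE_of_ne_zero hθ hp, partE_eq hθ]
    exact congrArg (sumE θ hθ) (Set.ext fun l => (le_and_cast_iff hp (weight_fst_le l)).symm)

end

/-! ### Graded commutativity, and induction along `ofLead` -/

theorem wedgeSign_comm : ∀ S T : Fin 16,
    wedgeSign T S = (-1) ^ (popCount S * popCount T) * wedgeSign S T := by decide +kernel

theorem ofLead_induction {A X : Type*} [CommRing A] [AddCommGroup X] [Module A X]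
    {L : ℕ → Submodule A X} {p : ℕ} {motive : X → Prop} (h : ∀ q ≤ p, ∀ x ∈ L q, motive x)
    (h' : ∀ x y, motive x → motive y → motive (x + y)) {x : X} (hx : x ∈ ofLead L p) :
    motive x := by
  cases p with
  | zero => exact h 0 le_rfl x hx
  | succ p =>
    obtain ⟨y, hy, z, hz, rfl⟩ := Submodule.mem_sup.1 hx
    exact h' y z (h _ le_rfl y hy) (h p p.le_succ z hz)

theorem le_ofLead {A X : Type*} [CommRing A] [AddCommGroup X] [Module A X]
    (L : ℕ → Submodule A X) (p : ℕ) : L p ≤ ofLead L p := by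
  cases p with
  | zero => exact le_rfl
  | succ p => exact le_sup_left

section

variable {A : Type*} [CommRing A] [Algebra ℝ A] {W : Type*} [AddCommGroup W] [Module A W]
  {c : Set (LinearMap.BilinForm A W)} {θ : Module.Basis (Fin 4) A W} (hθ : IsConfFrame c θ)

/-! ### Brackets -/

omit [Algebra ℝ A] in
include θ in
theorem graded_comm {n m : ℕ} {w a : ExteriorAlgebra A W} (hw : w ∈ ⋀[A]^n W)
    (ha : a ∈ ⋀[A]^m W) : a * w = (-1 : A) ^ (n * m) • (w * a) := by
  rw [extPow_eq_span θ] at hw ha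
  induction hw using Submodule.span_induction with
  | zero => simp
  | add u v _ _ hu hv => rw [mul_add, add_mul, hu, hv, smul_add]
  | smul r u _ hu => rw [mul_smul_comm, hu, smul_mul_assoc, smul_comm]
  | mem w hw =>
    obtain ⟨S, rfl, rfl⟩ := hw
    induction ha using Submodule.span_induction with
    | zero => simp
    | add u v _ _ hu hv => rw [mul_add, add_mul, hu, hv, smul_add]
    | smul r u _ hu => rw [mul_smul_comm, smul_mul_assoc, hu, smul_comm]
    | mem a ha =>
      obtain ⟨T, rfl, rfl⟩ := ha
      have hx : ∀ S T : Fin 16, S ^^^ T = T ^^^ S := by decide +kernel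
      rw [mono_mul, mono_mul, wedgeSign_comm, mul_smul, hx T S,
        ← Int.cast_smul_eq_zsmul A ((-1) ^ _)]
      norm_cast

include θ in
-- The bracket of `ℒ` is written without signs; for homogeneous `w` and `a` it acts as the graded
-- commutator, once `a` has been moved past `w` and past `δ'(w)`, which has the same degree as `w`.
theorem repL_bracketL_tmul {n m : ℕ} {w a : ExteriorAlgebra A W} (hw : w ∈ ⋀[A]^n W)
    (ha : a ∈ ⋀[A]^m W) (x y : CDerEnd c) (z : RepSpace A W) :
    repL c (bracketL c (w ⊗ₜ x) (a ⊗ₜ y)) z =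
      repL c (w ⊗ₜ x) (repL c (a ⊗ₜ y) z) -
        (-1 : A) ^ (n * m) • repL c (a ⊗ₜ y) (repL c (w ⊗ₜ x) z) := by
  have hs : (-1 : A) ^ (n * m) * (-1) ^ (n * m) = 1 := by
    rw [← mul_pow, neg_one_mul, neg_neg, one_pow]
  have h1 := graded_comm (θ := θ) hw ha
  have h2 := graded_comm (θ := θ) (y.onExt_mem n hw) ha
  obtain ⟨z, z'⟩ := z
  have e : anchor c (bracketL c (w ⊗ₜ x) (a ⊗ₜ y)) z =
      anchor c (w ⊗ₜ x) (anchor c (a ⊗ₜ y) z) -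
        (-1 : A) ^ (n * m) • anchor c (a ⊗ₜ y) (anchor c (w ⊗ₜ x) z) := by
    simp only [bracketL_tmul_tmul, map_add, map_sub, AddMonoidHom.add_apply,
      AddMonoidHom.sub_apply, anchor_tmul, CDerEnd.onExt_comm, CDerEnd.onExt_mul, mul_add, mul_sub,
      ← mul_assoc, h1, h2, smul_mul_assoc, smul_add, smul_smul, hs, one_smul]
    abel
  have e' : repOm c (bracketL c (w ⊗ₜ x) (a ⊗ₜ y)) z' =
      repOm c (w ⊗ₜ x) (repOm c (a ⊗ₜ y) z') -
        (-1 : A) ^ (n * m) • repOm c (a ⊗ₜ y) (repOm c (w ⊗ₜ x) z') := by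
    simp only [bracketL_tmul_tmul, map_add, map_sub, AddMonoidHom.add_apply,
      AddMonoidHom.sub_apply, repOm_tmul, CDerEnd.onExtOm_comm, CDerEnd.onExtOm_lmul, smul_add,
      smul_sub, smul_smul, h1, h2]
    simp only [smul_assoc, ← smul_assoc ((-1 : A) ^ (n * m)) ((-1 : A) ^ (n * m)), smul_eq_mul, hs,
      one_smul]
    abel
  exact Prod.ext e e'

include θ in
theorem repL_bracketL {n m : ℕ} {u v : L c} (hu : u ∈ gradeL c n) (hv : v ∈ gradeL c m)
    (z : RepSpace A W) :
    repL c (bracketL c u v) z =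
      repL c u (repL c v z) - (-1 : A) ^ (n * m) • repL c v (repL c u z) := by
  induction hu using Submodule.closure_induction with
  | zero => simp
  | add u u' _ _ hu hu' =>
    simp only [map_add, AddMonoidHom.add_apply, hu, hu', smul_add]
    abel
  | smul_mem r u hu =>
    obtain ⟨w, hw, x, rfl⟩ := hu
    induction hv using Submodule.closure_induction with
    | zero => simp
    | add v v' _ _ hv hv' =>
      simp only [map_add, AddMonoidHom.add_apply, hv, hv', smul_add]
      abel
    | smul_mem s v hv =>
      obtain ⟨a, ha, y, rfl⟩ := hv
      rw [TensorProduct.smul_tmul', TensorProduct.smul_tmul']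
      exact repL_bracketL_tmul (θ := θ) (Submodule.smul_mem _ r hw) (Submodule.smul_mem _ s ha) x y z

theorem comm_mem_part {V : ZMod 2 → Submodule A W} {i j : ZMod 2} {x y : CDerEnd c}
    (hx : x ∈ CDerEnd.part c V i) (hy : y ∈ CDerEnd.part c V j) :
    x.comm y ∈ CDerEnd.part c V (i + j) := by
  intro k w hw
  rw [CDerEnd.op_comm]
  have h1 := hx _ _ (hy k w hw)
  have h2 := hy _ _ (hx k w hw)
  rw [add_assoc] at h1 h2
  rw [add_comm j i] at h1
  exact sub_mem h1 h2

include hθ in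
-- A special case of `repL_partL`, with `x` regarded as the element `1 ⊗ x` of `ℒ`.
theorem onExt_mem_extPart {i j : ZMod 2} {x : CDerEnd c}
    (hx : x ∈ CDerEnd.part c (frameDecomp θ 0 1 2 3) i) {a : ExteriorAlgebra A W}
    (ha : a ∈ extPart (frameDecomp θ 0 1 2 3) j) :
    x.onExt a ∈ extPart (frameDecomp θ 0 1 2 3) (j + i) := by
  have h1 := mono_tmul_mem_partL 0 hx
  rw [show (deg23 0 : ZMod 2) = 0 from rfl, zero_add] at h1
  have h2 := (Submodule.mem_prod.1 (repL_partL hθ h1 (x := (a, 0)) ⟨ha, zero_mem _⟩)).1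
  rwa [repL_apply, anchor_tmul, mono_zero, one_mul] at h2

omit [Algebra ℝ A] in
theorem mul_mem_extPart {i j : ZMod 2} {a b : ExteriorAlgebra A W}
    (ha : a ∈ extPart (frameDecomp θ 0 1 2 3) i) (hb : b ∈ extPart (frameDecomp θ 0 1 2 3) j) :
    a * b ∈ extPart (frameDecomp θ 0 1 2 3) (i + j) := by
  rw [extPart_eq] at ha hb ⊢
  have : monoSpan θ {S | (deg23 S : ZMod 2) = i} * monoSpan θ {S | (deg23 S : ZMod 2) = j} ≤
      monoSpan θ {S | (deg23 S : ZMod 2) = i + j} := by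
    rw [monoSpan, monoSpan, Submodule.span_mul_span, Submodule.span_le]
    rintro _ ⟨_, ⟨S, rfl, rfl⟩, _, ⟨T, rfl, rfl⟩, rfl⟩
    change mono θ S * mono θ T ∈ _
    rw [mono_mul]
    exact zsmul_mem (mono_mem_monoSpan θ (deg23_xor_cast S T)) _
  exact this (Submodule.mul_mem_mul ha hb)

include hθ in
theorem bracketL_partL {i j : ZMod 2} {u v : L c} (hu : u ∈ partL c (frameDecomp θ 0 1 2 3) i)
    (hv : v ∈ partL c (frameDecomp θ 0 1 2 3) j) :
    bracketL c u v ∈ partL c (frameDecomp θ 0 1 2 3) (i + j) := by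
  induction hu using Submodule.closure_induction with
  | zero => simp
  | add u u' _ _ hu hu' => rw [map_add, AddMonoidHom.add_apply]; exact add_mem hu hu'
  | smul_mem r u hu =>
    obtain ⟨p, q, rfl, w, hw, x, hx, rfl⟩ := hu
    rw [TensorProduct.smul_tmul']
    replace hw := Submodule.smul_mem _ r hw
    generalize r • w = w at hw
    induction hv using Submodule.closure_induction with
    | zero => simp
    | add v v' _ _ hv hv' => rw [map_add]; exact add_mem hv hv'
    | smul_mem s v hv =>
      obtain ⟨p', q', rfl, a, ha, y, hy, rfl⟩ := hv
      rw [TensorProduct.smul_tmul']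
      replace ha := Submodule.smul_mem _ s ha
      generalize s • a = a at ha
      rw [bracketL_tmul_tmul]
      refine sub_mem (add_mem ?_ ?_) ?_
      · exact Submodule.subset_span ⟨_, _, by ring, _, mul_mem_extPart hw ha, _,
          comm_mem_part hx hy, rfl⟩
      · exact Submodule.subset_span ⟨_, _, by ring, _,
          mul_mem_extPart hw (onExt_mem_extPart hθ hx ha), _, hy, rfl⟩
      · exact Submodule.subset_span ⟨_, _, by ring, _,
          mul_mem_extPart (onExt_mem_extPart hθ hy hw) ha, _, hx, rfl⟩

include hθ in
theorem bracketE_partE {i j : ZMod 2} {x y : E c} (hx : x ∈ partE c (frameDecomp θ 0 1 2 3) i)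
    (hy : y ∈ partE c (frameDecomp θ 0 1 2 3) j) :
    bracketE c x y ∈ partE c (frameDecomp θ 0 1 2 3) (i + j) := by
  obtain ⟨u, hu, rfl⟩ := hx
  obtain ⟨v, hv, rfl⟩ := hy
  exact ⟨_, bracketL_partL hθ hu hv, rfl⟩

include hθ in
-- The one case not settled by parity. Homogeneous elements preserving `F_{◁0}` of the
-- representation space have a graded commutator that preserves it too; the reduction to homogeneous
-- elements uses that this piece is a sum of homogeneous components, by `leadE_eq`.
theorem bracketE_leadE_zero {x y : E c} (hx : x ∈ leadE c (frameDecomp θ 0 1 2 3) 0)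
    (hy : y ∈ leadE c (frameDecomp θ 0 1 2 3) 0) :
    bracketE c x y ∈ leadE c (frameDecomp θ 0 1 2 3) 0 := by
  have hg : IsGradedSubspace (gradeE c) (leadE c (frameDecomp θ 0 1 2 3) 0) := by
    rw [leadE_eq hθ]
    exact isGradedSubspace_sumE hθ _
  have key : ∀ n m, ∀ x ∈ leadE c (frameDecomp θ 0 1 2 3) 0 ⊓ gradeE c n,
      ∀ y ∈ leadE c (frameDecomp θ 0 1 2 3) 0 ⊓ gradeE c m,
      bracketE c x y ∈ leadE c (frameDecomp θ 0 1 2 3) 0 := by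
    rintro n m _ ⟨hx, u, hu, rfl⟩ _ ⟨hy, v, hv, rfl⟩
    have h1 := (mem_leadE_zero hθ).1 hx
    have h2 := (mem_leadE_zero hθ).1 hy
    have h3 := bracketE_partE hθ h1.1 h2.1
    rw [add_zero] at h3
    refine (mem_leadE_zero hθ).2 ⟨h3, fun z hz => ?_⟩
    have a1 : repL c u (repL c v z) ∈ repLead (frameDecomp θ 0 1 2 3) 0 := h1.2 _ (h2.2 z hz)
    have a2 : repL c v (repL c u z) ∈ repLead (frameDecomp θ 0 1 2 3) 0 := h2.2 _ (h1.2 z hz)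
    change repL c (bracketL c u v) z ∈ _
    rw [repL_bracketL (θ := θ) hu hv z]
    exact sub_mem a1 (Submodule.smul_mem _ _ a2)
  rw [hg] at hx
  induction hx using Submodule.iSup_induction' with
  | zero => rw [map_zero]; exact zero_mem _
  | add x x' _ _ hx hx' => rw [map_add, AddMonoidHom.add_apply]; exact add_mem hx hx'
  | mem n x hx =>
    rw [hg] at hy
    induction hy using Submodule.iSup_induction' with
    | zero => rw [map_zero]; exact zero_mem _
    | add y y' _ _ hy hy' => rw [map_add]; exact add_mem hy hy'
    | mem m y hy => exact key n m x hx y hy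

include hθ in
theorem bracketE_leadE {p q : ℕ} {x y : E c} (hx : x ∈ leadE c (frameDecomp θ 0 1 2 3) p)
    (hy : y ∈ leadE c (frameDecomp θ 0 1 2 3) q) :
    bracketE c x y ∈ leadE c (frameDecomp θ 0 1 2 3) (p + q) := by
  rcases eq_or_ne (p + q) 0 with h | h
  · obtain ⟨rfl, rfl⟩ := Nat.add_eq_zero_iff.1 h
    exact bracketE_leadE_zero hθ hx hy
  · rw [leadE_of_ne_zero hθ h, Nat.cast_add]
    exact bracketE_partE hθ hx.1 hy.1

/-! ### The one-index filtration -/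

theorem bkl1_eq (p : ℕ) : bkl1 c θ p = sumE θ hθ {l | (weight l).1 ≤ p} := by
  rw [bkl1, bkl, leadE_eq hθ]
  exact (isBooleanFamily_sumE hθ).ofLead_eq (fun l => (weight l).1) p

include hθ in
theorem isZ2Filtration_bkl :
    IsZ2Filtration (gradeE c) (partE c (frameDecomp θ 0 1 2 3))
      (bkl c (frameDecomp θ 0 1 2 3)) := by
  rw [bkl, leadE_eq hθ, partE_eq hθ]
  exact (isBooleanFamily_sumE hθ).isZ2Filtration (fun l => (weight l).1)
    (isGradedSubspace_sumE hθ) weight_fst_le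

include hθ in
theorem lead_bkl (p : ℕ) :
    lead (partE c (frameDecomp θ 0 1 2 3)) (bkl c (frameDecomp θ 0 1 2 3)) p =
      leadE c (frameDecomp θ 0 1 2 3) p := by
  rw [bkl, leadE_eq hθ, partE_eq hθ]
  exact (isBooleanFamily_sumE hθ).lead_eq (fun l => (weight l).1) p

include hθ in
theorem isGLAFiltration_bkl :
    IsGLAFiltration (gradeE c) (bracketE c) (bkl c (frameDecomp θ 0 1 2 3)) := by
  have h := isZ2Filtration_bkl hθ
  have hm : Monotone (bkl c (frameDecomp θ 0 1 2 3)) := monotone_nat_of_le_succ h.mono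
  refine ⟨h.graded, hm, h.exhaust, fun p q x hx y hy => ?_⟩
  refine ofLead_induction (motive := fun x => bracketE c x y ∈ _) (fun p' hp' x hx => ?_)
    (fun x x' hx hx' => ?_) hx
  · refine ofLead_induction (motive := fun y => bracketE c x y ∈ _) (fun q' hq' y hy => ?_)
      (fun y y' hy hy' => ?_) hy
    · exact hm (add_le_add hp' hq') (le_ofLead _ _ (bracketE_leadE hθ hx hy))
    · rw [map_add]; exact add_mem hy hy'
  · rw [map_add, AddMonoidHom.add_apply]; exact add_mem hx hx'

end

section

variable {A : Type*} [CommRing A] [Algebra ℝ A] {W : Type*} [AddCommGroup W] [Module A W]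
  {c : Set (LinearMap.BilinForm A W)} {θ : Module.Basis (Fin 4) A W} (hθ : IsConfFrame c θ)

/-! ### Cyclic permutations of the basis -/

/-- The cyclic permutation of `1, 2, 3`. -/
def rotPerm : Equiv.Perm (Fin 4) where
  toFun := ![0, 2, 3, 1]
  invFun := ![0, 3, 1, 2]
  left_inv := by decide
  right_inv := by decide

/-- The basis `θ_0, θ_2, θ_3, θ_1`. -/
noncomputable def rotBasis (θ : Module.Basis (Fin 4) A W) : Module.Basis (Fin 4) A W :=
  θ.reindex rotPerm.symm

omit [Algebra ℝ A] in
theorem rotBasis_apply (i : Fin 4) : rotBasis θ i = θ (rotPerm i) := by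
  rw [rotBasis, Module.Basis.reindex_apply, Equiv.symm_symm]

omit [Algebra ℝ A] in
include hθ in
theorem isConfFrame_rotBasis : IsConfFrame c (rotBasis θ) := by
  obtain ⟨g, hg, h, h'⟩ := hθ.exists_rep
  refine ⟨g, hg, fun i j => ?_, h'⟩
  have e : ∀ i, rotPerm i = 0 ↔ i = 0 := by decide
  rw [rotBasis_apply, rotBasis_apply, h, mink, mink]
  simp only [rotPerm.injective.eq_iff, e]

omit [Algebra ℝ A] in
theorem frameDecomp_rotBasis (i j k l : Fin 4) :
    frameDecomp (rotBasis θ) i j k l =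
      frameDecomp θ (rotPerm i) (rotPerm j) (rotPerm k) (rotPerm l) := by
  funext m
  simp only [frameDecomp, rotBasis_apply]

theorem op_boost (i : Fin 3) (j : Fin 4) : (boost hθ i).op (θ j) =
    (if j = 0 then θ i.succ else 0) + (if j = i.succ then θ 0 else 0) := by
  rw [← elem_apply, ← elem_apply]; rfl

theorem op_rot (i k : Fin 3) (j : Fin 4) : (rot hθ i k).op (θ j) =
    (if j = k.succ then θ i.succ else 0) - (if j = i.succ then θ k.succ else 0) := by
  rw [← elem_apply, ← elem_apply]; rfl

theorem rotPerm_symm_eq (j k : Fin 4) : rotPerm.symm j = k ↔ j = rotPerm k :=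
  rotPerm.symm_apply_eq

set_option linter.unusedSimpArgs false in
theorem rotBasis_sigma (hθ' : IsConfFrame c (rotBasis θ)) :
    sigma0 hθ' = sigma0 hθ ∧
    boost hθ' 0 = boost hθ 1 ∧ boost hθ' 1 = boost hθ 2 ∧ boost hθ' 2 = boost hθ 0 ∧
    rot hθ' 0 1 = rot hθ 1 2 ∧ rot hθ' 1 2 = rot hθ 2 0 ∧ rot hθ' 2 0 = rot hθ 0 1 ∧
    ∀ D, der hθ' D = der hθ D := by
  have e : ∀ j, θ j = rotBasis θ (rotPerm.symm j) := fun j => by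
    rw [rotBasis_apply, Equiv.apply_symm_apply]
  have p0 : rotPerm 0 = 0 := rfl
  have p1 : rotPerm 1 = 2 := rfl
  have p2 : rotPerm 2 = 3 := rfl
  have p3 : rotPerm 3 = 1 := rfl
  refine ⟨rfl, ?_, ?_, ?_, ?_, ?_, ?_, fun D => ?_⟩
  · refine cDerEnd_ext (θ := θ) rfl fun j => ?_
    rw [op_boost, e, op_boost]
    simp [rotBasis_apply, rotPerm_symm_eq, p0, p1, p2, p3]
  · refine cDerEnd_ext (θ := θ) rfl fun j => ?_
    rw [op_boost, e, op_boost]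
    simp [rotBasis_apply, rotPerm_symm_eq, p0, p1, p2, p3]
  · refine cDerEnd_ext (θ := θ) rfl fun j => ?_
    rw [op_boost, e, op_boost]
    simp [rotBasis_apply, rotPerm_symm_eq, p0, p1, p2, p3]
  · refine cDerEnd_ext (θ := θ) rfl fun j => ?_
    rw [op_rot, e, op_rot]
    simp [rotBasis_apply, rotPerm_symm_eq, p0, p1, p2, p3]
  · refine cDerEnd_ext (θ := θ) rfl fun j => ?_
    rw [op_rot, e, op_rot]
    simp [rotBasis_apply, rotPerm_symm_eq, p0, p1, p2, p3]
  · refine cDerEnd_ext (θ := θ) rfl fun j => ?_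
    rw [op_rot, e, op_rot]
    simp [rotBasis_apply, rotPerm_symm_eq, p0, p1, p2, p3]
  · refine cDerEnd_ext (θ := θ) rfl fun j => ?_
    rw [op_der, e, op_der]

omit [Algebra ℝ A] in
theorem rotBasis_th : th0 (rotBasis θ) = th0 θ ∧ th (rotBasis θ) 0 = th θ 1 ∧
    th (rotBasis θ) 1 = th θ 2 ∧ th (rotBasis θ) 2 = th θ 0 := by
  simp only [th0, th, rotBasis_apply]
  exact ⟨rfl, rfl, rfl, rfl⟩

theorem mul_cyclic (u v w : W) :
    ExteriorAlgebra.ι A u * ExteriorAlgebra.ι A v * ExteriorAlgebra.ι A w =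
      ExteriorAlgebra.ι A w * ExteriorAlgebra.ι A u * ExteriorAlgebra.ι A v := by
  have h : ExteriorAlgebra.ι A u * ExteriorAlgebra.ι A v ∈ ⋀[A]^2 W := by
    change _ ∈ LinearMap.range (ExteriorAlgebra.ι A) ^ 2
    rw [pow_two]
    exact Submodule.mul_mem_mul ⟨u, rfl⟩ ⟨v, rfl⟩
  rw [even_comm h, mul_assoc]

-- The rows of the table are permuted by the cyclic symmetry. Rows `000` and `222` go to themselves,
-- after reordering the sums and using `θ_2 θ_3 θ_1 = θ_1 θ_2 θ_3`.
set_option linter.unusedSimpArgs false in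
theorem gens_rotBasis_subset (hθ' : IsConfFrame c (rotBasis θ)) (α : ℕ × ℕ × ℕ) :
    gens hθ' α ⊆ gens hθ (α.2.2, α.1, α.2.1) := by
  obtain ⟨s0, b0, b1, b2, r0, r1, r2, hD⟩ := rotBasis_sigma hθ hθ'
  obtain ⟨t, t0, t1, t2⟩ := rotBasis_th (θ := θ)
  have hd : ∀ w, derSet hθ' w = derSet hθ w := fun w => by simp only [derSet, hD]
  unfold gens
  split
  · change gen000 hθ' ⊆ gen000 hθ
    simp only [gen000, s0, b0, b1, b2, r0, r1, r2, hd, t, t0, t1, t2]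
    rintro _ (h | rfl | rfl | rfl | rfl | rfl)
    · exact Or.inl h
    · simp
    · simp
    · simp
    · simp
    · refine Or.inr (Or.inr (Or.inr (Or.inr (Or.inr ?_))))
      rw [Set.mem_singleton_iff]
      abel
  · change gen200 hθ' 0 1 2 ⊆ gen200 hθ 1 2 0
    simp only [gen200, s0, b0, b1, b2, r0, r1, r2, hd, t, t0, t1, t2, subset_rfl]
  · change gen200 hθ' 1 2 0 ⊆ gen200 hθ 2 0 1
    simp only [gen200, s0, b0, b1, b2, r0, r1, r2, hd, t, t0, t1, t2, subset_rfl]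
  · change gen200 hθ' 2 0 1 ⊆ gen200 hθ 0 1 2
    simp only [gen200, s0, b0, b1, b2, r0, r1, r2, hd, t, t0, t1, t2, subset_rfl]
  · change gen011 hθ' 0 1 2 ⊆ gen011 hθ 1 2 0
    simp only [gen011, s0, b0, b1, b2, r0, r1, r2, hd, t, t0, t1, t2, subset_rfl]
  · change gen011 hθ' 1 2 0 ⊆ gen011 hθ 2 0 1
    simp only [gen011, s0, b0, b1, b2, r0, r1, r2, hd, t, t0, t1, t2, subset_rfl]
  · change gen011 hθ' 2 0 1 ⊆ gen011 hθ 0 1 2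
    simp only [gen011, s0, b0, b1, b2, r0, r1, r2, hd, t, t0, t1, t2, subset_rfl]
  · change gen211 hθ' 0 1 2 ⊆ gen211 hθ 1 2 0
    simp only [gen211, s0, b0, b1, b2, r0, r1, r2, hd, t, t0, t1, t2, subset_rfl]
  · change gen211 hθ' 1 2 0 ⊆ gen211 hθ 2 0 1
    simp only [gen211, s0, b0, b1, b2, r0, r1, r2, hd, t, t0, t1, t2, subset_rfl]
  · change gen211 hθ' 2 0 1 ⊆ gen211 hθ 0 1 2
    simp only [gen211, s0, b0, b1, b2, r0, r1, r2, hd, t, t0, t1, t2, subset_rfl]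
  · change gen222 hθ' ⊆ gen222 hθ
    simp only [gen222, s0, b0, b1, b2, r0, r1, r2, hd, t, t0, t1, t2]
    rintro _ (h | rfl | rfl)
    · refine Or.inl ?_
      rwa [th, th, th, mul_cyclic] at h
    · refine Or.inr (Or.inl ?_)
      abel
    · refine Or.inr (Or.inr ?_)
      rw [Set.mem_singleton_iff, th, th, th, mul_cyclic (θ _) (θ _) (θ _)]
      abel
  · exact Set.empty_subset _

/-- An inclusion for each weight suffices. Both families sum to `ℰ` and the larger one is
independent, so the inclusions are equalities. -/
theorem G_rotBasis (hθ' : IsConfFrame c (rotBasis θ)) (α : ℕ × ℕ × ℕ) :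
    G hθ' α = G hθ (α.2.2, α.1, α.2.1) := by
  let e : ℕ × ℕ × ℕ ≃ ℕ × ℕ × ℕ :=
    { toFun := fun α => (α.2.2, α.1, α.2.1)
      invFun := fun α => (α.2.1, α.2.2, α.1)
      left_inv := fun _ => rfl
      right_inv := fun _ => rfl }
  have h : ∀ {θ : Module.Basis (Fin 4) A W} (hθ : IsConfFrame c θ),
      iSupIndep (G hθ) ∧ iSup (G hθ) = ⊤ := fun {θ} hθ => by
    have := (isSeparated_compE hθ).isInternal weight
    rw [DirectSum.isInternal_submodule_iff_iSupIndep_and_iSup_eq_top] at this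
    simpa only [← G_eq] using this
  have h1 : iSupIndep (G hθ ∘ e) := (h hθ).1.comp e.injective
  have h2 : G hθ' ≤ G hθ ∘ e := fun α => by
    have hGG : GG hθ' α ≤ GG hθ (e α) := Submodule.span_mono (gens_rotBasis_subset hθ hθ' α)
    have ht : mulTh0 c (rotBasis θ) = mulTh0 c θ := by rw [mulTh0, rotBasis_th.1, mulTh0]
    rw [G, ht]
    exact sup_le_sup hGG (Submodule.map_mono hGG)
  exact congrFun ((h1.le_iff_eq_of_iSup_eq_top (h hθ').2).1 h2) α

theorem sumE_rotBasis (hθ' : IsConfFrame c (rotBasis θ)) (p : ℕ × ℕ × ℕ → Prop) :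
    sumE (rotBasis θ) hθ' {l | p (weight l)} =
      sumE θ hθ {l | p ((weight l).2.1, (weight l).2.2, (weight l).1)} := by
  rw [← iSup_G, ← iSup_G hθ fun α => p (α.2.1, α.2.2, α.1)]
  refine le_antisymm (iSup₂_le fun α hα => ?_) (iSup₂_le fun α hα => ?_)
  · rw [G_rotBasis hθ hθ']
    exact le_iSup₂_of_le (α.2.2, α.1, α.2.1) hα le_rfl
  · refine le_iSup₂_of_le (α.2.1, α.2.2, α.1) hα ?_
    rw [G_rotBasis hθ hθ']

/-- `F'` only differs from `F` by the frame: `(θ_0, θ_2 | θ_3, θ_1)` is the standard decomposition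
for the rotated basis. Rotating twice gives `F''`. -/
theorem bkl2_eq_rotBasis : bkl2 c θ = bkl1 c (rotBasis θ) := by
  rw [bkl1, frameDecomp_rotBasis]; rfl

theorem bkl3_eq_rotBasis : bkl3 c θ = bkl2 c (rotBasis θ) := by
  rw [bkl2, frameDecomp_rotBasis]; rfl

theorem bkl2_eq (p : ℕ) : bkl2 c θ p = sumE θ hθ {l | (weight l).2.1 ≤ p} := by
  have hθ' := isConfFrame_rotBasis hθ
  rw [bkl2_eq_rotBasis, bkl1_eq hθ', sumE_rotBasis hθ hθ' fun α => α.1 ≤ p]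

theorem bkl3_eq (p : ℕ) : bkl3 c θ p = sumE θ hθ {l | (weight l).2.2 ≤ p} := by
  have hθ' := isConfFrame_rotBasis hθ
  rw [bkl3_eq_rotBasis, bkl2_eq hθ', sumE_rotBasis hθ hθ' fun α => α.2.1 ≤ p]

/-! ### The multi-index filtrations -/

/-- Each factor is a sum of components selected by one entry of the weight, and such sums intersect
like their index sets. -/
theorem bkl23_eq (p : ℕ × ℕ) : bkl23 c θ p = sumE θ hθ {l | (weight l).2 ≤ p} := by
  rw [bkl23, bkl2_eq hθ, bkl3_eq hθ, (isBooleanFamily_sumE hθ).inf]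
  rfl

theorem bkl123_eq (α : ℕ × ℕ × ℕ) : bkl123 c θ α = sumE θ hθ {l | weight l ≤ α} := by
  rw [bkl123, bkl1_eq hθ, bkl2_eq hθ, bkl3_eq hθ, (isBooleanFamily_sumE hθ).inf,
    (isBooleanFamily_sumE hθ).inf]
  refine congrArg _ (Set.ext fun l => ?_)
  exact and_assoc

include hθ in
theorem isGLAFiltration_bkl1 : IsGLAFiltration (gradeE c) (bracketE c) (bkl1 c θ) :=
  isGLAFiltration_bkl hθ

include hθ in
theorem isGLAFiltration_bkl2 : IsGLAFiltration (gradeE c) (bracketE c) (bkl2 c θ) := by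
  rw [bkl2_eq_rotBasis]
  exact isGLAFiltration_bkl1 (isConfFrame_rotBasis hθ)

include hθ in
theorem isGLAFiltration_bkl3 : IsGLAFiltration (gradeE c) (bracketE c) (bkl3 c θ) := by
  rw [bkl3_eq_rotBasis]
  exact isGLAFiltration_bkl2 (isConfFrame_rotBasis hθ)

include hθ in
-- Compatibility with the bracket passes to intersections, but gradedness does not in general; it is
-- taken from the explicit form.
theorem isGLAFiltration_bkl23 : IsGLAFiltration (gradeE c) (bracketE c) (bkl23 c θ) := by
  have h2 := isGLAFiltration_bkl2 hθ
  have h3 := isGLAFiltration_bkl3 hθ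
  refine ⟨fun p => ?_, fun p q h => inf_le_inf (h2.mono h.1) (h3.mono h.2), ?_,
    fun p q x hx y hy => ⟨h2.bracket_mem _ _ x hx.1 y hy.1, h3.bracket_mem _ _ x hx.2 y hy.2⟩⟩
  · rw [bkl23_eq hθ]
    exact isGradedSubspace_sumE hθ _
  · obtain ⟨p, hp⟩ := h2.exhaust
    obtain ⟨q, hq⟩ := h3.exhaust
    exact ⟨(p, q), by rw [bkl23, hp, hq, inf_top_eq]⟩

include hθ in
theorem isGLAFiltration_bkl123 : IsGLAFiltration (gradeE c) (bracketE c) (bkl123 c θ) := by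
  have h1 := isGLAFiltration_bkl1 hθ
  have h2 := isGLAFiltration_bkl2 hθ
  have h3 := isGLAFiltration_bkl3 hθ
  refine ⟨fun p => ?_,
    fun p q h => inf_le_inf (inf_le_inf (h1.mono h.1) (h2.mono h.2.1)) (h3.mono h.2.2), ?_,
    fun p q x hx y hy => ⟨⟨h1.bracket_mem _ _ x hx.1.1 y hy.1.1,
      h2.bracket_mem _ _ x hx.1.2 y hy.1.2⟩, h3.bracket_mem _ _ x hx.2 y hy.2⟩⟩
  · rw [bkl123_eq hθ]
    exact isGradedSubspace_sumE hθ _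
  · obtain ⟨p, hp⟩ := h1.exhaust
    obtain ⟨q, hq⟩ := h2.exhaust
    obtain ⟨r, hr⟩ := h3.exhaust
    exact ⟨(p, q, r), by rw [bkl123, hp, hq, hr, inf_top_eq, inf_top_eq]⟩

theorem leadE_eq_iSup (p : ℕ) : leadE c (frameDecomp θ 0 1 2 3) p =
    ⨆ (α : ℕ × ℕ × ℕ) (_ : ∃ k : ℕ, α.1 + 2 * k = p), G hθ α := by
  rw [iSup_G hθ fun α => ∃ k : ℕ, α.1 + 2 * k = p, leadE_eq hθ]
  refine congrArg (sumE θ hθ) (Set.ext fun l => ?_)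
  simp only [Set.mem_ofPred_eq, ZMod.natCast_eq_natCast_iff, Nat.ModEq]
  constructor
  · rintro ⟨h1, h2⟩
    -- The division is exact, since the weight is at most `p` and congruent to it modulo 2.
    exact ⟨(p - (weight l).1) / 2, by omega⟩
  · rintro ⟨k, hk⟩
    omega

end

end BKL

/-! ### The three statements assembled -/

theorem mainTheorem3
    {M : Type*} [TopologicalSpace M] [T2Space M] [SigmaCompactSpace M]
    [ChartedSpace (EuclideanSpace ℝ (Fin 4)) M] [IsManifold (𝓡 4) ∞ M]
    {W : Type*} [AddCommGroup W] [Module (Smooth M) W]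
    (c : Set (LinearMap.BilinForm (Smooth M) W)) (hc : IsConformalClass c) :
    -- the filtrations associated to an orthogonal decomposition `W = V 0 ⊕ V 1`
    (∀ V : ZMod 2 → Submodule (Smooth M) W, IsOrthDecomp c V →
      -- on `∧W`: the smallest filtration respecting the algebra structure and `W → ∧W`
      IsZ2Filtration (fun n => ⋀[Smooth M]^n W) (extPart V) (ofLead (extLead V)) ∧
      (∀ p, lead (extPart V) (ofLead (extLead V)) p = extLead V p) ∧
      RespectsExt V (extPart V) (ofLead (extLead V)) ∧
      (∀ P F, IsZ2Filtration (fun n => ⋀[Smooth M]^n W) P F → RespectsExt V P F →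
        ∀ p, extLead V p ≤ lead P F p) ∧
      ofLead (extLead V) 2 = ⊤ ∧
      -- on `∧W ⊗ Ω`
      IsZ2Filtration (fun n => tensOm (⋀[Smooth M]^n W)) (fun i => tensOm (extPart V i))
        (ofLead fun p => tensOm (extLead V p)) ∧
      (∀ p, lead (fun i => tensOm (extPart V i)) (ofLead fun p => tensOm (extLead V p)) p =
        tensOm (extLead V p)) ∧
      -- on `ℰ`: the filtration induced through the representation
      IsZ2Filtration (gradeE c) (partE c V) (bkl c V) ∧
      (∀ p, lead (partE c V) (bkl c V) p = leadE c V p) ∧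
      (∀ i j, ∀ x ∈ partE c V i, ∀ y ∈ partE c V j, bracketE c x y ∈ partE c V (i + j)) ∧
      (∀ p q, ∀ x ∈ leadE c V p, ∀ y ∈ leadE c V q, bracketE c x y ∈ leadE c V (p + q)) ∧
      IsGLAFiltration (gradeE c) (bracketE c) (bkl c V)) ∧
    -- the explicit description in a conformally orthonormal basis
    (∀ (θ : Module.Basis (Fin 4) (Smooth M) W) (hθ : IsConfFrame c θ),
      (∀ p, extLead (frameDecomp θ 0 1 2 3) p =
        Submodule.span (Smooth M) (leadMonomials θ p)) ∧
      -- the decompositions `ℰ = ℰ_G ⊕ θ_0 ℰ_G` and `ℰ = ⨁_α G_α ℰ`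
      IsCompl (EG hθ) ((EG hθ).map (mulTh0 c θ)) ∧
      Set.InjOn (mulTh0 c θ) (EG hθ) ∧
      DirectSum.IsInternal (G hθ) ∧
      -- the one-index filtration
      (∀ p, leadE c (frameDecomp θ 0 1 2 3) p =
        ⨆ (α : ℕ × ℕ × ℕ) (_ : ∃ k : ℕ, α.1 + 2 * k = p), G hθ α) ∧
      (∀ p, bkl1 c θ p = ⨆ (α : ℕ × ℕ × ℕ) (_ : α.1 ≤ p), G hθ α) ∧
      -- the 2- and 3-index filtrations
      IsGLAFiltration (gradeE c) (bracketE c) (bkl23 c θ) ∧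
      IsGLAFiltration (gradeE c) (bracketE c) (bkl123 c θ) ∧
      (∀ p : ℕ × ℕ, bkl23 c θ p = ⨆ (α : ℕ × ℕ × ℕ) (_ : α.2 ≤ p), G hθ α) ∧
      (∀ α : ℕ × ℕ × ℕ, bkl123 c θ α = ⨆ (β : ℕ × ℕ × ℕ) (_ : β ≤ α), G hθ β) ∧
      -- freeness over the exterior algebra in the generator `θ_0`
      (Module.Free (Smooth M) (Derivation ℝ (Smooth M) (Smooth M)) →
        (∀ α, IsFreeOverTh0 θ (G hθ α)) ∧ (∀ p, IsFreeOverTh0 θ (bkl23 c θ p)) ∧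
          ∀ α, IsFreeOverTh0 θ (bkl123 c θ α))) := by
  refine ⟨?_, fun θ hθ => ⟨extLead_eq_span θ, ?_, ?_, ?_, leadE_eq_iSup hθ, fun p => ?_,
    isGLAFiltration_bkl23 hθ, isGLAFiltration_bkl123 hθ, fun p => ?_, fun α => ?_,
    fun hfree => ⟨fun α => ?_, fun p => ?_, fun α => ?_⟩⟩⟩
  · rintro V ⟨θ, hθ, rfl⟩
    exact ⟨isZ2Filtration_ext θ, lead_ext θ, respectsExt θ, fun P F hF h => extLead_le hF h,
      ofLead_ext_two θ, isZ2Filtration_tensOm θ, lead_tensOm θ, isZ2Filtration_bkl hθ, lead_bkl hθ,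
      fun i j x hx y hy => bracketE_partE hθ hx hy, fun p q x hx y hy => bracketE_leadE hθ hx hy,
      isGLAFiltration_bkl hθ⟩
  · rw [EG_eq]
    exact (isSeparated_compE hθ).isCompl
  · rw [EG_eq]
    exact (isSeparated_compE hθ).injOn
  · have h := (isSeparated_compE hθ).isInternal weight
    simp only [← G_eq] at h
    exact h
  · rw [bkl1_eq hθ, iSup_G hθ fun α => α.1 ≤ p]
  · rw [bkl23_eq hθ, iSup_G hθ fun α => α.2 ≤ p]
  · rw [bkl123_eq hθ, iSup_G hθ fun β => β ≤ α]
  · rw [G_eq]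
    exact isFreeOverTh0_sumE hθ _
  · rw [bkl23_eq hθ]
    exact isFreeOverTh0_sumE hθ _
  · rw [bkl123_eq hθ]
    exact isFreeOverTh0_sumE hθ _
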